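/- **Setting.** All objects are indexed by the sample size $T\to\infty$; the dependence on $T$ is mostly suppressed. Let $p=p_T\ge 2$ (for large $T$), let $(x_t)_{t\in\mathbb Z}$, $x_t=(x_{t,1},\dots,x_{t,p})^\top$, be a process of real random variables on a probability space, and let $G=G_T\subset[p]=\{1,\dots,p\}$ have a fixed number of elements. Assume that $\Sigma=\mathbb E[x_tx_t^\top]$ does not depend on $t$ and that, for a constant $\gamma_0>0$ independent of $T$, all eigenvalues of $\Sigma$ are at least $\gamma_0$. Put $\Theta=\Sigma^{-1}$, $\gamma_j=\Sigma_{-j,-j}^{-1}\Sigma_{-j,j}\in\mathbb R^{p-1}$ and $v_{t,j}=x_{t,j}-x_{t,-j}^\top\gamma_j$, where $-j$ means that the index $j$ is left out. Let $S=\max_{j\in G}S_j$, where $S_j$ is the number of non-zero entries of the $j$-th row of $\Theta$, and let $s=\max_{j\in G}(|\mathrm{supp}\,\gamma_j|\vee1)$. For a $\sigma$-algebra $\mathcal M$ and a random vector $\xi\in\mathbb R^l$ put $\tau(\mathcal M,\xi)=\big\|\operatorname{ess\,sup}_{f}|\mathbb E(f(\xi)|\mathcal M)-\mathbb E f(\xi)|\big\|_1$,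 over all $f:\mathbb R^l\to\mathbb R$ that are $1$-Lipschitz for the $\ell_1$ norm. The $\tau$-mixing coefficients of a real process $(\xi_t)_{t\in\mathbb Z}$ with $\mathcal M_t=\sigma(\xi_t,\xi_{t-1},\dots)$ are $\tau_k=\sup_{j\ge1}\frac1j\sup_{t+k\le t_1<\dots<t_j}\tau(\mathcal M_t,(\xi_{t_1},\dots,\xi_{t_j}))$. Write $Y_T=O_P(\rho_T)$ if for every $\varepsilon>0$ there is $M>0$ with $\Pr(|Y_T|>M\rho_T)\le\varepsilon$ for all large $T$. **Constants.** Let $r>4$, $q>2r/(r-2)$, $\varsigma=qr/(q+r)$, $a>(\varsigma-1)/(\varsigma-2)$, $b>(r-2)/(r-4)$, $c,K>0$, and put $$\kappa=\frac{(a+1)\varsigma-1}{a+\varsigma-1},\qquad \mu=\frac{(b+1)r-2}{r+2(b-1)}.$$ **Nodewise LASSO.** With observations $t=1,\dots,T$, let $\mathbf X$ be the $T\times p$ matrix with rows $x_t^\top$, $\mathbf X_j$ its $j$-th column, $\mathbf X_{-j}$ the remaining columns, $\|w\|_T^2=|w|_2^2/T$ and $\hat\Sigma=\mathbf X^\top\mathbf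 X/T$. For $j\in G$ let $\hat\gamma_j$ be a minimizer of $\|\mathbf X_j-\mathbf X_{-j}g\|_T^2+2\lambda_j|g|_1$ over $g\in\mathbb R^{p-1}$, and let $\hat\sigma_j^2=\|\mathbf X_j-\mathbf X_{-j}\hat\gamma_j\|_T^2+\lambda_j|\hat\gamma_j|_1$. The $j$-th row $\hat\Theta_j$ of $\hat\Theta$ is $\hat\sigma_j^{-2}$ times the vector with $j$-th entry $1$ and remaining entries $-\hat\gamma_j$. **Proposition.** There is a constant $C_0>0$, depending only on $q,r,a,b,c,K$, such that the following holds. Assume: 1. (Data) $\|x_{t,k}\|_r\le K$ for all $T$, $t$ and $k\in[p]$. For all $T$ and $j\in G$: $(v_{t,j}x_{t,-j})_{t}$ and $(x_{t,-j}x_{t,-j}^\top)_{t}$ are strictly stationary; $\|v_{t,j}\|_q\le K$; and for all $k,l\ne j$ and $n\ge1$ the $\tau$-mixing coefficients of $(v_{t,j}x_{t,k})_t$ and $(x_{t,k}x_{t,l})_t$ satisfy $\tau_n\le cn^{-a}$ and $\tilde\tau_n\le cn^{-b}$, respectively. 2. (Regularization) For some $\delta\in(0,1)$ and some constant $C_1$,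 for all large $T$ and all $j\in G$, $C_0R_T\le\lambda_j\le C_1R_T$, where $R_T=\left(\frac{p}{\delta T^{\kappa-1}}\right)^{1/\kappa}\vee\sqrt{\frac{\log(8p/\delta)}{T}}$. 3. (Rates) $s^\mu p^2T^{1-\mu}\to0$, and $p^2\exp(-c_1T/s^2)\to0$ for some constant $c_1>0$. 4. (Long-run variance) There is a constant $L$ with $\mathrm{Var}\big(T^{-1/2}\sum_{t=1}^Tv_{t,j}^2\big)\le L$ for all large $T$ and all $j\in G$. 5. $S^\kappa pT^{1-\kappa}\to0$ and $S^2\log p/T\to0$. Then $$\|\hat\Theta_G-\Theta_G\|_\infty=\max_{j\in G}|\hat\Theta_j-\Theta_j|_1=O_P\left(\frac{Sp^{1/\kappa}}{T^{1-1/\kappa}}\vee S\sqrt{\frac{\log p}{T}}\right)$$ and $$\max_{j\in G}|(I-\hat\Theta\hat\Sigma)_j|_\infty=O_P\left(\frac{p^{1/\kappa}}{T^{1-1/\kappa}}\vee\sqrt{\frac{\log p}{T}}\right).$$ -/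

import Mathlib

open MeasureTheory ProbabilityTheory Filter Topology
open scoped ENNReal

namespace NodewiseLasso

noncomputable section

/-! ### Stochastic order and dependence -/

/-- `Y_T = O_P(ρ_T)` as `T → ∞`. -/
def BigOP {Ω : Type*} [MeasurableSpace Ω] (P : Measure Ω) (Y : ℕ → Ω → ℝ) (ρ : ℕ → ℝ) : Prop :=
  ∀ ε : ℝ, 0 < ε → ∃ M : ℝ, 0 < M ∧
    ∀ᶠ T in atTop, P {ω | M * ρ T < |Y T ω|} ≤ ENNReal.ofReal ε

/-- Strict stationarity of a process indexed by `ℤ`: the law of the whole path is invariant under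
time shifts. -/
def Stationary {Ω E : Type*} [MeasurableSpace Ω] [MeasurableSpace E] (P : Measure Ω)
    (ξ : ℤ → Ω → E) : Prop :=
  ∀ h : ℤ, IdentDistrib (fun ω (t : ℤ) => ξ (t + h) ω) (fun ω (t : ℤ) => ξ t ω) P P

/-- The functions on `ℝ^l` that are `1`-Lipschitz for the `ℓ¹` norm. -/
def IsLipOne {l : ℕ} (f : (Fin l → ℝ) → ℝ) : Prop :=
  ∀ x y, |f x - f y| ≤ ∑ i, |x i - y i|

/-- `τ(M, ξ) = ‖ sup_{f ∈ Lip₁} |E(f(ξ) | M) - E f(ξ)| ‖₁`. The supremum of this uncountable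
family of almost-everywhere classes is the essential one, so that its `L¹` norm is the least
integral of a measurable function dominating every member of the family almost everywhere. -/
def tauDep {Ω : Type*} [mΩ : MeasurableSpace Ω] (P : Measure Ω) (m : MeasurableSpace Ω) {l : ℕ}
    (ξ : Ω → Fin l → ℝ) : ℝ≥0∞ :=
  ⨅ (g : Ω → ℝ≥0∞) (_ : Measurable g)
    (_ : ∀ f : (Fin l → ℝ) → ℝ, IsLipOne f →
      ∀ᵐ ω ∂P, ENNReal.ofReal
        |condExp m P (fun ω' => f (ξ ω')) ω - ∫ ω', f (ξ ω') ∂P| ≤ g ω),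
    ∫⁻ ω, g ω ∂P

/-- The natural filtration `M_t = σ(ξ_t, ξ_{t-1}, …)`. -/
abbrev past {Ω : Type*} (ξ : ℤ → Ω → ℝ) (t : ℤ) : MeasurableSpace Ω :=
  ⨆ (s : ℤ) (_ : s ≤ t), MeasurableSpace.comap (ξ s) inferInstance

/-- The `τ`-mixing coefficient
`τ_k = sup_{j ≥ 1} j⁻¹ sup_{t + k ≤ t_1 < ⋯ < t_j} τ(M_t, (ξ_{t_1}, …, ξ_{t_j}))`. -/
def tauCoeff {Ω : Type*} [MeasurableSpace Ω] (P : Measure Ω) (ξ : ℤ → Ω → ℝ) (k : ℕ) : ℝ≥0∞ :=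
  ⨆ (j : ℕ) (_ : 1 ≤ j) (t : ℤ) (s : Fin j → ℤ) (_ : StrictMono s) (_ : ∀ i, t + k ≤ s i),
    (j : ℝ≥0∞)⁻¹ * tauDep P (past ξ t) (fun ω i => ξ (s i) ω)

/-! ### Regression assumption -/

/-- Stationarity, moment and mixing conditions for a regression with error `u` and
regressors `x`; `K` bounds the moments. -/
structure RegressionData {Ω ι : Type*} [MeasurableSpace Ω] (P : Measure Ω)
    (u : ℤ → Ω → ℝ) (x : ℤ → ι → Ω → ℝ) (q r a b c K : ℝ) : Prop where
  stationary_ux : Stationary P (fun t ω (k : ι) => u t ω * x t k ω)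
  stationary_xx : Stationary P (fun t ω (kl : ι × ι) => x t kl.1 ω * x t kl.2 ω)
  moment_u : ∀ t, eLpNorm (u t) (ENNReal.ofReal q) P ≤ ENNReal.ofReal K
  moment_x : ∀ t k, eLpNorm (x t k) (ENNReal.ofReal r) P ≤ ENNReal.ofReal K
  mixing_ux : ∀ k, ∀ n : ℕ, 1 ≤ n →
    tauCoeff P (fun t ω => u t ω * x t k ω) n ≤ ENNReal.ofReal (c * (n : ℝ) ^ (-a))
  mixing_xx : ∀ k l, ∀ n : ℕ, 1 ≤ n →
    tauCoeff P (fun t ω => x t k ω * x t l ω) n ≤ ENNReal.ofReal (c * (n : ℝ) ^ (-b))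

/-- `ς = qr / (q + r)`. -/
def sigmaExp (q r : ℝ) : ℝ := q * r / (q + r)

/-- `κ = ((a + 1)ς - 1) / (a + ς - 1)`. -/
def kappaExp (q r a : ℝ) : ℝ :=
  ((a + 1) * sigmaExp q r - 1) / (a + sigmaExp q r - 1)

/-- `μ = ((b + 1)r - 2) / (r + 2(b - 1))`. -/
def muExp (r b : ℝ) : ℝ := ((b + 1) * r - 2) / (r + 2 * (b - 1))

/-- `(p / (δ T^{κ-1}))^{1/κ} ∨ √(log(8p/δ) / T)`. -/
def tuningRate (κ δ : ℝ) (p T : ℕ) : ℝ :=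
  max (((p : ℝ) / (δ * (T : ℝ) ^ (κ - 1))) ^ (1 / κ)) (√(Real.log (8 * p / δ) / T))

/-! ### Population quantities -/

section Population

variable {Ω : Type*} [MeasurableSpace Ω] {p : ℕ}

/-- `E[x_t x_tᵀ]`. -/
def secondMoment (P : Measure Ω) (x : ℤ → Fin p → Ω → ℝ) (t : ℤ) : Matrix (Fin p) (Fin p) ℝ :=
  Matrix.of fun k l => ∫ ω, x t k ω * x t l ω ∂P

/-- The covariance matrix `Σ`; below, the second moments are required not to depend on `t`. -/
def covMat (P : Measure Ω) (x : ℤ → Fin p → Ω → ℝ) : Matrix (Fin p) (Fin p) ℝ :=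
  secondMoment P x 0

/-- The precision matrix `Θ = Σ⁻¹`. -/
def precMat (P : Measure Ω) (x : ℤ → Fin p → Ω → ℝ) : Matrix (Fin p) (Fin p) ℝ :=
  (covMat P x)⁻¹

/-- The projection coefficient `γ_j = Σ_{-j,-j}⁻¹ Σ_{-j,j}`. -/
def projCoef (P : Measure Ω) (x : ℤ → Fin p → Ω → ℝ) (j : Fin p) : {k : Fin p // k ≠ j} → ℝ :=
  Matrix.mulVec ((covMat P x).submatrix (Subtype.val : {k : Fin p // k ≠ j} → Fin p)
      (Subtype.val : {k : Fin p // k ≠ j} → Fin p))⁻¹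
    (fun k => covMat P x k.1 j)

/-- The projection error `v_{t,j} = x_{t,j} - x_{t,-j}ᵀ γ_j`. -/
def projErr (P : Measure Ω) (x : ℤ → Fin p → Ω → ℝ) (j : Fin p) (t : ℤ) (ω : Ω) : ℝ :=
  x t j ω - ∑ k : {k : Fin p // k ≠ j}, projCoef P x j k * x t k.1 ω

/-- The regressors `x_{t,-j}`. -/
def others (x : ℤ → Fin p → Ω → ℝ) (j : Fin p) : ℤ → {k : Fin p // k ≠ j} → Ω → ℝ :=
  fun t k => x t k.1

open Classical in
/-- The number of non-zero entries of a vector. -/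
def numNonzero {ι : Type*} [Fintype ι] (w : ι → ℝ) : ℕ :=
  (Finset.univ.filter fun k => w k ≠ 0).card

/-- `S = max_{j ∈ G} S_j`, with `S_j` the number of non-zero entries of the `j`-th row of `Θ`. -/
def rowSparsity (P : Measure Ω) (x : ℤ → Fin p → Ω → ℝ) (G : Finset (Fin p)) : ℕ :=
  G.sup fun j => numNonzero (precMat P x j)

/-- `s = max_{j ∈ G} (|supp γ_j| ∨ 1)`, the largest sparsity of the nodewise regressions, a zero
coefficient vector being given sparsity `1` (and so is an empty family). -/
def regSparsity (P : Measure Ω) (x : ℤ → Fin p → Ω → ℝ) (G : Finset (Fin p)) : ℕ :=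
  max 1 (G.sup fun j => numNonzero (projCoef P x j))

end Population

/-! ### The nodewise LASSO estimator -/

section Estimator

variable {Ω : Type*} {p : ℕ}

/-- `‖X_j - X_{-j} g‖_T²`, where `‖w‖_T² = |w|₂² / T` and the sample is `t = 1, …, T`. -/
def residNormSq (T : ℕ) (x : ℤ → Fin p → Ω → ℝ) (j : Fin p) (g : {k : Fin p // k ≠ j} → ℝ)
    (ω : Ω) : ℝ :=
  (∑ t ∈ Finset.Icc (1 : ℤ) T, (x t j ω - ∑ k, g k * x t k.1 ω) ^ 2) / T

/-- The nodewise LASSO objective `‖X_j - X_{-j} g‖_T² + 2 lam |g|₁`. -/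
def lassoObj (T : ℕ) (x : ℤ → Fin p → Ω → ℝ) (j : Fin p) (lam : ℝ)
    (g : {k : Fin p // k ≠ j} → ℝ) (ω : Ω) : ℝ :=
  residNormSq T x j g ω + 2 * lam * ∑ k, |g k|

/-- `σ̂_j² = ‖X_j - X_{-j} γ̂_j‖_T² + lam |γ̂_j|₁`. -/
def sigmaHatSq (T : ℕ) (x : ℤ → Fin p → Ω → ℝ) (j : Fin p) (lam : ℝ)
    (g : {k : Fin p // k ≠ j} → ℝ) (ω : Ω) : ℝ :=
  residNormSq T x j g ω + lam * ∑ k, |g k|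

/-- `Θ̂`, whose `j`-th row is `σ̂_j⁻²` times the vector with `j`-th entry `1` and remaining
entries `-γ̂_j`. -/
def thetaHat (T : ℕ) (x : ℤ → Fin p → Ω → ℝ) (lam : Fin p → ℝ)
    (gHat : (j : Fin p) → Ω → {k : Fin p // k ≠ j} → ℝ) (ω : Ω) : Matrix (Fin p) (Fin p) ℝ :=
  Matrix.of fun j k =>
    (sigmaHatSq T x j (lam j) (gHat j ω) ω)⁻¹ *
      (if h : k = j then 1 else -gHat j ω ⟨k, h⟩)

/-- The sample covariance matrix `Σ̂ = XᵀX / T`. -/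
def sampleCov (T : ℕ) (x : ℤ → Fin p → Ω → ℝ) (ω : Ω) : Matrix (Fin p) (Fin p) ℝ :=
  Matrix.of fun k l => (∑ t ∈ Finset.Icc (1 : ℤ) T, x t k ω * x t l ω) / T

/-- `‖A_G‖_∞ = max_{j ∈ G} ∑_k |A_{jk}|` (and `0` if `G` is empty). -/
def rowSumNorm (A : Matrix (Fin p) (Fin p) ℝ) (G : Finset (Fin p)) : ℝ :=
  ⨆ j : {j // j ∈ G}, ∑ k, |A j.1 k|

/-- `max_{j ∈ G} |A_j|_∞ = max_{j ∈ G} max_k |A_{jk}|` (and `0` if `G` is empty). -/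
def rowMaxNorm (A : Matrix (Fin p) (Fin p) ℝ) (G : Finset (Fin p)) : ℝ :=
  ⨆ j : {j // j ∈ G}, ⨆ k, |A j.1 k|

end Estimator

end

end NodewiseLasso

/-!
# Nodewise LASSO under `τ`-mixing

The proof has a probabilistic and a deterministic half.

*Concentration.* Partial sums of a `τ`-mixing process satisfy a Fuk–Nagaev inequality
(`fuk_nagaev`). The sum is cut into blocks of length `J`, and every second block is kept. Instead of
coupling the blocks with independent ones, a Lipschitz function `ψ` that approximates the indicator
of a half-line is applied to the sum, and the blocks are replaced by independent copies one at a
time, the last first. Conditionally on the past, each replacement is an expectation of a Lipschitz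
function of a single block, so it costs at most the Lipschitz constant times the `τ`-dependence of
the block on the past (`integral_test_add_block_le`). For independent blocks the truncated
exponential moments multiply, and one induction does both steps (`integral_test_sum_le`). Choosing
`J = u^{(s-1)/(a+s-1)}` at deviation `u` balances the `s`-th moments of the blocks against the
replacement cost and yields the tail `T u^{-κ}` besides the Gaussian one; the variances of the
blocks are linear in their length since the covariances are summable
(`abs_integral_centered_mul_le`). The inequality is used for `v_{t,j} x_{t,k}`, with exponent `κ`,
and for `x_{t,k} x_{t,l}`, with exponent `μ`.

*Noise above the penalty.* As `δ` is fixed, the penalty dominates the noise `X_k^⊤ v_j / T` in all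
coordinates only with a probability bounded away from one, which does not suffice for a statement in
`O_P`. However, each coordinate exceeds the penalty with probability `O(1/p)`, so that the number
of such coordinates is bounded in probability, and so is the size of the largest one relative to the
penalty (`measureReal_noise_le`). The excess therefore enters the basic inequality only as a
multiple of `λ_j |Δ|₂`, which enlarges the cone that contains the error `Δ` by a constant factor
(`lasso_oracle`). On this cone the empirical Gram matrix inherits the lower bound `γ₀`, because its
entries are within a small multiple of `1/s` of their expectations with probability tending to one;
here `s ≤ S`, since a row of `Θ` has one more non-zero entry than `γ_j` (`tendsto_gram_bound`).

*From the regression to the precision matrix.* The `j`-th row of `Θ` is `σ_j⁻² (1, -γ_j)`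
(`inv_row_eq`), and `σ̂_j²` differs from `σ_j²` by `O(√s ρ)`, where `ρ` is the rate of the penalty
and the error variance is controlled by Chebyshev's inequality (`measure_residNormSq_le`). Together
with `|Δ|₁ = O(s ρ)` this gives the first claim (`row_bounds`). The second follows from the
stationarity conditions of the LASSO: the off-diagonal entries of a row of `Θ̂ Σ̂` are at most
`λ_j / σ̂_j²`, and the diagonal entry is exactly `1` by the definition of `σ̂_j²`
(`abs_one_sub_thetaHat_mul_sampleCov_le`).
-/

namespace NodewiseLasso

/-! ### Replacing a block by an independent copy -/

/-- The `c`-Lipschitz test functions with values in `[0, 1]`. -/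
structure IsTest (c : ℝ) (ψ : ℝ → ℝ) : Prop where
  nonneg : ∀ x, 0 ≤ ψ x
  le_one : ∀ x, ψ x ≤ 1
  lip : ∀ x y, |ψ x - ψ y| ≤ c * |x - y|

section Decoupling

variable {Ω : Type*} {m : MeasurableSpace Ω} [mΩ : MeasurableSpace Ω] {P : Measure Ω} {c : ℝ}
  {ψ : ℝ → ℝ}

lemma IsTest.continuous (hψ : IsTest c ψ) : Continuous ψ := by
  have : LipschitzWith (Real.toNNReal c) ψ := by
    refine LipschitzWith.of_dist_le_mul fun x y => ?_
    rw [Real.dist_eq, Real.dist_eq]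
    exact (hψ.lip x y).trans (mul_le_mul_of_nonneg_right (Real.le_coe_toNNReal c) (abs_nonneg _))
  exact this.continuous

lemma IsTest.abs_le (hψ : IsTest c ψ) (x : ℝ) : ‖ψ x‖ ≤ 1 := by
  rw [Real.norm_eq_abs, abs_of_nonneg (hψ.nonneg x)]; exact hψ.le_one x

lemma IsTest.integrable [IsProbabilityMeasure P] (hψ : IsTest c ψ) {Z : Ω → ℝ}
    (hZ : Measurable Z) : Integrable (fun ω => ψ (Z ω)) P :=
  Integrable.of_bound (hψ.continuous.measurable.comp hZ).aestronglyMeasurable 1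
    (Eventually.of_forall fun _ => hψ.abs_le _)

/-- Averaging over an independent increment keeps the class of test functions. -/
lemma IsTest.average [IsProbabilityMeasure P] (hψ : IsTest c ψ) {Y : Ω → ℝ} (hY : Measurable Y) :
    IsTest c (fun w => ∫ ω, ψ (w + Y ω) ∂P) where
  nonneg w := integral_nonneg fun _ => hψ.nonneg _
  le_one w := by
    have := integral_mono (hψ.integrable (P := P) (hY.const_add w))
      (integrable_const 1) (fun ω => hψ.le_one (w + Y ω))
    simpa using this
  lip x y := by
    have hi : ∀ w, Integrable (fun ω => ψ (w + Y ω)) P := fun w => hψ.integrable (hY.const_add w)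
    rw [← integral_sub (hi x) (hi y)]
    refine (abs_integral_le_integral_abs).trans ?_
    have := integral_mono (μ := P) ((hi x).sub (hi y)).abs
      (integrable_const (c * |x - y|)) (fun ω => by
        simpa using hψ.lip (x + Y ω) (y + Y ω))
    simpa using this

lemma integral_test_add_le_of_simple [IsProbabilityMeasure P] (hm : m ≤ mΩ)
    (hψ : IsTest c ψ) {Y : Ω → ℝ} (hY : Measurable Y) {G : Ω → ℝ} (hG : Integrable G P)
    (hdom : ∀ w, ∀ᵐ ω ∂P, |condExp m P (fun ω' => ψ (w + Y ω')) ω - ∫ ω', ψ (w + Y ω') ∂P| ≤ G ω)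
    {W : Ω → ℝ} (hW : Measurable[m] W) {R : Finset ℝ} (hR : ∀ ω, W ω ∈ R) :
    ∫ ω, ψ (W ω + Y ω) ∂P ≤ (∫ ω, (∫ ω', ψ (W ω + Y ω') ∂P) ∂P) + ∫ ω, G ω ∂P := by
  have hWm : Measurable W := hW.mono hm le_rfl
  have hG0 : 0 ≤ᵐ[P] G := by
    filter_upwards [hdom 0] with ω h using (abs_nonneg _).trans h
  set φ : ℝ → ℝ := fun w => ∫ ω', ψ (w + Y ω') ∂P with hφ
  have hφt : IsTest c φ := hψ.average hY
  have hI1 : Integrable (fun ω => ψ (W ω + Y ω)) P := hψ.integrable (Z := fun ω => W ω + Y ω) (hWm.add hY)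
  have hI2 : Integrable (fun ω => φ (W ω) + G ω) P := (hφt.integrable (Z := fun ω => W ω) hWm).add hG
  rw [← integral_add (hφt.integrable hWm) hG]
  have hU : (⋃ w ∈ R, W ⁻¹' {w}) = Set.univ := by
    ext ω; simpa using hR ω
  have hms : ∀ w, MeasurableSet[m] (W ⁻¹' {w}) := fun w =>
    hW (measurableSet_singleton w)
  have hdisj : Set.PairwiseDisjoint (↑R) (fun w => W ⁻¹' {w}) := by
    intro a _ b _ hab
    refine Set.disjoint_left.2 fun ω ha hb => hab ?_
    simp only [Set.mem_preimage, Set.mem_singleton_iff] at ha hb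
    rw [← ha, ← hb]
  rw [← setIntegral_univ (μ := P) (f := fun ω => ψ (W ω + Y ω)),
    ← setIntegral_univ (μ := P) (f := fun ω => φ (W ω) + G ω), ← hU,
    integral_biUnion_finset _ (fun w _ => hm _ (hms w)) hdisj (fun w _ => hI1.integrableOn),
    integral_biUnion_finset _ (fun w _ => hm _ (hms w)) hdisj (fun w _ => hI2.integrableOn)]
  refine Finset.sum_le_sum fun w _ => ?_
  have e1 : ∫ ω in W ⁻¹' {w}, ψ (W ω + Y ω) ∂P = ∫ ω in W ⁻¹' {w}, ψ (w + Y ω) ∂P := by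
    refine setIntegral_congr_fun (hm _ (hms w)) fun ω hω => ?_
    simp only [Set.mem_preimage, Set.mem_singleton_iff] at hω
    simp only [hω]
  have hIw : Integrable (fun ω => ψ (w + Y ω)) P := hψ.integrable (hY.const_add w)
  rw [e1, ← setIntegral_condExp hm hIw (hms w)]
  refine setIntegral_mono_on_ae integrable_condExp.integrableOn hI2.integrableOn (hm _ (hms w)) ?_
  filter_upwards [hdom w] with ω h hω
  simp only [Set.mem_preimage, Set.mem_singleton_iff] at hω
  rw [hω]
  have := (abs_le.1 h).2
  simp only [hφ]
  linarith

/-- If the conditional expectations of `ψ (w + Y)` given `m` are within `G` of the expectations,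
then in `E ψ (W + Y)`, with `W` measurable for `m`, the variable `Y` may be replaced by an
independent copy at the cost of `E G`. -/
lemma integral_test_add_le [IsProbabilityMeasure P] (hm : m ≤ mΩ)
    (hψ : IsTest c ψ) {Y : Ω → ℝ} (hY : Measurable Y) {G : Ω → ℝ} (hG : Integrable G P)
    (hdom : ∀ w, ∀ᵐ ω ∂P, |condExp m P (fun ω' => ψ (w + Y ω')) ω - ∫ ω', ψ (w + Y ω') ∂P| ≤ G ω)
    {W : Ω → ℝ} (hW : Measurable[m] W) :
    ∫ ω, ψ (W ω + Y ω) ∂P ≤ (∫ ω, (∫ ω', ψ (W ω + Y ω') ∂P) ∂P) + ∫ ω, G ω ∂P := by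
  have hWs : StronglyMeasurable[m] W := hW.stronglyMeasurable
  have hφt : IsTest c (fun w => ∫ ω', ψ (w + Y ω') ∂P) := hψ.average hY
  have hn : ∀ n, Measurable (hWs.approx n) := fun n =>
    (@SimpleFunc.measurable Ω ℝ m _ (hWs.approx n)).mono hm le_rfl
  have t1 : Tendsto (fun n => ∫ ω, ψ (hWs.approx n ω + Y ω) ∂P) atTop
      (𝓝 (∫ ω, ψ (W ω + Y ω) ∂P)) := by
    refine tendsto_integral_of_dominated_convergence (fun _ => 1) (fun n =>
      (hψ.integrable (Z := fun ω => hWs.approx n ω + Y ω) ((hn n).add hY)).aestronglyMeasurable) (integrable_const 1)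
      (fun n => Eventually.of_forall fun ω => hψ.abs_le _) (Eventually.of_forall fun ω => ?_)
    exact (hψ.continuous.tendsto _).comp ((hWs.tendsto_approx ω).add_const _)
  have t2 : Tendsto (fun n => ∫ ω, (∫ ω', ψ (hWs.approx n ω + Y ω') ∂P) ∂P) atTop
      (𝓝 (∫ ω, (∫ ω', ψ (W ω + Y ω') ∂P) ∂P)) := by
    refine tendsto_integral_of_dominated_convergence (fun _ => 1) (fun n =>
      (hφt.integrable (Z := fun ω => hWs.approx n ω) (hn n)).aestronglyMeasurable) (integrable_const 1)
      (fun n => Eventually.of_forall fun ω => hφt.abs_le _) (Eventually.of_forall fun ω => ?_)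
    exact (hφt.continuous.tendsto _).comp (hWs.tendsto_approx ω)
  exact le_of_tendsto_of_tendsto' t1 (t2.add_const _) fun n =>
    integral_test_add_le_of_simple hm hψ hY hG hdom (@SimpleFunc.measurable Ω ℝ m _ (hWs.approx n))
      (R := (@SimpleFunc.finite_range Ω ℝ m (hWs.approx n)).toFinset) (by simp)

/-- Decoupling through the `τ`-dependence coefficient: replacing the centred block sum
`e (∑ ξ_i - d)`, `e = ±1`, by an independent copy costs at most `c τ(m, ξ)`. -/
lemma integral_test_add_block_le [IsProbabilityMeasure P] (hm : m ≤ mΩ)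
    (hc : 0 < c) (hψ : IsTest c ψ) {l : ℕ} {ξ : Ω → Fin l → ℝ} (hξ : ∀ i, Measurable fun ω => ξ ω i)
    {e : ℝ} (he : |e| = 1) (d : ℝ) {θ : ℝ} (hθ : 0 ≤ θ) (hτ : tauDep P m ξ ≤ ENNReal.ofReal θ)
    {W : Ω → ℝ} (hW : Measurable[m] W) :
    ∫ ω, ψ (W ω + e * (∑ i, ξ ω i - d)) ∂P ≤
      (∫ ω, (∫ ω', ψ (W ω + e * (∑ i, ξ ω' i - d)) ∂P) ∂P) + c * θ := by
  have hY : Measurable (fun ω => e * (∑ i, ξ ω i - d)) :=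
    measurable_const.mul ((Finset.measurable_sum _ fun i _ => hξ i).sub measurable_const)
  refine le_of_forall_pos_le_add fun ε hε => ?_
  have hlt : tauDep P m ξ < ENNReal.ofReal (θ + ε / c) :=
    hτ.trans_lt ((ENNReal.ofReal_lt_ofReal_iff (by positivity)).2 (by
      have : 0 < ε / c := by positivity
      linarith))
  unfold tauDep at hlt
  simp only [iInf_lt_iff] at hlt
  obtain ⟨g, hgm', hg, hlt⟩ := hlt
  have hgm : Measurable g := hgm'.mono hm le_rfl
  have hfin : ∫⁻ ω, g ω ∂P ≠ ∞ := (hlt.trans ENNReal.ofReal_lt_top).ne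
  have hgi : Integrable (fun ω => (g ω).toReal) P := integrable_toReal_of_lintegral_ne_top
    hgm.aemeasurable hfin
  have hgint : ∫ ω, (g ω).toReal ∂P ≤ θ + ε / c := by
    rw [integral_toReal hgm.aemeasurable (ae_lt_top hgm hfin)]
    exact ENNReal.toReal_le_of_le_ofReal (by positivity) hlt.le
  have key := integral_test_add_le hm hψ hY (hgi.const_mul c) (W := W) ?_ hW
  · rw [integral_const_mul] at key
    have h2 := mul_le_mul_of_nonneg_left hgint hc.le
    have h3 : c * (θ + ε / c) = c * θ + ε := by field_simp
    linarith
  · intro w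
    have hl : IsLipOne (fun y : Fin l → ℝ => c⁻¹ * ψ (w + e * (∑ i, y i - d))) := by
      intro y z
      have h1 := hψ.lip (w + e * (∑ i, y i - d)) (w + e * (∑ i, z i - d))
      have h2 : w + e * (∑ i, y i - d) - (w + e * (∑ i, z i - d)) = e * ∑ i, (y i - z i) := by
        rw [Finset.sum_sub_distrib]; ring
      rw [h2, abs_mul, he, one_mul] at h1
      rw [← mul_sub, abs_mul, abs_of_pos (inv_pos.2 hc), inv_mul_le_iff₀ hc]
      exact h1.trans (mul_le_mul_of_nonneg_left (Finset.abs_sum_le_sum_abs _ _) hc.le)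
    have hsm : condExp m P (fun ω' => c⁻¹ * ψ (w + e * (∑ i, ξ ω' i - d))) =ᵐ[P]
        fun ω => c⁻¹ * condExp m P (fun ω' => ψ (w + e * (∑ i, ξ ω' i - d))) ω :=
      condExp_smul (μ := P) c⁻¹ (fun ω' => ψ (w + e * (∑ i, ξ ω' i - d))) m
    filter_upwards [hg _ hl, ae_lt_top hgm hfin, hsm] with ω h1 h2 h3
    rw [h3, integral_const_mul, ← mul_sub, abs_mul, abs_of_pos (inv_pos.2 hc),
      ENNReal.ofReal_le_iff_le_toReal h2.ne, inv_mul_le_iff₀ hc] at h1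
    exact h1

end Decoupling

/-! ### Exponential bounds for independent summands -/

lemma exp_le_one_add_add_sq {s t : ℝ} (hs : 0 ≤ s) (ht : t ≤ s) :
    Real.exp t ≤ 1 + t + Real.exp s * t ^ 2 := by
  have hs1 : 1 ≤ Real.exp s := Real.one_le_exp hs
  have h1 : t ^ 2 ≤ Real.exp s * t ^ 2 := le_mul_of_one_le_left (sq_nonneg t) hs1
  by_cases h : |t| ≤ 1
  · have := (abs_le.1 (Real.abs_exp_sub_one_sub_id_le h)).2
    linarith
  · rcases le_or_gt t 0 with h0 | h0
    · have : Real.exp t ≤ 1 := Real.exp_le_one_iff.2 h0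
      rw [abs_of_nonpos h0, not_le] at h
      nlinarith
    · rw [abs_of_pos h0, not_le] at h
      have h2 : Real.exp t ≤ Real.exp s := Real.exp_le_exp.2 ht
      have h3 : Real.exp s ≤ Real.exp s * t ^ 2 :=
        le_mul_of_one_le_right (Real.exp_pos s).le (by nlinarith)
      linarith

/-- Below the truncation level `y`, the exponential is bounded by its quadratic expansion up to
`h x = s`, and beyond by comparison with the power function, as `exp (h x) / x ^ s` increases for
`h x ≥ s`. -/
lemma truncated_exp_le {s h y : ℝ} (hs : 0 < s) (hh : 0 < h) (hy : 0 < y) (x : ℝ) :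
    (if x ≤ y then Real.exp (h * x) else 0) ≤
      1 + h * x + Real.exp s * (h * x) ^ 2 + Real.exp (h * y) * (|x| / y) ^ s := by
  have hp : 0 ≤ Real.exp (h * y) * (|x| / y) ^ s := by positivity
  have hq : 0 ≤ Real.exp s * (h * x) ^ 2 := by positivity
  split_ifs with hxy
  · rcases le_or_gt (h * x) s with h1 | h1
    · have := exp_le_one_add_add_sq hs.le h1
      linarith
    · have hx : 0 < x := by
        by_contra hx
        have : h * x ≤ 0 := mul_nonpos_of_nonneg_of_nonpos hh.le (not_lt.1 hx)
        linarith
      have hlog : Real.log (y / x) ≤ y / x - 1 := Real.log_le_sub_one_of_pos (by positivity)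
      have e1 : (|x| / y) ^ s = Real.exp (-(s * Real.log (y / x))) := by
        rw [abs_of_pos hx, Real.rpow_def_of_pos (by positivity), ← inv_div, Real.log_inv]
        ring_nf
      rw [e1, ← Real.exp_add]
      have e2 : s * Real.log (y / x) ≤ h * (y - x) := by
        calc s * Real.log (y / x) ≤ s * (y / x - 1) := by gcongr
          _ ≤ h * x * (y / x - 1) := by
            have : 1 ≤ y / x := by rwa [one_le_div hx]
            exact mul_le_mul_of_nonneg_right h1.le (by linarith)
          _ = h * (y - x) := by field_simp
      have e3 : Real.exp (h * x) ≤ Real.exp (h * y + -(s * Real.log (y / x))) :=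
        Real.exp_le_exp.2 (by linarith)
      have : 0 < h * x := by positivity
      linarith
  · have : 0 < h * x := mul_pos hh (hy.trans (not_le.1 hxy))
    linarith

section Iteration

variable {Ω : Type*} [mΩ : MeasurableSpace Ω] {P : Measure Ω}

lemma integral_truncated_exp_le [IsProbabilityMeasure P] {s h y : ℝ} (hs : 0 < s) (hh : 0 < h)
    (hy : 0 < y) {Y : Ω → ℝ} (hY : Measurable Y) (h1 : Integrable Y P)
    (h2 : Integrable (fun ω => Y ω ^ 2) P) (h3 : Integrable (fun ω => |Y ω| ^ s) P)
    (h0 : ∫ ω, Y ω ∂P = 0) :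
    Integrable (fun ω => if Y ω ≤ y then Real.exp (h * Y ω) else 0) P ∧
    ∫ ω, (if Y ω ≤ y then Real.exp (h * Y ω) else 0) ∂P ≤
      1 + (Real.exp s * h ^ 2 * ∫ ω, Y ω ^ 2 ∂P +
        Real.exp (h * y) * (y ^ (-s) * ∫ ω, |Y ω| ^ s ∂P)) := by
  have hi : Integrable (fun ω => if Y ω ≤ y then Real.exp (h * Y ω) else 0) P := by
    refine Integrable.of_bound (Measurable.aestronglyMeasurable
      (Measurable.ite (measurableSet_le hY measurable_const)
      (measurable_const.mul hY).exp measurable_const)) (Real.exp (h * y))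
      (Eventually.of_forall fun ω => ?_)
    split_ifs with hω
    · rw [Real.norm_eq_abs, abs_of_pos (Real.exp_pos _)]
      exact Real.exp_le_exp.2 (mul_le_mul_of_nonneg_left hω hh.le)
    · simpa using (Real.exp_pos _).le
  refine ⟨hi, ?_⟩
  have hb : ∀ ω, (if Y ω ≤ y then Real.exp (h * Y ω) else 0) ≤
      1 + (h * Y ω + (Real.exp s * h ^ 2 * Y ω ^ 2 +
        Real.exp (h * y) * (y ^ (-s) * |Y ω| ^ s))) := by
    intro ω
    refine (truncated_exp_le hs hh hy (Y ω)).trans (le_of_eq ?_)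
    rw [Real.div_rpow (abs_nonneg _) hy.le, Real.rpow_neg hy.le]
    ring
  have i2 := h2.const_mul (Real.exp s * h ^ 2)
  have i3 := (h3.const_mul (y ^ (-s))).const_mul (Real.exp (h * y))
  have i23 : Integrable (fun ω => Real.exp s * h ^ 2 * Y ω ^ 2 +
      Real.exp (h * y) * (y ^ (-s) * |Y ω| ^ s)) P := i2.add i3
  have i123 : Integrable (fun ω => h * Y ω + (Real.exp s * h ^ 2 * Y ω ^ 2 +
      Real.exp (h * y) * (y ^ (-s) * |Y ω| ^ s))) P := (h1.const_mul h).add i23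
  refine (integral_mono hi ((integrable_const 1).add i123) hb).trans (le_of_eq ?_)
  simp only [Pi.add_apply]
  rw [integral_add (integrable_const _) i123, integral_add (h1.const_mul h) i23,
    integral_add i2 i3]
  simp only [integral_const_mul, h0]
  simp

/-- Let `Y i` be replaceable by an independent copy at cost `θ i`, given its predecessors. A test
function below `A exp (h w) + B` then has an expectation at `∑ Y i` which is bounded as if the
`Y i` were independent and truncated at `y`, the excesses over `y` being paid for separately. -/
lemma integral_test_sum_le [IsProbabilityMeasure P] {c h y : ℝ}
    (Y : ℕ → Ω → ℝ) (hY : ∀ i, Measurable (Y i)) (ms : ℕ → MeasurableSpace Ω)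
    (hms : ∀ n, Measurable[ms n] (fun ω => ∑ i ∈ Finset.range n, Y i ω)) (θ κ : ℕ → ℝ)
    (hdec : ∀ i ψ, IsTest c ψ → ∀ W : Ω → ℝ, Measurable[ms i] W →
      ∫ ω, ψ (W ω + Y i ω) ∂P ≤ (∫ ω, (∫ ω', ψ (W ω + Y i ω') ∂P) ∂P) + θ i)
    (hi : ∀ i, Integrable (fun ω => if Y i ω ≤ y then Real.exp (h * Y i ω) else 0) P)
    (hκ : ∀ i, ∫ ω, (if Y i ω ≤ y then Real.exp (h * Y i ω) else 0) ∂P ≤ Real.exp (κ i))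
    (n : ℕ) : ∀ (A B : ℝ) (ψ : ℝ → ℝ), 0 ≤ A → 0 ≤ B → IsTest c ψ →
      (∀ w, ψ w ≤ A * Real.exp (h * w) + B) →
      ∫ ω, ψ (∑ i ∈ Finset.range n, Y i ω) ∂P ≤ A * Real.exp (∑ i ∈ Finset.range n, κ i) + B +
        ∑ i ∈ Finset.range n, (P.real {ω | y < Y i ω} + θ i) := by
  induction n with
  | zero =>
    intro A B ψ hA hB hψ hb
    simpa using hb 0
  | succ n ih =>
    intro A B ψ hA hB hψ hb
    have hq := hψ.average (P := P) (hY n)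
    have hm : MeasurableSet {ω | y < Y n ω} := measurableSet_lt measurable_const (hY n)
    have hind : Integrable (Set.indicator {ω | y < Y n ω} (fun _ => (1 : ℝ))) P :=
      (integrable_const (1 : ℝ)).indicator hm
    have hBi : Integrable (fun ω => B + Set.indicator {ω | y < Y n ω} (fun _ => (1 : ℝ)) ω) P :=
      (integrable_const B).add hind
    have hq2 : ∀ w, (∫ ω, ψ (w + Y n ω) ∂P) ≤
        (A * Real.exp (κ n)) * Real.exp (h * w) + (B + P.real {ω | y < Y n ω}) := by
      intro w
      have hpt : ∀ ω, ψ (w + Y n ω) ≤ A * Real.exp (h * w) *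
          (if Y n ω ≤ y then Real.exp (h * Y n ω) else 0) + (B +
            Set.indicator {ω | y < Y n ω} (fun _ => (1 : ℝ)) ω) := by
        intro ω
        by_cases hω : Y n ω ≤ y
        · have h1 : ω ∉ {ω | y < Y n ω} := by simpa using hω
          rw [Set.indicator_of_notMem h1, if_pos hω, mul_assoc, ← Real.exp_add, ← mul_add]
          simpa using hb (w + Y n ω)
        · have h1 : ω ∈ {ω | y < Y n ω} := by simpa using hω
          rw [Set.indicator_of_mem h1, if_neg hω, mul_zero]
          linarith [hψ.le_one (w + Y n ω)]
      have := integral_mono (hψ.integrable (P := P) ((hY n).const_add w))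
        (((hi n).const_mul (A * Real.exp (h * w))).add hBi) hpt
      refine this.trans ?_
      simp only [Pi.add_apply]
      rw [integral_add ((hi n).const_mul _) hBi, integral_add (integrable_const B) hind, integral_const_mul, integral_indicator hm]
      have h4 : A * Real.exp (h * w) *
          ∫ ω, (if Y n ω ≤ y then Real.exp (h * Y n ω) else 0) ∂P ≤
          A * Real.exp (h * w) * Real.exp (κ n) :=
        mul_le_mul_of_nonneg_left (hκ n) (by positivity)
      simp
      linarith
    have h1 := ih _ _ _ (by positivity) (by positivity) hq hq2
    have h2 := hdec n ψ hψ _ (hms n)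
    simp only [Finset.sum_range_succ]
    rw [Real.exp_add]
    linarith

/-- A Fuk–Nagaev inequality: for centred variables that decouple at total cost `∑ θ i`, the tail of
the sum is bounded by `s`-th moments and by a Gaussian term in the sum `V` of the variances. -/
lemma tail_sum_le_of_decoupled [IsProbabilityMeasure P] {s u V β : ℝ} (hs : 0 < s) (hu : 0 < u)
    (hV : 0 < V) (hβ : 0 < β)
    (Y : ℕ → Ω → ℝ) (hY : ∀ i, Measurable (Y i)) (ms : ℕ → MeasurableSpace Ω)
    (hms : ∀ n, Measurable[ms n] (fun ω => ∑ i ∈ Finset.range n, Y i ω)) (θ : ℕ → ℝ)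
    (hdec : ∀ i ψ, IsTest u⁻¹ ψ → ∀ W : Ω → ℝ, Measurable[ms i] W →
      ∫ ω, ψ (W ω + Y i ω) ∂P ≤ (∫ ω, (∫ ω', ψ (W ω + Y i ω') ∂P) ∂P) + θ i)
    (h1 : ∀ i, Integrable (Y i) P) (h2 : ∀ i, Integrable (fun ω => Y i ω ^ 2) P)
    (h3 : ∀ i, Integrable (fun ω => |Y i ω| ^ s) P) (h0 : ∀ i, ∫ ω, Y i ω ∂P = 0) (n : ℕ)
    (hvar : ∑ i ∈ Finset.range n, ∫ ω, Y i ω ^ 2 ∂P ≤ V)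
    (hmom : ∑ i ∈ Finset.range n, ∫ ω, |Y i ω| ^ s ∂P ≤ β * (u / 2) ^ s)
    (hθ : 0 ≤ ∑ i ∈ Finset.range n, θ i) :
    P.real {ω | 2 * u < ∑ i ∈ Finset.range n, Y i ω} ≤
      4 * β + 3 * Real.exp (-(u ^ 2 / (4 * Real.exp s * V))) + ∑ i ∈ Finset.range n, θ i := by
  have hE : 0 < Real.exp (-(u ^ 2 / (4 * Real.exp s * V))) := Real.exp_pos _
  rcases le_or_gt 1 β with hβ1 | hβ1
  · have : P.real {ω | 2 * u < ∑ i ∈ Finset.range n, Y i ω} ≤ 1 := measureReal_le_one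
    linarith
  set y := u / 2 with hy
  have hy0 : 0 < y := by positivity
  set l := -Real.log β with hl
  have hl0 : 0 < l := by have := Real.log_neg hβ hβ1; linarith
  set h := min (u / (2 * Real.exp s * V)) (l / y) with hh
  have hh0 : 0 < h := lt_min (by positivity) (by positivity)
  have hh1 : Real.exp s * h * V ≤ u / 2 := by
    have : h ≤ u / (2 * Real.exp s * V) := min_le_left _ _
    rw [le_div_iff₀ (by positivity)] at this
    linarith
  have hh2 : Real.exp (h * y) * β ≤ 1 := by
    have : h ≤ l / y := min_le_right _ _
    rw [le_div_iff₀ hy0] at this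
    calc Real.exp (h * y) * β ≤ Real.exp l * β := by gcongr
      _ = 1 := by rw [hl, Real.exp_neg, Real.exp_log hβ]; field_simp
  set κ : ℕ → ℝ := fun i => Real.exp s * h ^ 2 * ∫ ω, Y i ω ^ 2 ∂P +
        Real.exp (h * y) * (y ^ (-s) * ∫ ω, |Y i ω| ^ s ∂P) with hκ
  have hys : y ^ (-s) * y ^ s = 1 := by
    rw [← Real.rpow_add hy0]; simp
  have hmom' : ∑ i ∈ Finset.range n, y ^ (-s) * ∫ ω, |Y i ω| ^ s ∂P ≤ β := by
    rw [← Finset.mul_sum]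
    calc _ ≤ y ^ (-s) * (β * y ^ s) := mul_le_mul_of_nonneg_left hmom (by positivity)
      _ = β * (y ^ (-s) * y ^ s) := by ring
      _ = β := by rw [hys, mul_one]
  have hκs : ∑ i ∈ Finset.range n, κ i ≤ h * u / 2 + 1 := by
    simp only [hκ, Finset.sum_add_distrib, ← Finset.mul_sum] at hmom' ⊢
    have a1 : Real.exp s * h ^ 2 * ∑ i ∈ Finset.range n, ∫ ω, Y i ω ^ 2 ∂P ≤
        Real.exp s * h ^ 2 * V := mul_le_mul_of_nonneg_left hvar (by positivity)
    have a2 : Real.exp s * h ^ 2 * V ≤ h * u / 2 := by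
      have := mul_le_mul_of_nonneg_left hh1 hh0.le
      linarith
    have a3 := mul_le_mul_of_nonneg_left hmom' (Real.exp_pos (h * y)).le
    linarith
  have htr := fun i => integral_truncated_exp_le (P := P) hs hh0 hy0 (hY i) (h1 i) (h2 i) (h3 i)
    (h0 i)
  -- a Lipschitz function between the indicators of `(2u, ∞)` and `(u, ∞)`
  set ψ : ℝ → ℝ := fun w => max 0 (min 1 ((w - u) / u)) with hψ
  have hψt : IsTest u⁻¹ ψ := by
    refine ⟨fun x => le_max_left _ _, fun x => max_le zero_le_one (min_le_left _ _), fun x z => ?_⟩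
    calc |ψ x - ψ z| ≤ |min 1 ((x - u) / u) - min 1 ((z - u) / u)| := by
          have := abs_max_sub_max_le_max 0 (min 1 ((x - u) / u)) 0 (min 1 ((z - u) / u))
          simpa [hψ] using this
      _ ≤ |(x - u) / u - (z - u) / u| := by
          have := abs_min_sub_min_le_max 1 ((x - u) / u) 1 ((z - u) / u)
          simpa using this
      _ = u⁻¹ * |x - z| := by
          rw [← sub_div, abs_div, abs_of_pos hu]
          ring_nf
  have hψle : ∀ w, ψ w ≤ Real.exp (-(h * u)) * Real.exp (h * w) + 0 := by
    intro w
    rw [add_zero, ← Real.exp_add]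
    rcases le_or_gt w u with hw | hw
    · have : (w - u) / u ≤ 0 := div_nonpos_of_nonpos_of_nonneg (by linarith) hu.le
      have : ψ w = 0 := max_eq_left ((min_le_right _ _).trans this)
      rw [this]; positivity
    · refine (hψt.le_one w).trans (Real.one_le_exp ?_)
      nlinarith
  have key := integral_test_sum_le Y hY ms hms θ κ hdec (fun i => (htr i).1)
    (fun i => (htr i).2.trans (by
      have := Real.add_one_le_exp (κ i)
      simp only [hκ] at this ⊢
      linarith)) n _ 0 ψ (Real.exp_pos (-(h * u))).le le_rfl hψt hψle
  have hSm : Measurable fun ω => ∑ i ∈ Finset.range n, Y i ω :=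
    Finset.measurable_sum _ fun i _ => hY i
  have hlow : P.real {ω | 2 * u < ∑ i ∈ Finset.range n, Y i ω} ≤
      ∫ ω, ψ (∑ i ∈ Finset.range n, Y i ω) ∂P := by
    have hm : MeasurableSet {ω | 2 * u < ∑ i ∈ Finset.range n, Y i ω} :=
      measurableSet_lt measurable_const hSm
    have : ∫ ω, Set.indicator {ω | 2 * u < ∑ i ∈ Finset.range n, Y i ω} (fun _ => (1 : ℝ)) ω ∂P =
        P.real {ω | 2 * u < ∑ i ∈ Finset.range n, Y i ω} := by
      rw [integral_indicator hm]; simp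
    rw [← this]
    refine integral_mono ((integrable_const (1 : ℝ)).indicator hm) (hψt.integrable hSm) fun ω => ?_
    by_cases hω : 2 * u < ∑ i ∈ Finset.range n, Y i ω
    · rw [Set.indicator_of_mem (by exact hω)]
      refine le_max_of_le_right (le_min le_rfl ?_)
      rw [le_div_iff₀ hu]; linarith
    · rw [Set.indicator_of_notMem (by exact hω)]
      exact hψt.nonneg _
  have hmark : ∑ i ∈ Finset.range n, P.real {ω | y < Y i ω} ≤ β := by
    refine (Finset.sum_le_sum fun i _ => ?_).trans hmom'
    have hsub : {ω | y < Y i ω} ⊆ {ω | y ^ s ≤ |Y i ω| ^ s} := fun ω hω =>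
      Real.rpow_le_rpow hy0.le ((le_of_lt hω).trans (le_abs_self _)) hs.le
    have hmk := mul_meas_ge_le_integral_of_nonneg (μ := P)
      (Eventually.of_forall fun ω => by positivity) (h3 i) (y ^ s)
    have h5 : P.real {ω | y < Y i ω} ≤ P.real {ω | y ^ s ≤ |Y i ω| ^ s} :=
      measureReal_mono hsub
    calc P.real {ω | y < Y i ω} = y ^ (-s) * y ^ s * P.real {ω | y < Y i ω} := by
          rw [hys, one_mul]
      _ ≤ y ^ (-s) * (y ^ s * P.real {ω | y ^ s ≤ |Y i ω| ^ s}) := by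
          rw [mul_assoc]; gcongr
      _ ≤ _ := mul_le_mul_of_nonneg_left hmk (by positivity)
  have hexp : Real.exp (-(h * u)) * Real.exp (∑ i ∈ Finset.range n, κ i) ≤
      3 * (β + Real.exp (-(u ^ 2 / (4 * Real.exp s * V)))) := by
    have e1 : Real.exp (-(h * u)) * Real.exp (∑ i ∈ Finset.range n, κ i) ≤
        Real.exp 1 * Real.exp (-(h * u / 2)) := by
      rw [← Real.exp_add, ← Real.exp_add]
      exact Real.exp_le_exp.2 (by linarith)
    have e2 : Real.exp (-(h * u / 2)) ≤ β + Real.exp (-(u ^ 2 / (4 * Real.exp s * V))) := by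
      rcases min_choice (u / (2 * Real.exp s * V)) (l / y) with hc | hc
      · have : h * u / 2 = u ^ 2 / (4 * Real.exp s * V) := by
          rw [hh, hc]; field_simp; norm_num
        rw [this]; linarith
      · have : -(h * u / 2) = Real.log β := by
          rw [hh, hc, hy, hl]; field_simp
        rw [this, Real.exp_log hβ]; linarith
    have e3 : Real.exp 1 ≤ 3 := Real.exp_one_lt_three.le
    have : 0 < Real.exp (-(h * u / 2)) := Real.exp_pos _
    nlinarith
  have hadd := Finset.sum_add_distrib (s := Finset.range n) (f := fun i => P.real {ω | y < Y i ω})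
    (g := θ)
  linarith

end Iteration

/-! ### Moments and covariances of a `τ`-mixing process -/

section Moments

variable {Ω : Type*} {m : MeasurableSpace Ω} [mΩ : MeasurableSpace Ω] {P : Measure Ω}

lemma integral_abs_rpow_le_of_eLpNorm_le {X : Ω → ℝ} (hX : AEStronglyMeasurable X P) {s k : ℝ}
    (hs : 0 < s) (hk : 0 ≤ k) (h : eLpNorm X (ENNReal.ofReal s) P ≤ ENNReal.ofReal k) :
    Integrable (fun ω => |X ω| ^ s) P ∧ ∫ ω, |X ω| ^ s ∂P ≤ k ^ s := by
  have hL : MemLp X (ENNReal.ofReal s) P := ⟨hX, h.trans_lt ENNReal.ofReal_lt_top⟩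
  have h0 : ENNReal.ofReal s ≠ 0 := by simpa using hs
  have hI := hL.integrable_norm_rpow h0 ENNReal.ofReal_ne_top
  rw [ENNReal.toReal_ofReal hs.le] at hI
  refine ⟨hI, ?_⟩
  rw [hL.eLpNorm_eq_integral_rpow_norm h0 ENNReal.ofReal_ne_top, ENNReal.toReal_ofReal hs.le,
    ENNReal.ofReal_le_ofReal_iff hk] at h
  have hnn : 0 ≤ ∫ ω, |X ω| ^ s ∂P := integral_nonneg fun _ => by positivity
  calc ∫ ω, |X ω| ^ s ∂P = ((∫ ω, |X ω| ^ s ∂P) ^ s⁻¹) ^ s := by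
        rw [← Real.rpow_mul hnn, inv_mul_cancel₀ hs.ne', Real.rpow_one]
    _ ≤ k ^ s := Real.rpow_le_rpow (by positivity) h hs.le

lemma eLpNorm_centered_le [IsProbabilityMeasure P] {X : Ω → ℝ} (hX : AEStronglyMeasurable X P)
    {s k : ℝ} (hs : 1 ≤ s) (hk : 0 ≤ k) (h : eLpNorm X (ENNReal.ofReal s) P ≤ ENNReal.ofReal k) :
    eLpNorm (fun ω => X ω - ∫ ω', X ω' ∂P) (ENNReal.ofReal s) P ≤ ENNReal.ofReal (2 * k) := by
  have hs1 : (1 : ℝ≥0∞) ≤ ENNReal.ofReal s := by simpa using hs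
  have h1 : eLpNorm X 1 P ≤ ENNReal.ofReal k :=
    (eLpNorm_le_eLpNorm_of_exponent_le hs1 hX).trans h
  have hm : ‖∫ ω', X ω' ∂P‖ₑ ≤ ENNReal.ofReal k := by
    refine (enorm_integral_le_lintegral_enorm _).trans ?_
    rwa [← eLpNorm_one_eq_lintegral_enorm]
  have h2 : eLpNorm (fun _ : Ω => ∫ ω', X ω' ∂P) (ENNReal.ofReal s) P ≤ ENNReal.ofReal k := by
    rw [eLpNorm_const _ (by positivity) (IsProbabilityMeasure.ne_zero P)]
    simpa using hm
  calc _ ≤ eLpNorm X (ENNReal.ofReal s) P +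
        eLpNorm (fun _ : Ω => ∫ ω', X ω' ∂P) (ENNReal.ofReal s) P :=
        eLpNorm_sub_le hX aestronglyMeasurable_const hs1
    _ ≤ ENNReal.ofReal k + ENNReal.ofReal k := add_le_add h h2
    _ = ENNReal.ofReal (2 * k) := by rw [← ENNReal.ofReal_add hk hk]; ring_nf

lemma mul_le_rpow_of_lt {s N x z : ℝ} (hs : 2 ≤ s) (hN : 0 < N) (hx : N < |x|) :
    |x * z| ≤ N ^ (2 - s) * (|x| ^ s + |z| ^ s) := by
  have h1 : N ≤ max |x| |z| := hx.le.trans (le_max_left _ _)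
  have h0 : 0 < max |x| |z| := hN.trans_le h1
  calc |x * z| = |x| * |z| := abs_mul _ _
    _ ≤ max |x| |z| * max |x| |z| := mul_le_mul (le_max_left _ _) (le_max_right _ _)
        (abs_nonneg _) h0.le
    _ = (max |x| |z|) ^ (2 - s) * (max |x| |z|) ^ s := by
        rw [← Real.rpow_add h0, ← sq, ← Real.rpow_two]; ring_nf
    _ ≤ N ^ (2 - s) * (|x| ^ s + |z| ^ s) := by
        refine mul_le_mul (Real.rpow_le_rpow_of_nonpos hN h1 (by linarith)) ?_ (by positivity)
          (by positivity)
        rcases max_choice |x| |z| with h | h <;> rw [h]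
        · have : 0 ≤ |z| ^ s := by positivity
          linarith
        · have : 0 ≤ |x| ^ s := by positivity
          linarith

/-- A covariance inequality: `X` is measurable for `m` and is truncated at level `N`. -/
lemma abs_integral_mul_le [IsProbabilityMeasure P] (hm : m ≤ mΩ) {s M θ N : ℝ}
    (hs : 2 ≤ s) (hN : 0 < N) {X Z G : Ω → ℝ} (hX : Measurable[m] X) (hZ : Integrable Z P)
    (hXZ : Integrable (fun ω => X ω * Z ω) P)
    (hXs : Integrable (fun ω => |X ω| ^ s) P) (hZs : Integrable (fun ω => |Z ω| ^ s) P)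
    (hXM : ∫ ω, |X ω| ^ s ∂P ≤ M) (hZM : ∫ ω, |Z ω| ^ s ∂P ≤ M) (hG : Integrable G P)
    (hGZ : ∀ᵐ ω ∂P, |condExp m P Z ω| ≤ G ω) (hGθ : ∫ ω, G ω ∂P ≤ θ) :
    |∫ ω, X ω * Z ω ∂P| ≤ N * θ + 2 * M * N ^ (2 - s) := by
  set A : Set Ω := {ω | |X ω| ≤ N} with hA
  have hAm : MeasurableSet[m] A := (measurable_norm.comp hX) measurableSet_Iic
  have hsplit : ∫ ω, X ω * Z ω ∂P = ∫ ω, A.indicator X ω * Z ω ∂P +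
      ∫ ω in Aᶜ, X ω * Z ω ∂P := by
    rw [← integral_add_compl (hm _ hAm) hXZ, ← integral_indicator (hm _ hAm)]
    congr 2
    ext ω
    by_cases hω : ω ∈ A <;> simp [hω]
  have hXA : StronglyMeasurable[m] (A.indicator X) := hX.stronglyMeasurable.indicator hAm
  have hXAb : ∀ ω, ‖A.indicator X ω‖ ≤ N := by
    intro ω
    by_cases hω : ω ∈ A
    · rw [Set.indicator_of_mem hω]; exact hω
    · simp [hω, hN.le]
  have hint : Integrable (fun ω => A.indicator X ω * Z ω) P :=
    hZ.bdd_mul (hXA.mono hm).aestronglyMeasurable (Eventually.of_forall hXAb)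
  have hfirst : |∫ ω, A.indicator X ω * Z ω ∂P| ≤ N * θ := by
    have e1 : ∫ ω, A.indicator X ω * Z ω ∂P =
        ∫ ω, A.indicator X ω * condExp m P Z ω ∂P := by
      rw [← integral_condExp hm]
      exact integral_congr_ae (condExp_mul_of_stronglyMeasurable_left hXA hint hZ)
    rw [e1]
    refine abs_integral_le_integral_abs.trans ?_
    refine (integral_mono_ae (g := fun ω => N * G ω) ?_ (hG.const_mul N) ?_).trans ?_
    · exact (integrable_condExp.bdd_mul (hXA.mono hm).aestronglyMeasurable
        (Eventually.of_forall hXAb)).abs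
    · filter_upwards [hGZ] with ω hω
      rw [abs_mul]
      exact mul_le_mul (hXAb ω) hω (abs_nonneg _) hN.le
    · rw [integral_const_mul]
      exact mul_le_mul_of_nonneg_left hGθ hN.le
  have hsecond : |∫ ω in Aᶜ, X ω * Z ω ∂P| ≤ 2 * M * N ^ (2 - s) := by
    have hi : Integrable (fun ω => N ^ (2 - s) * (|X ω| ^ s + |Z ω| ^ s)) P :=
      (hXs.add hZs).const_mul _
    calc |∫ ω in Aᶜ, X ω * Z ω ∂P| ≤ ∫ ω in Aᶜ, |X ω * Z ω| ∂P := abs_integral_le_integral_abs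
      _ ≤ ∫ ω in Aᶜ, N ^ (2 - s) * (|X ω| ^ s + |Z ω| ^ s) ∂P := by
          refine setIntegral_mono_on hXZ.abs.integrableOn hi.integrableOn (hm _ hAm).compl
            fun ω hω => mul_le_rpow_of_lt hs hN ?_
          simpa [hA] using hω
      _ ≤ ∫ ω, N ^ (2 - s) * (|X ω| ^ s + |Z ω| ^ s) ∂P :=
          setIntegral_le_integral hi (Eventually.of_forall fun ω => by positivity)
      _ = N ^ (2 - s) * (∫ ω, |X ω| ^ s ∂P + ∫ ω, |Z ω| ^ s ∂P) := by
          rw [integral_const_mul, integral_add hXs hZs]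
      _ ≤ N ^ (2 - s) * (M + M) := by gcongr
      _ = _ := by ring
  rw [hsplit]
  exact (abs_add_le _ _).trans (add_le_add hfirst hsecond)

end Moments

section Mixing

variable {Ω : Type*} [mΩ : MeasurableSpace Ω] {P : Measure Ω}

lemma past_le {ξ : ℤ → Ω → ℝ} (hξ : ∀ t, Measurable (ξ t)) (t : ℤ) : past ξ t ≤ mΩ :=
  iSup₂_le fun s _ => (hξ s).comap_le

omit mΩ in
lemma measurable_past {ξ : ℤ → Ω → ℝ} {s t : ℤ} (h : s ≤ t) : Measurable[past ξ t] (ξ s) := by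
  have : MeasurableSpace.comap (ξ s) inferInstance ≤ past ξ t :=
    le_iSup₂_of_le (f := fun s (_ : s ≤ t) => MeasurableSpace.comap (ξ s) inferInstance) s h le_rfl
  exact Measurable.mono (comap_measurable (ξ s)) this le_rfl

lemma tauDep_le_of_tauCoeff_le {ξ : ℤ → Ω → ℝ} {k : ℕ} {θ : ℝ}
    (h : tauCoeff P ξ k ≤ ENNReal.ofReal θ) {l : ℕ} (hl : 1 ≤ l) {t : ℤ} {s : Fin l → ℤ}
    (hs : StrictMono s) (hts : ∀ i, t + k ≤ s i) :
    tauDep P (past ξ t) (fun ω i => ξ (s i) ω) ≤ ENNReal.ofReal (l * θ) := by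
  have h1 : (l : ℝ≥0∞)⁻¹ * tauDep P (past ξ t) (fun ω i => ξ (s i) ω) ≤ ENNReal.ofReal θ := by
    refine le_trans ?_ h
    unfold tauCoeff
    exact le_iSup_of_le l (le_iSup_of_le hl (le_iSup_of_le t (le_iSup_of_le s
      (le_iSup_of_le hs (le_iSup_of_le hts le_rfl)))))
  have hl0 : (l : ℝ≥0∞) ≠ 0 := by simp; omega
  have := mul_le_mul_right h1 (l : ℝ≥0∞)
  rw [← mul_assoc, ENNReal.mul_inv_cancel hl0 (by simp), one_mul] at this
  rw [ENNReal.ofReal_mul (by positivity), ENNReal.ofReal_natCast]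
  exact this

/-- The covariances of a process with `τ_n ≤ c n^{-a}` and bounded `s`-th moments decay like
`n^{-a(s-2)/(s-1)}`; the truncation level is `n^{a/(s-1)}`. -/
lemma abs_integral_centered_mul_le [IsProbabilityMeasure P] {ξ : ℤ → Ω → ℝ}
    (hξ : ∀ t, Measurable (ξ t)) {s a c k : ℝ} (hs : 2 < s) (hc : 0 < c) (hk : 0 ≤ k)
    (hmom : ∀ t, eLpNorm (ξ t) (ENNReal.ofReal s) P ≤ ENNReal.ofReal k)
    {n : ℕ} (hn : 1 ≤ n) (hτ : tauCoeff P ξ n ≤ ENNReal.ofReal (c * (n : ℝ) ^ (-a))) (t : ℤ) :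
    |∫ ω, (ξ t ω - ∫ ω', ξ t ω' ∂P) * (ξ (t + n) ω - ∫ ω', ξ (t + n) ω' ∂P) ∂P| ≤
      (2 * c + 2 * (2 * k) ^ s) * (n : ℝ) ^ (-(a * (s - 2) / (s - 1))) := by
  have hs1 : 1 ≤ ENNReal.ofReal s := by simpa using (by linarith : (1 : ℝ) ≤ s)
  have hs2 : 2 ≤ ENNReal.ofReal s := by
    rw [← ENNReal.ofReal_ofNat]; exact ENNReal.ofReal_le_ofReal hs.le
  have hn0 : (0 : ℝ) < n := by exact_mod_cast hn
  have hLp : ∀ t, MemLp (ξ t) (ENNReal.ofReal s) P := fun t =>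
    ⟨(hξ t).aestronglyMeasurable, (hmom t).trans_lt ENNReal.ofReal_lt_top⟩
  have hI : ∀ t, Integrable (ξ t) P := fun t => (hLp t).integrable hs1
  have hcm : ∀ t, Measurable (fun ω => ξ t ω - ∫ ω', ξ t ω' ∂P) := fun t =>
    (hξ t).sub measurable_const
  have hcL : ∀ t, MemLp (fun ω => ξ t ω - ∫ ω', ξ t ω' ∂P) 2 P := fun t =>
    ((hLp t).mono_exponent hs2).sub (memLp_const _)
  have hcs := fun t => integral_abs_rpow_le_of_eLpNorm_le (P := P) (hcm t).aestronglyMeasurable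
    (by linarith : 0 < s) (by positivity : 0 ≤ 2 * k)
    (eLpNorm_centered_le (hξ t).aestronglyMeasurable (by linarith) hk (hmom t))
  have hm := past_le hξ t
  set θ : ℝ := c * (n : ℝ) ^ (-a) with hθ
  have hθ0 : 0 < θ := by positivity
  have htau : tauDep P (past ξ t) (fun ω (_ : Fin 1) => ξ (t + n) ω) < ENNReal.ofReal (2 * θ) := by
    refine (tauDep_le_of_tauCoeff_le hτ le_rfl (t := t) (s := fun _ : Fin 1 => t + n)
      (Subsingleton.strictMono _) (fun _ => le_rfl)).trans_lt ?_
    rw [ENNReal.ofReal_lt_ofReal_iff (by positivity)]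
    push_cast; linarith
  unfold tauDep at htau
  simp only [iInf_lt_iff] at htau
  obtain ⟨g, hgm', hg, hlt⟩ := htau
  have hgm : Measurable g := hgm'.mono hm le_rfl
  have hfin : ∫⁻ ω, g ω ∂P ≠ ∞ := (hlt.trans ENNReal.ofReal_lt_top).ne
  have hgi : Integrable (fun ω => (g ω).toReal) P := integrable_toReal_of_lintegral_ne_top
    hgm.aemeasurable hfin
  have hgint : ∫ ω, (g ω).toReal ∂P ≤ 2 * θ := by
    rw [integral_toReal hgm.aemeasurable (ae_lt_top hgm hfin)]
    exact ENNReal.toReal_le_of_le_ofReal (by positivity) hlt.le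
  have hdom : ∀ᵐ ω ∂P, |condExp (past ξ t) P (fun ω => ξ (t + n) ω - ∫ ω', ξ (t + n) ω' ∂P) ω| ≤
      (g ω).toReal := by
    have hl : IsLipOne (fun y : Fin 1 → ℝ => y 0) := by intro y z; simp
    have h3 := condExp_sub (hI (t + n)) (integrable_const (∫ ω', ξ (t + n) ω' ∂P)) (past ξ t)
    rw [condExp_const hm] at h3
    filter_upwards [hg _ hl, ae_lt_top hgm hfin, h3] with ω h1 h2 h3
    rw [ENNReal.ofReal_le_iff_le_toReal h2.ne] at h1
    refine le_trans (le_of_eq ?_) h1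
    exact congrArg _ h3
  set N : ℝ := (n : ℝ) ^ (a / (s - 1)) with hN
  have hN0 : 0 < N := by positivity
  have key := abs_integral_mul_le hm hs.le hN0 ((measurable_past le_rfl).sub measurable_const)
    ((hI (t + n)).sub (integrable_const (∫ ω', ξ (t + n) ω' ∂P)))
    ((hcL t).integrable_mul (hcL (t + n))) (hcs t).1 (hcs (t + n)).1 (hcs t).2 (hcs (t + n)).2
    hgi hdom hgint
  refine key.trans (le_of_eq ?_)
  have e1 : N * (n : ℝ) ^ (-a) = (n : ℝ) ^ (-(a * (s - 2) / (s - 1))) := by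
    rw [hN, ← Real.rpow_add hn0]
    congr 1
    have : s - 1 ≠ 0 := by linarith
    field_simp; ring
  have e2 : N ^ (2 - s) = (n : ℝ) ^ (-(a * (s - 2) / (s - 1))) := by
    rw [hN, ← Real.rpow_mul hn0.le]
    congr 1
    have : s - 1 ≠ 0 := by linarith
    field_simp; ring
  rw [e2, hθ, ← e1]; ring

end Mixing

/-! ### Blocks -/

lemma sum_blocks {α : Type*} [AddCommMonoid α] (f : ℕ → α) (J T n : ℕ) :
    ∑ b ∈ Finset.range n, ∑ i ∈ Finset.range (min J (T - b * J)), f (b * J + i) =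
      ∑ t ∈ Finset.range (min (n * J) T), f t := by
  induction n with
  | zero => simp
  | succ n ih =>
    rw [Finset.sum_range_succ, ih]
    have hs : (n + 1) * J = n * J + J := by ring
    rw [hs]
    generalize n * J = N
    rcases le_total T N with h | h
    · have h1 : min J (T - N) = 0 := by omega
      have h2 : min (N + J) T = min N T := by omega
      rw [h1, h2]; simp
    · have h1 : min N T = N := by omega
      have h2 : min (N + J) T = N + min J (T - N) := by omega
      rw [h1, h2, Finset.sum_range_add]

lemma sum_range_two_mul {α : Type*} [AddCommMonoid α] (f : ℕ → α) (n : ℕ) :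
    ∑ b ∈ Finset.range (2 * n), f b =
      ∑ m ∈ Finset.range n, f (2 * m) + ∑ m ∈ Finset.range n, f (2 * m + 1) := by
  induction n with
  | zero => simp
  | succ n ih =>
    rw [show 2 * (n + 1) = 2 * n + 1 + 1 by ring, Finset.sum_range_succ, Finset.sum_range_succ, ih,
      Finset.sum_range_succ, Finset.sum_range_succ]
    abel

lemma sum_Icc_one_eq_sum_range {α : Type*} [AddCommMonoid α] (f : ℤ → α) (T : ℕ) :
    ∑ t ∈ Finset.Icc (1 : ℤ) T, f t = ∑ t ∈ Finset.range T, f (1 + t) := by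
  refine Finset.sum_nbij' (fun t => (t - 1).toNat) (fun t => 1 + (t : ℤ)) ?_ ?_ ?_ ?_ ?_
  · intro t ht; simp only [Finset.mem_Icc, Finset.mem_range] at *; omega
  · intro t ht; simp only [Finset.mem_Icc, Finset.mem_range] at *; omega
  · intro t ht; simp only [Finset.mem_Icc] at *; omega
  · intro t ht; simp
  · intro t ht
    simp only [Finset.mem_Icc] at ht
    congr 1; omega

section Blocks

variable {Ω : Type*} [mΩ : MeasurableSpace Ω] {P : Measure Ω}

lemma integral_sum_sq_le {η : ℕ → Ω → ℝ} (hη : ∀ i, MemLp (η i) 2 P) {f : ℕ → ℝ} {v Z : ℝ}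
    (hf : ∀ i n, 1 ≤ n → |∫ ω, η i ω * η (i + n) ω ∂P| ≤ f n) (hv : ∀ i, ∫ ω, η i ω ^ 2 ∂P ≤ v)
    (hZ : ∀ l, ∑ i ∈ Finset.range l, f (i + 1) ≤ Z) (l : ℕ) :
    ∫ ω, (∑ i ∈ Finset.range l, η i ω) ^ 2 ∂P ≤ l * (v + 2 * Z) := by
  induction l with
  | zero => simp
  | succ l ih =>
    have hS : MemLp (fun ω => ∑ i ∈ Finset.range l, η i ω) 2 P :=
      memLp_finsetSum _ fun i _ => hη i
    have hij : ∀ i j, Integrable (fun ω => η i ω * η j ω) P := fun i j =>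
      (hη i).integrable_mul (hη j)
    have hcross : Integrable (fun ω => 2 * ∑ i ∈ Finset.range l, η i ω * η l ω) P :=
      (integrable_finsetSum _ fun i _ => hij i l).const_mul 2
    have e : ∀ ω, (∑ i ∈ Finset.range (l + 1), η i ω) ^ 2 =
        (∑ i ∈ Finset.range l, η i ω) ^ 2 + (2 * ∑ i ∈ Finset.range l, η i ω * η l ω +
          η l ω ^ 2) := by
      intro ω
      rw [Finset.sum_range_succ, ← Finset.sum_mul]; ring
    have hlast : Integrable (fun ω => 2 * ∑ i ∈ Finset.range l, η i ω * η l ω + η l ω ^ 2) P :=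
      hcross.add (hη l).integrable_sq
    simp only [e]
    rw [integral_add hS.integrable_sq hlast, integral_add hcross (hη l).integrable_sq,
      integral_const_mul, integral_finsetSum _ fun i _ => hij i l]
    have hsum : ∑ i ∈ Finset.range l, ∫ ω, η i ω * η l ω ∂P ≤ Z := by
      calc _ ≤ ∑ i ∈ Finset.range l, f (l - 1 - i + 1) := by
            refine Finset.sum_le_sum fun i hi => ?_
            rw [Finset.mem_range] at hi
            have h1 := hf i (l - i) (by omega)
            rw [show i + (l - i) = l by omega] at h1
            rw [show l - 1 - i + 1 = l - i by omega]
            exact (le_abs_self _).trans h1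
        _ = ∑ i ∈ Finset.range l, f (i + 1) := Finset.sum_range_reflect (fun i => f (i + 1)) l
        _ ≤ Z := hZ l
    have := hv l
    push_cast
    linarith

lemma integral_abs_sum_rpow_le {η : ℕ → Ω → ℝ} {s M : ℝ} (hs : 1 ≤ s)
    (hη : ∀ i, Measurable (η i)) (hi : ∀ i, Integrable (fun ω => |η i ω| ^ s) P)
    (hM : ∀ i, ∫ ω, |η i ω| ^ s ∂P ≤ M) (l : ℕ) :
    Integrable (fun ω => |∑ i ∈ Finset.range l, η i ω| ^ s) P ∧
      ∫ ω, |∑ i ∈ Finset.range l, η i ω| ^ s ∂P ≤ (l : ℝ) ^ (s - 1) * (l * M) := by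
  have hb : ∀ ω, |∑ i ∈ Finset.range l, η i ω| ^ s ≤
      (l : ℝ) ^ (s - 1) * ∑ i ∈ Finset.range l, |η i ω| ^ s := by
    intro ω
    calc _ ≤ (∑ i ∈ Finset.range l, |η i ω|) ^ s :=
          Real.rpow_le_rpow (abs_nonneg _) (Finset.abs_sum_le_sum_abs _ _) (by linarith)
      _ ≤ _ := by
        simpa using Real.rpow_sum_le_const_mul_sum_rpow (Finset.range l) (fun i => η i ω) hs
  have hI : Integrable (fun ω => (l : ℝ) ^ (s - 1) * ∑ i ∈ Finset.range l, |η i ω| ^ s) P :=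
    (integrable_finsetSum _ fun i _ => hi i).const_mul _
  have hm : Measurable (fun ω => |∑ i ∈ Finset.range l, η i ω| ^ s) :=
    ((Finset.measurable_sum _ fun i _ => hη i).abs).pow_const s
  have hI2 : Integrable (fun ω => |∑ i ∈ Finset.range l, η i ω| ^ s) P :=
    hI.mono' hm.aestronglyMeasurable (Eventually.of_forall fun ω => by
      rw [Real.norm_eq_abs, abs_of_nonneg (by positivity)]; exact hb ω)
  refine ⟨hI2, (integral_mono hI2 hI hb).trans ?_⟩
  rw [integral_const_mul, integral_finsetSum _ fun i _ => hi i]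
  refine mul_le_mul_of_nonneg_left ?_ (by positivity)
  calc _ ≤ ∑ i ∈ Finset.range l, M := Finset.sum_le_sum fun i _ => hM i
    _ = l * M := by simp

/-- The variance constant of block sums of a process with `s`-th moments at most `k ^ s` and
`τ_n ≤ c n^{-a}`. -/
noncomputable def varConst (s a c k : ℝ) : ℝ :=
  1 + (2 * k) ^ s + 2 * ∑' n : ℕ, (2 * c + 2 * (2 * k) ^ s) *
    ((n + 1 : ℕ) : ℝ) ^ (-(a * (s - 2) / (s - 1)))

lemma varConst_pos {s a c k : ℝ} (hc : 0 < c) (hk : 0 < k) : 0 < varConst s a c k := by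
  have : 0 ≤ ∑' n : ℕ, (2 * c + 2 * (2 * k) ^ s) *
      ((n + 1 : ℕ) : ℝ) ^ (-(a * (s - 2) / (s - 1))) := tsum_nonneg fun n => by positivity
  unfold varConst
  positivity

/-- Properties of the centred process used for the block sums. -/
lemma centered_block_bounds [IsProbabilityMeasure P] {ξ : ℤ → Ω → ℝ}
    (hξ : ∀ t, Measurable (ξ t)) {s a c k : ℝ} (hs : 2 < s) (ha : (s - 1) / (s - 2) < a)
    (hc : 0 < c) (hk : 0 < k)
    (hmom : ∀ t, eLpNorm (ξ t) (ENNReal.ofReal s) P ≤ ENNReal.ofReal k)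
    (hτ : ∀ n : ℕ, 1 ≤ n → tauCoeff P ξ n ≤ ENNReal.ofReal (c * (n : ℝ) ^ (-a)))
    (t : ℤ) (l : ℕ) {Y : Ω → ℝ}
    (hY : Y = fun ω => ∑ i ∈ Finset.range l, (ξ (t + i) ω - ∫ ω', ξ (t + i) ω' ∂P)) :
    Integrable Y P ∧ Integrable (fun ω => Y ω ^ 2) P ∧ Integrable (fun ω => |Y ω| ^ s) P ∧
      ∫ ω, Y ω ∂P = 0 ∧ ∫ ω, Y ω ^ 2 ∂P ≤ l * varConst s a c k ∧
      ∫ ω, |Y ω| ^ s ∂P ≤ (l : ℝ) ^ (s - 1) * (l * (2 * k) ^ s) := by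
  have hs1 : 1 ≤ ENNReal.ofReal s := by simpa using (by linarith : (1 : ℝ) ≤ s)
  have hs2 : 2 ≤ ENNReal.ofReal s := by
    rw [← ENNReal.ofReal_ofNat]; exact ENNReal.ofReal_le_ofReal hs.le
  have hLp : ∀ t, MemLp (ξ t) (ENNReal.ofReal s) P := fun t =>
    ⟨(hξ t).aestronglyMeasurable, (hmom t).trans_lt ENNReal.ofReal_lt_top⟩
  have hI : ∀ t, Integrable (ξ t) P := fun t => (hLp t).integrable hs1
  set η : ℕ → Ω → ℝ := fun i ω => ξ (t + i) ω - ∫ ω', ξ (t + i) ω' ∂P with hη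
  have hηm : ∀ i, Measurable (η i) := fun i => (hξ _).sub measurable_const
  have hηL : ∀ i, MemLp (η i) 2 P := fun i =>
    ((hLp _).mono_exponent hs2).sub (memLp_const _)
  have hηi : ∀ i, Integrable (η i) P := fun i => (hηL i).integrable one_le_two
  have hηs := fun i => integral_abs_rpow_le_of_eLpNorm_le (P := P) (hηm i).aestronglyMeasurable
    (by linarith : 0 < s) (by positivity : 0 ≤ 2 * k)
    (eLpNorm_centered_le (hξ _).aestronglyMeasurable (by linarith) hk.le (hmom _))
  have hYL : MemLp Y 2 P := by rw [hY]; exact memLp_finsetSum _ fun i _ => hηL i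
  have hblock := integral_abs_sum_rpow_le (P := P) (by linarith : 1 ≤ s) hηm
    (fun i => (hηs i).1) (fun i => (hηs i).2) l
  have hcov : ∀ i n : ℕ, 1 ≤ n → |∫ ω, η i ω * η (i + n) ω ∂P| ≤
      (2 * c + 2 * (2 * k) ^ s) * (n : ℝ) ^ (-(a * (s - 2) / (s - 1))) := by
    intro i n hn
    have h1 := abs_integral_centered_mul_le hξ hs hc hk.le hmom hn (hτ n hn) (t + i)
    simp only [hη]
    push_cast
    rw [← add_assoc]
    exact h1
  have hexp : 1 < a * (s - 2) / (s - 1) := by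
    have h2 : 0 < s - 2 := by linarith
    rw [div_lt_iff₀ h2] at ha
    rw [lt_div_iff₀ (by linarith)]; linarith
  have hsum : Summable fun n : ℕ => (2 * c + 2 * (2 * k) ^ s) *
      ((n + 1 : ℕ) : ℝ) ^ (-(a * (s - 2) / (s - 1))) := by
    refine Summable.mul_left _ ?_
    exact (summable_nat_add_iff (f := fun n : ℕ => (n : ℝ) ^ (-(a * (s - 2) / (s - 1)))) 1).2
      (Real.summable_nat_rpow.2 (by linarith))
  have hsq : ∀ i, ∫ ω, η i ω ^ 2 ∂P ≤ 1 + (2 * k) ^ s := by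
    intro i
    have hpt : ∀ ω, η i ω ^ 2 ≤ 1 + |η i ω| ^ s := by
      intro ω
      rcases le_total |η i ω| 1 with h | h
      · have h3 : η i ω ^ 2 ≤ 1 := by rw [← sq_abs]; exact pow_le_one₀ (abs_nonneg _) h
        have : 0 ≤ |η i ω| ^ s := by positivity
        linarith
      · have h3 : |η i ω| ^ (2 : ℝ) ≤ |η i ω| ^ s := Real.rpow_le_rpow_of_exponent_le h hs.le
        rw [Real.rpow_two, sq_abs] at h3
        linarith
    have := integral_mono (hηL i).integrable_sq ((integrable_const 1).add (hηs i).1) hpt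
    simp only [Pi.add_apply] at this
    rw [integral_add (integrable_const _) (hηs i).1] at this
    have h4 := (hηs i).2
    simp at this
    simp only [hη] at this h4 ⊢
    linarith
  refine ⟨hYL.integrable one_le_two, hYL.integrable_sq, ?_, ?_, ?_, ?_⟩
  · rw [hY]; exact hblock.1
  · rw [hY, integral_finsetSum _ fun i _ => hηi i]
    refine Finset.sum_eq_zero fun i _ => ?_
    simp only [hη]
    rw [integral_sub (hI _) (integrable_const _)]; simp
  · rw [hY]
    exact integral_sum_sq_le hηL hcov hsq
      (fun l => hsum.sum_le_tsum (Finset.range l) (fun n _ => by positivity)) l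
  · rw [hY]; exact hblock.2

end Blocks

/-! ### A Fuk–Nagaev inequality for `τ`-mixing processes -/

section FukNagaev

variable {Ω : Type*} [mΩ : MeasurableSpace Ω] {P : Measure Ω}

/-- The sum of every second block of length `J` of the centred process with sign `e`, over times
`1, …, T`. Conditionally on the past, a block decouples from the preceding ones since it is
separated from them by `J` time points. -/
lemma tail_alternate_blocks_le [IsProbabilityMeasure P] {ξ : ℤ → Ω → ℝ}
    (hξ : ∀ t, Measurable (ξ t)) {s a c k : ℝ} (hs : 2 < s) (ha : (s - 1) / (s - 2) < a)
    (hc : 0 < c) (hk : 0 < k)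
    (hmom : ∀ t, eLpNorm (ξ t) (ENNReal.ofReal s) P ≤ ENNReal.ofReal k)
    (hτ : ∀ n : ℕ, 1 ≤ n → tauCoeff P ξ n ≤ ENNReal.ofReal (c * (n : ℝ) ^ (-a)))
    {e : ℝ} (he : |e| = 1) (o : ℕ) (ho : o < 2) {J T : ℕ} (hJ : 1 ≤ J) (hT : 1 ≤ T) {u : ℝ}
    (hu : 0 < u) :
    P.real {ω | 2 * u < ∑ m ∈ Finset.range T, e * ∑ i ∈ Finset.range (min J (T - (2 * m + o) * J)),
        (ξ (1 + ((2 * m + o) * J + i : ℕ)) ω - ∫ ω', ξ (1 + ((2 * m + o) * J + i : ℕ)) ω' ∂P)} ≤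
      4 * ((J : ℝ) ^ (s - 1) * (T * (2 * k) ^ s) * (u / 2) ^ (-s)) +
        3 * Real.exp (-(u ^ 2 / (4 * Real.exp s * (T * varConst s a c k)))) +
        u⁻¹ * (T * (c * (J : ℝ) ^ (-a))) := by
  set L : ℕ → ℕ := fun m => min J (T - (2 * m + o) * J) with hL
  have hLJ : ∀ m, L m ≤ J := fun m => min_le_left _ _
  have hLT : ∑ m ∈ Finset.range T, L m ≤ T := by
    have h1 := sum_blocks (fun _ => 1) J T (2 * T)
    rw [sum_range_two_mul] at h1
    simp only [Finset.sum_const, Finset.card_range, smul_eq_mul, mul_one] at h1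
    have h2 : min (2 * T * J) T ≤ T := min_le_right _ _
    interval_cases o
    · simp only [hL, add_zero]; omega
    · simp only [hL]; omega
  have hLT' : ∑ m ∈ Finset.range T, (L m : ℝ) ≤ T := by exact_mod_cast hLT
  have hT0 : (0 : ℝ) < T := by exact_mod_cast hT
  have hJ0 : (0 : ℝ) < J := by exact_mod_cast hJ
  set X : ℕ → Ω → ℝ := fun m ω => ∑ i ∈ Finset.range (L m),
    (ξ (1 + ((2 * m + o) * J + i : ℕ)) ω - ∫ ω', ξ (1 + ((2 * m + o) * J + i : ℕ)) ω' ∂P) with hX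
  have hXm : ∀ m, Measurable (X m) := fun m =>
    Finset.measurable_sum _ fun i _ => (hξ _).sub measurable_const
  have hB := fun m => centered_block_bounds hξ hs ha hc hk hmom hτ (1 + ((2 * m + o) * J : ℕ))
    (L m) (Y := X m) (by
      simp only [hX]; push_cast; simp only [← add_assoc])
  have hVp := varConst_pos (s := s) (a := a) hc hk
  have hsq : ∀ m ω, (e * X m ω) ^ 2 = X m ω ^ 2 := by
    intro m ω; rw [mul_pow, ← sq_abs e, he]; ring
  have habs : ∀ m ω, |e * X m ω| = |X m ω| := by
    intro m ω; rw [abs_mul, he, one_mul]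
  set t0 : ℕ → ℤ := fun m => (2 * (m : ℤ) + o - 1) * J with ht0
  have key := tail_sum_le_of_decoupled (P := P) (s := s) (u := u) (V := T * varConst s a c k)
    (β := (J : ℝ) ^ (s - 1) * (T * (2 * k) ^ s) * (u / 2) ^ (-s)) (by linarith) hu
    (by positivity) (by positivity)
    (fun m ω => e * X m ω) (fun m => (hXm m).const_mul e) (fun m => past ξ (t0 m)) ?_
    (fun m => u⁻¹ * (L m * (c * (J : ℝ) ^ (-a)))) ?_
    (fun m => (hB m).1.const_mul e) (fun m => by simpa only [hsq] using (hB m).2.1)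
    (fun m => by simpa only [habs] using (hB m).2.2.1)
    (fun m => by rw [integral_const_mul, (hB m).2.2.2.1, mul_zero]) T ?_ ?_
    (Finset.sum_nonneg fun m _ => by positivity)
  · refine key.trans (add_le_add le_rfl ?_)
    rw [← Finset.mul_sum, ← Finset.sum_mul]
    gcongr
  · intro n
    refine Finset.measurable_sum _ fun m hm => Measurable.const_mul
      (Finset.measurable_sum _ fun i hi => Measurable.sub (measurable_past ?_) measurable_const) e
    rw [Finset.mem_range] at hm hi
    have hi' : i < J := hi.trans_le (hLJ m)
    have h1 : (2 * m + o + 1) * J ≤ (2 * n + o - 1) * J := Nat.mul_le_mul_right _ (by omega)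
    have h2 : ((2 * n + o - 1 : ℕ) : ℤ) = 2 * (n : ℤ) + o - 1 := by omega
    simp only [ht0]
    rw [← h2]
    have h3 : (2 * m + o + 1) * J = (2 * m + o) * J + J := by ring
    have h4 : 1 + ((2 * m + o) * J + i) ≤ (2 * n + o - 1) * J := by omega
    exact_mod_cast h4
  · intro m ψ hψ W hW
    have hm := past_le hξ (t0 m)
    rcases Nat.eq_zero_or_pos (L m) with h0 | hpos
    · simp only [hX, h0]
      simp
    · have hτm := tauDep_le_of_tauCoeff_le (P := P) (hτ J hJ) hpos (t := t0 m)
        (s := fun i : Fin (L m) => 1 + ((2 * m + o) * J + (i : ℕ) : ℕ)) (by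
          intro i j hij
          have : (i : ℕ) < j := hij
          simp only
          omega) (by
          intro i
          simp only [ht0]
          push_cast
          nlinarith [(Nat.cast_nonneg (i : ℕ) : (0 : ℤ) ≤ ((i : ℕ) : ℤ))])
      have hdec := integral_test_add_block_le hm (inv_pos.2 hu) hψ (fun i => hξ _) he
        (∑ i ∈ Finset.range (L m), ∫ ω', ξ (1 + ((2 * m + o) * J + i : ℕ)) ω' ∂P)
        (by positivity) hτm hW
      have hXe : ∀ ω, X m ω = ∑ i : Fin (L m), ξ (1 + ((2 * m + o) * J + (i : ℕ) : ℕ)) ω -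
          ∑ i ∈ Finset.range (L m), ∫ ω', ξ (1 + ((2 * m + o) * J + i : ℕ)) ω' ∂P := by
        intro ω
        simp only [hX]
        rw [Finset.sum_sub_distrib, Finset.sum_range]
      simp only [hXe]
      exact hdec
  · simp only [hsq]
    calc _ ≤ ∑ m ∈ Finset.range T, (L m : ℝ) * varConst s a c k :=
          Finset.sum_le_sum fun m _ => (hB m).2.2.2.2.1
      _ ≤ _ := by rw [← Finset.sum_mul]; gcongr
  · simp only [habs]
    have hu2 : (u / 2) ^ (-s) * (u / 2) ^ s = 1 := by
      rw [← Real.rpow_add (by positivity)]; simp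
    rw [mul_assoc, hu2, mul_one]
    calc _ ≤ ∑ m ∈ Finset.range T, (J : ℝ) ^ (s - 1) * (L m * (2 * k) ^ s) := by
          refine Finset.sum_le_sum fun m _ => (hB m).2.2.2.2.2.trans ?_
          have : (L m : ℝ) ≤ J := by exact_mod_cast hLJ m
          exact mul_le_mul_of_nonneg_right (Real.rpow_le_rpow (by positivity) this (by linarith))
            (by positivity)
      _ ≤ _ := by rw [← Finset.mul_sum, ← Finset.sum_mul]; gcongr

/-- The tail exponent in the Fuk–Nagaev inequality for a process with `s` moments and mixing
rate `a`. -/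
noncomputable def fukNagaevExp (s a : ℝ) : ℝ := ((a + 1) * s - 1) / (a + s - 1)

/-- A tail bound for partial sums, with constants `A` and `B`, that holds for all processes with
`s`-th moments bounded through `k` and `τ_n ≤ c n^{-a}`. -/
def FukNagaevBound (P : Measure Ω) (s a c k A B : ℝ) : Prop :=
  ∀ ξ : ℤ → Ω → ℝ, (∀ t, Measurable (ξ t)) →
    (∀ t, eLpNorm (ξ t) (ENNReal.ofReal s) P ≤ ENNReal.ofReal k) →
    (∀ n : ℕ, 1 ≤ n → tauCoeff P ξ n ≤ ENNReal.ofReal (c * (n : ℝ) ^ (-a))) →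
    ∀ (T : ℕ) (u : ℝ), 1 ≤ T → 0 < u →
    P.real {ω | u < |∑ t ∈ Finset.Icc (1 : ℤ) T, (ξ t ω - ∫ ω', ξ t ω' ∂P)|} ≤
      A * (T * u ^ (-fukNagaevExp s a) + Real.exp (-(B * (u ^ 2 / T))))

/-- Fuk–Nagaev inequality for `τ`-mixing processes. The block length `u^{(s-1)/(a+s-1)}` balances
the moment term against the cost of decoupling the blocks. -/
theorem fuk_nagaev {s a c k : ℝ} (hs : 2 < s) (ha : (s - 1) / (s - 2) < a)
    (hc : 0 < c) (hk : 0 < k) :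
    ∃ A B : ℝ, 0 < A ∧ 0 < B ∧ ∀ (Ω : Type*) [MeasurableSpace Ω] (P : Measure Ω)
      [IsProbabilityMeasure P], FukNagaevBound P s a c k A B := by
  have ha0 : 0 < a := lt_trans (div_pos (by linarith) (by linarith)) ha
  have hV := varConst_pos (s := s) (a := a) hc hk
  have hd : 0 < a + s - 1 := by linarith
  set A₁ : ℝ := 4 * (2 ^ (s - 1) * (2 * k) ^ s * (1 / 8) ^ (-s)) + 4 * c with hA₁
  have hA₁0 : 0 < A₁ := by positivity
  set B : ℝ := (64 * Real.exp s * varConst s a c k)⁻¹ with hB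
  refine ⟨4 * (A₁ + 3) + 1, B, by positivity, by positivity, ?_⟩
  intro Ω _ P _ ξ hξ hmom hτ T u hT hu
  have hT0 : (0 : ℝ) < T := by exact_mod_cast hT
  have hT1 : (1 : ℝ) ≤ T := by exact_mod_cast hT
  set κ := fukNagaevExp s a with hκ
  have hκ0 : 0 < κ := div_pos (by nlinarith) hd
  have hE : 0 < Real.exp (-(B * (u ^ 2 / T))) := Real.exp_pos _
  rcases le_or_gt u 1 with hu1 | hu1
  · have h1 : 1 ≤ T * u ^ (-κ) := by
      have : 1 ≤ u ^ (-κ) := Real.one_le_rpow_of_pos_of_le_one_of_nonpos hu hu1 (by linarith)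
      nlinarith
    have h2 : P.real {ω | u < |∑ t ∈ Finset.Icc (1 : ℤ) T, (ξ t ω - ∫ ω', ξ t ω' ∂P)|} ≤ 1 :=
      measureReal_le_one
    nlinarith
  set ϑ : ℝ := (s - 1) / (a + s - 1) with hϑ
  have hϑ0 : 0 < ϑ := div_pos (by linarith) hd
  set J : ℕ := ⌈u ^ ϑ⌉₊ with hJ
  have huϑ : 1 ≤ u ^ ϑ := Real.one_le_rpow hu1.le hϑ0.le
  have hJ1 : 1 ≤ J := Nat.one_le_ceil_iff.2 (by positivity)
  have hJl : u ^ ϑ ≤ J := Nat.le_ceil _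
  have hJu : (J : ℝ) ≤ 2 * u ^ ϑ := by
    have := Nat.ceil_lt_add_one (by positivity : 0 ≤ u ^ ϑ)
    linarith
  have hJ0 : (0 : ℝ) < J := by exact_mod_cast hJ1
  have hsingle : ∀ e : ℝ, |e| = 1 → ∀ o : ℕ, o < 2 →
      P.real {ω | 2 * (u / 4) < ∑ m ∈ Finset.range T,
        e * ∑ i ∈ Finset.range (min J (T - (2 * m + o) * J)),
        (ξ (1 + ((2 * m + o) * J + i : ℕ)) ω - ∫ ω', ξ (1 + ((2 * m + o) * J + i : ℕ)) ω' ∂P)} ≤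
      (A₁ + 3) * (T * u ^ (-κ) + Real.exp (-(B * (u ^ 2 / T)))) := by
    intro e he o ho
    refine (tail_alternate_blocks_le hξ hs ha hc hk hmom hτ he o ho hJ1 hT
      (by positivity : 0 < u / 4)).trans ?_
    have t1 : (J : ℝ) ^ (s - 1) * (T * (2 * k) ^ s) * (u / 4 / 2) ^ (-s) ≤
        2 ^ (s - 1) * (2 * k) ^ s * (1 / 8) ^ (-s) * (T * u ^ (-κ)) := by
      have e1 : (J : ℝ) ^ (s - 1) ≤ 2 ^ (s - 1) * u ^ (ϑ * (s - 1)) := by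
        calc (J : ℝ) ^ (s - 1) ≤ (2 * u ^ ϑ) ^ (s - 1) :=
              Real.rpow_le_rpow hJ0.le hJu (by linarith)
          _ = _ := by rw [Real.mul_rpow (by norm_num) (by positivity), ← Real.rpow_mul hu.le]
      have e2 : (u / 4 / 2) ^ (-s) = (1 / 8) ^ (-s) * u ^ (-s) := by
        rw [← Real.mul_rpow (by norm_num) hu.le]; ring_nf
      have e3 : u ^ (ϑ * (s - 1)) * u ^ (-s) = u ^ (-κ) := by
        rw [← Real.rpow_add hu]
        congr 1
        rw [hϑ, hκ, fukNagaevExp]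
        field_simp; ring
      rw [e2, ← e3]
      calc _ ≤ 2 ^ (s - 1) * u ^ (ϑ * (s - 1)) * (T * (2 * k) ^ s) * ((1 / 8) ^ (-s) * u ^ (-s)) := by
            gcongr
        _ = _ := by ring
    have t2 : (u / 4)⁻¹ * (T * (c * (J : ℝ) ^ (-a))) ≤ 4 * c * (T * u ^ (-κ)) := by
      have e1 : (J : ℝ) ^ (-a) ≤ u ^ (ϑ * (-a)) := by
        rw [Real.rpow_mul hu.le]
        exact Real.rpow_le_rpow_of_nonpos (by positivity) hJl (by linarith)
      have e3 : u⁻¹ * u ^ (ϑ * (-a)) = u ^ (-κ) := by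
        rw [← Real.rpow_neg_one, ← Real.rpow_add hu]
        congr 1
        rw [hϑ, hκ, fukNagaevExp]
        field_simp; ring
      rw [← e3]
      calc _ ≤ (u / 4)⁻¹ * (T * (c * u ^ (ϑ * (-a)))) := by gcongr
        _ = _ := by field_simp
    have t3 : (u / 4) ^ 2 / (4 * Real.exp s * (T * varConst s a c k)) = B * (u ^ 2 / T) := by
      rw [hB]; field_simp; norm_num
    rw [t3]
    have h0 : 0 ≤ T * u ^ (-κ) := by positivity
    have h9 : A₁ * (T * u ^ (-κ)) = 4 * (2 ^ (s - 1) * (2 * k) ^ s * (1 / 8) ^ (-s) *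
      (T * u ^ (-κ))) + 4 * c * (T * u ^ (-κ)) := by rw [hA₁]; ring
    have h8 : 0 < A₁ * Real.exp (-(B * (u ^ 2 / T))) := by positivity
    linarith
  have hpart : ∀ e ω, e * ∑ t ∈ Finset.Icc (1 : ℤ) T, (ξ t ω - ∫ ω', ξ t ω' ∂P) =
      ∑ m ∈ Finset.range T, e * ∑ i ∈ Finset.range (min J (T - (2 * m + 0) * J)),
        (ξ (1 + ((2 * m + 0) * J + i : ℕ)) ω - ∫ ω', ξ (1 + ((2 * m + 0) * J + i : ℕ)) ω' ∂P) +
      ∑ m ∈ Finset.range T, e * ∑ i ∈ Finset.range (min J (T - (2 * m + 1) * J)),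
        (ξ (1 + ((2 * m + 1) * J + i : ℕ)) ω - ∫ ω', ξ (1 + ((2 * m + 1) * J + i : ℕ)) ω' ∂P) := by
    intro e ω
    rw [← Finset.mul_sum, ← Finset.mul_sum, ← mul_add]
    congr 1
    have h1 := sum_blocks (fun t : ℕ => ξ (1 + (t : ℤ)) ω - ∫ ω', ξ (1 + (t : ℤ)) ω' ∂P) J T (2 * T)
    have h2 : min (2 * T * J) T = T := min_eq_right (by nlinarith)
    rw [sum_range_two_mul, h2] at h1
    rw [sum_Icc_one_eq_sum_range, ← h1]
    rfl
  set E : ℝ → ℕ → Set Ω := fun e o => {ω | 2 * (u / 4) < ∑ m ∈ Finset.range T,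
        e * ∑ i ∈ Finset.range (min J (T - (2 * m + o) * J)),
        (ξ (1 + ((2 * m + o) * J + i : ℕ)) ω - ∫ ω', ξ (1 + ((2 * m + o) * J + i : ℕ)) ω' ∂P)} with hEdef
  have hsub : {ω | u < |∑ t ∈ Finset.Icc (1 : ℤ) T, (ξ t ω - ∫ ω', ξ t ω' ∂P)|} ⊆
      (E 1 0 ∪ E 1 1) ∪ (E (-1) 0 ∪ E (-1) 1) := by
    intro ω hω
    have hcase : ∀ e : ℝ, u < e * ∑ t ∈ Finset.Icc (1 : ℤ) T, (ξ t ω - ∫ ω', ξ t ω' ∂P) →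
        ω ∈ E e 0 ∪ E e 1 := by
      intro e h
      rw [hpart] at h
      by_contra hcon
      simp only [hEdef, Set.mem_union, Set.mem_ofPred_eq, not_or, not_lt] at hcon
      linarith [hcon.1, hcon.2]
    rw [Set.mem_ofPred_eq] at hω
    rcases lt_abs.1 hω with h | h
    · exact Or.inl (hcase 1 (by rwa [one_mul]))
    · exact Or.inr (hcase (-1) (by rwa [neg_one_mul]))
  have hmeas : P.real {ω | u < |∑ t ∈ Finset.Icc (1 : ℤ) T, (ξ t ω - ∫ ω', ξ t ω' ∂P)|} ≤
      P.real (E 1 0) + P.real (E 1 1) + (P.real (E (-1) 0) + P.real (E (-1) 1)) :=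
    (measureReal_mono hsub).trans ((measureReal_union_le _ _).trans
      (add_le_add (measureReal_union_le _ _) (measureReal_union_le _ _)))
  have s1 := hsingle 1 (by simp) 0 (by norm_num)
  have s2 := hsingle 1 (by simp) 1 (by norm_num)
  have s3 := hsingle (-1) (by simp) 0 (by norm_num)
  have s4 := hsingle (-1) (by simp) 1 (by norm_num)
  have h0 : 0 ≤ T * u ^ (-κ) + Real.exp (-(B * (u ^ 2 / T))) := by positivity
  simp only [hEdef] at hmeas
  linarith

end FukNagaev

/-! ### Deterministic analysis of the LASSO -/

section Lasso

variable {ι : Type*} [Fintype ι]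

lemma sum_filter_abs_le_sqrt_mul {γ Δ : ι → ℝ} {s : ℝ} (hs : (numNonzero γ : ℝ) ≤ s) :
    ∑ k with γ k ≠ 0, |Δ k| ≤ √s * √(∑ k, Δ k ^ 2) := by
  classical
  rw [← Real.sqrt_mul' _ (Finset.sum_nonneg fun k _ => sq_nonneg _)]
  refine Real.le_sqrt_of_sq_le ?_
  refine sq_sum_le_card_mul_sum_sq.trans ?_
  have hc : ((Finset.univ.filter fun k => γ k ≠ 0).card : ℝ) ≤ s := by
    refine le_trans (le_of_eq ?_) hs
    unfold numNonzero
    congr! 2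
  refine mul_le_mul hc ?_ (Finset.sum_nonneg fun k _ => sq_nonneg _)
    ((Nat.cast_nonneg _).trans hc)
  simp only [sq_abs]
  exact Finset.sum_le_sum_of_subset_of_nonneg (Finset.filter_subset _ _) fun k _ _ => sq_nonneg _

lemma sum_abs_le_sqrt_mul {γ : ι → ℝ} {s : ℝ} (hs : (numNonzero γ : ℝ) ≤ s) :
    ∑ k, |γ k| ≤ √s * √(∑ k, γ k ^ 2) := by
  classical
  refine le_trans (le_of_eq ?_) (sum_filter_abs_le_sqrt_mul (Δ := γ) hs)
  rw [Finset.sum_filter]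
  refine Finset.sum_congr rfl fun k _ => ?_
  by_cases h : γ k = 0 <;> simp [h]

/-- The oracle inequality. The noise `z` need not be dominated by the penalty level `lam`
everywhere: an excess of size `M lam` in Euclidean norm only enlarges the cone to which the error
`Δ` belongs. -/
lemma lasso_oracle {γ γ' z : ι → ℝ} {Q lam M s γ₀ η : ℝ} (hlam : 0 < lam) (hM : 0 ≤ M) (hs1 : 1 ≤ s)
    (hs : (numNonzero γ : ℝ) ≤ s) (hγ₀ : 0 < γ₀) (hQ : 0 ≤ Q) (hη : 0 ≤ η)
    (hbasic : Q - 2 * ∑ k, (γ' k - γ k) * z k + 2 * lam * ∑ k, |γ' k| ≤ 2 * lam * ∑ k, |γ k|)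
    (hnoise : |∑ k, (γ' k - γ k) * z k| ≤
      lam / 2 * ∑ k, |γ' k - γ k| + M * lam * √(∑ k, (γ' k - γ k) ^ 2))
    (hRE : γ₀ * ∑ k, (γ' k - γ k) ^ 2 - η * (∑ k, |γ' k - γ k|) ^ 2 ≤ Q)
    (hηs : η * ((4 + 2 * M) ^ 2 * s) ≤ γ₀ / 2) :
    ∑ k, |γ' k - γ k| ≤ 2 * (4 + 2 * M) ^ 2 / γ₀ * (lam * s) ∧
      Q ≤ 2 * (4 + 2 * M) ^ 2 / γ₀ * (lam ^ 2 * s) ∧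
      |∑ k, (γ' k - γ k) * z k| ≤ 2 * (4 + 2 * M) ^ 2 / γ₀ * (lam ^ 2 * s) := by
  classical
  set H := 4 + 2 * M with hH
  have hH0 : 0 < H := by positivity
  set D := ∑ k, |γ' k - γ k| with hD
  set d := √(∑ k, (γ' k - γ k) ^ 2) with hd
  have hd2 : d ^ 2 = ∑ k, (γ' k - γ k) ^ 2 :=
    Real.sq_sqrt (Finset.sum_nonneg fun k _ => sq_nonneg _)
  have hd0 : 0 ≤ d := Real.sqrt_nonneg _
  have hD0 : 0 ≤ D := Finset.sum_nonneg fun k _ => abs_nonneg _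
  set w := √s with hw
  have hw2 : w ^ 2 = s := Real.sq_sqrt (by linarith)
  have hw1 : 1 ≤ w := Real.one_le_sqrt.2 hs1
  have hS := sum_filter_abs_le_sqrt_mul (Δ := fun k => γ' k - γ k) hs
  have hcone : ∑ k, |γ k| - ∑ k, |γ' k| ≤ 2 * ∑ k with γ k ≠ 0, |γ' k - γ k| - D := by
    rw [hD, Finset.sum_filter, Finset.mul_sum, ← Finset.sum_sub_distrib, ← Finset.sum_sub_distrib]
    refine Finset.sum_le_sum fun k _ => ?_
    by_cases h : γ k = 0
    · simp [h]
    · rw [if_pos h]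
      have := abs_sub_abs_le_abs_sub (γ k) (γ' k)
      rw [abs_sub_comm (γ k)] at this
      linarith
  have hz := (abs_le.1 hnoise).2
  have hSd : lam * ∑ k with γ k ≠ 0, |γ' k - γ k| ≤ lam * (w * d) :=
    mul_le_mul_of_nonneg_left hS hlam.le
  have hcl := mul_le_mul_of_nonneg_left hcone hlam.le
  have hmain : Q + lam * D ≤ lam * (H * (w * d)) := by
    have h1 : M * d ≤ M * (w * d) :=
      mul_le_mul_of_nonneg_left (le_mul_of_one_le_left hd0 hw1) hM
    have h2 := mul_le_mul_of_nonneg_left h1 hlam.le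
    rw [hH]
    linarith
  have hwd : 0 ≤ w * d := by positivity
  have hDle : D ≤ H * (w * d) := by
    have : lam * D ≤ lam * (H * (w * d)) := by linarith
    exact le_of_mul_le_mul_left this hlam
  have hQle : Q ≤ lam * (H * (w * d)) := by
    have : 0 ≤ lam * D := by positivity
    linarith
  have hDsq : η * D ^ 2 ≤ γ₀ / 2 * d ^ 2 := by
    calc η * D ^ 2 ≤ η * (H * (w * d)) ^ 2 := by gcongr
      _ = η * (H ^ 2 * s) * d ^ 2 := by rw [← hw2]; ring
      _ ≤ γ₀ / 2 * d ^ 2 := by gcongr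
  have hdle : d ≤ 2 * H / γ₀ * (lam * w) := by
    rcases hd0.eq_or_lt with h0 | hpos
    · rw [← h0]; positivity
    · have h1 : γ₀ / 2 * d * d ≤ lam * (H * w) * d := by
        rw [← hd2] at hRE
        nlinarith
      have h2 := le_of_mul_le_mul_right h1 hpos
      rw [div_mul_eq_mul_div, le_div_iff₀ hγ₀]
      linarith
  have hkey : H * (w * d) ≤ 2 * H ^ 2 / γ₀ * (lam * s) := by
    calc H * (w * d) ≤ H * (w * (2 * H / γ₀ * (lam * w))) := by gcongr
      _ = 2 * H ^ 2 / γ₀ * (lam * w ^ 2) := by ring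
      _ = _ := by rw [hw2]
  have hkey2 : lam * (H * (w * d)) ≤ 2 * H ^ 2 / γ₀ * (lam ^ 2 * s) := by
    calc lam * (H * (w * d)) ≤ lam * (2 * H ^ 2 / γ₀ * (lam * s)) := by gcongr
      _ = _ := by ring
  refine ⟨hDle.trans hkey, hQle.trans hkey2, hnoise.trans (le_trans ?_ hkey2)⟩
  have h1 : M * lam * d ≤ lam * (H * (w * d)) / 2 := by
    have h2 : M * d ≤ H / 2 * (w * d) := by
      refine mul_le_mul (by rw [hH]; linarith) (le_mul_of_one_le_left hd0 hw1) hd0 (by positivity)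
    have := mul_le_mul_of_nonneg_left h2 hlam.le
    linarith
  have h2 := mul_le_mul_of_nonneg_left hDle hlam.le
  linarith

end Lasso

lemma nonpos_of_forall_mul_le {B q : ℝ} (h : ∀ τ : ℝ, 0 < τ → τ ≤ 1 → 2 * τ * B ≤ τ ^ 2 * q) :
    B ≤ 0 := by
  by_contra hB
  rw [not_le] at hB
  set τ := min 1 (B / (|q| + 1)) with hτ
  have hq : 0 < |q| + 1 := by positivity
  have hτ0 : 0 < τ := lt_min one_pos (by positivity)
  have h1 := h τ hτ0 (min_le_left _ _)
  have h2 : τ * (|q| + 1) ≤ B := (le_div_iff₀ hq).1 (min_le_right _ _)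
  have h3 : 2 * B ≤ τ * q := by
    have : τ * (2 * B) ≤ τ * (τ * q) := by linarith
    exact le_of_mul_le_mul_left this hτ0
  have h4 : τ * q ≤ τ * |q| := mul_le_mul_of_nonneg_left (le_abs_self q) hτ0.le
  linarith

section Estimator

variable {Ω : Type*} {p : ℕ}

/-- The empirical covariances `X_k^⊤ (X_j - X_{-j} g) / T` of regressors and residuals. -/
noncomputable def score (T : ℕ) (x : ℤ → Fin p → Ω → ℝ) (j : Fin p) (g : {k : Fin p // k ≠ j} → ℝ)
    (ω : Ω) (k : Fin p) : ℝ :=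
  (∑ t ∈ Finset.Icc (1 : ℤ) T, x t k ω * (x t j ω - ∑ l, g l * x t l.1 ω)) / T

/-- The quadratic form `‖X_{-j} h‖_T²`. -/
noncomputable def gramForm (T : ℕ) (x : ℤ → Fin p → Ω → ℝ) (j : Fin p)
    (h : {k : Fin p // k ≠ j} → ℝ) (ω : Ω) : ℝ :=
  (∑ t ∈ Finset.Icc (1 : ℤ) T, (∑ k, h k * x t k.1 ω) ^ 2) / T

variable {T : ℕ} {x : ℤ → Fin p → Ω → ℝ} {j : Fin p} {ω : Ω}

lemma gramForm_nonneg (h : {k : Fin p // k ≠ j} → ℝ) : 0 ≤ gramForm T x j h ω :=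
  div_nonneg (Finset.sum_nonneg fun _ _ => sq_nonneg _) (Nat.cast_nonneg _)

lemma sum_mul_score (g h : {k : Fin p // k ≠ j} → ℝ) :
    ∑ k : {k : Fin p // k ≠ j}, h k * score T x j g ω k =
      (∑ t ∈ Finset.Icc (1 : ℤ) T, (∑ k, h k * x t k.1 ω) * (x t j ω - ∑ l, g l * x t l.1 ω)) / T := by
  simp only [score, Finset.sum_mul, Finset.mul_sum, mul_div_assoc', ← Finset.sum_div]
  rw [Finset.sum_comm]
  congr 1
  refine Finset.sum_congr rfl fun t _ => Finset.sum_congr rfl fun k _ => ?_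
  ring

lemma residNormSq_add (g h : {k : Fin p // k ≠ j} → ℝ) (τ : ℝ) :
    residNormSq T x j (fun k => g k + τ * h k) ω =
      residNormSq T x j g ω - 2 * τ * ∑ k : {k : Fin p // k ≠ j}, h k * score T x j g ω k +
        τ ^ 2 * gramForm T x j h ω := by
  rw [sum_mul_score]
  simp only [residNormSq, gramForm, mul_div_assoc', ← sub_div, ← add_div, Finset.mul_sum (s := Finset.Icc _ _),
    ← Finset.sum_sub_distrib, ← Finset.sum_add_distrib]
  congr 1
  refine Finset.sum_congr rfl fun t _ => ?_
  have : ∑ k : {k : Fin p // k ≠ j}, (g k + τ * h k) * x t k.1 ω =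
      ∑ k, g k * x t k.1 ω + τ * ∑ k, h k * x t k.1 ω := by
    rw [Finset.mul_sum, ← Finset.sum_add_distrib]
    exact Finset.sum_congr rfl fun k _ => by ring
  rw [this]; ring

/-- Stationarity of the LASSO in each coordinate. -/
lemma abs_score_le {lam : ℝ} {g : {k : Fin p // k ≠ j} → ℝ} (hlam : 0 ≤ lam)
    (hmin : ∀ z, lassoObj T x j lam g ω ≤ lassoObj T x j lam z ω) (k : {k : Fin p // k ≠ j}) :
    |score T x j g ω k| ≤ lam := by
  classical
  have hdir : ∀ e : ℝ, |e| = 1 → e * score T x j g ω k - lam ≤ 0 := by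
    intro e he
    refine nonpos_of_forall_mul_le (q := gramForm T x j (Pi.single k e) ω) fun τ hτ _ => ?_
    have h1 := hmin (fun l => g l + τ * (Pi.single k e : {k : Fin p // k ≠ j} → ℝ) l)
    unfold lassoObj at h1
    rw [residNormSq_add] at h1
    have h2 : ∑ l : {k : Fin p // k ≠ j}, (Pi.single k e : {k : Fin p // k ≠ j} → ℝ) l *
        score T x j g ω l = e * score T x j g ω k := by
      rw [Finset.sum_eq_single k] <;> simp +contextual
    have h3 : ∑ l, |g l + τ * (Pi.single k e : {k : Fin p // k ≠ j} → ℝ) l| ≤ ∑ l, |g l| + τ := by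
      calc _ ≤ ∑ l, (|g l| + |τ * (Pi.single k e : {k : Fin p // k ≠ j} → ℝ) l|) :=
            Finset.sum_le_sum fun l _ => abs_add_le _ _
        _ = ∑ l, |g l| + τ := by
            rw [Finset.sum_add_distrib]
            congr 1
            rw [Finset.sum_eq_single k]
            · rw [Pi.single_eq_same, abs_mul, he, abs_of_pos hτ, mul_one]
            · intro b _ hb; rw [Pi.single_eq_of_ne hb]; simp
            · simp
    rw [h2] at h1
    have h4 := mul_le_mul_of_nonneg_left h3 (by positivity : 0 ≤ 2 * lam)
    linarith
  have h1 := hdir 1 (by simp)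
  have h2 := hdir (-1) (by simp)
  exact abs_le.2 ⟨by linarith, by linarith⟩

/-- Stationarity of the LASSO along the ray through the estimator. -/
lemma sum_mul_score_eq {lam : ℝ} {g : {k : Fin p // k ≠ j} → ℝ}
    (hmin : ∀ z, lassoObj T x j lam g ω ≤ lassoObj T x j lam z ω) :
    ∑ k : {k : Fin p // k ≠ j}, g k * score T x j g ω k = lam * ∑ k, |g k| := by
  have hdir : ∀ e : ℝ, |e| = 1 →
      e * (∑ k : {k : Fin p // k ≠ j}, g k * score T x j g ω k - lam * ∑ k, |g k|) ≤ 0 := by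
    intro e he
    refine nonpos_of_forall_mul_le (q := gramForm T x j g ω) fun τ hτ hτ1 => ?_
    have h1 := hmin (fun l => g l + (τ * e) * g l)
    unfold lassoObj at h1
    rw [residNormSq_add] at h1
    have hle := abs_le.1 he.le
    have h3 : ∑ l, |g l + (τ * e) * g l| = (1 + τ * e) * ∑ l, |g l| := by
      rw [Finset.mul_sum]
      refine Finset.sum_congr rfl fun l _ => ?_
      rw [show g l + τ * e * g l = (1 + τ * e) * g l by ring, abs_mul, abs_of_nonneg]
      nlinarith [hle.1]
    have h4 : (τ * e) ^ 2 = τ ^ 2 := by rw [mul_pow, ← sq_abs e, he]; ring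
    rw [h3, h4] at h1
    linarith
  have h1 := hdir 1 (by simp)
  have h2 := hdir (-1) (by simp)
  linarith

lemma score_self (g : {k : Fin p // k ≠ j} → ℝ) :
    score T x j g ω j = residNormSq T x j g ω +
      ∑ k : {k : Fin p // k ≠ j}, g k * score T x j g ω k := by
  rw [sum_mul_score]
  simp only [score, residNormSq, ← add_div, ← Finset.sum_add_distrib]
  congr 1
  exact Finset.sum_congr rfl fun t _ => by ring

lemma thetaHat_mul_sampleCov (lam : Fin p → ℝ)
    (gHat : (j : Fin p) → Ω → {k : Fin p // k ≠ j} → ℝ) (k : Fin p) :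
    (thetaHat T x lam gHat ω * sampleCov T x ω) j k =
      (sigmaHatSq T x j (lam j) (gHat j ω) ω)⁻¹ * score T x j (gHat j ω) ω k := by
  rw [Matrix.mul_apply, Fintype.sum_eq_add_sum_subtype_ne _ j]
  simp only [thetaHat, sampleCov, score, Matrix.of_apply, dif_pos, mul_one]
  have : ∀ l : {l : Fin p // l ≠ j}, (if h : l.1 = j then (1 : ℝ) else -gHat j ω ⟨l.1, h⟩) =
      -gHat j ω l := fun l => dif_neg l.2
  simp only [this, mul_assoc, ← Finset.mul_sum, ← mul_add]
  congr 1
  simp only [mul_div_assoc', ← Finset.sum_div, ← add_div]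
  congr 1
  simp only [Finset.mul_sum]
  rw [Finset.sum_comm, ← Finset.sum_add_distrib]
  refine Finset.sum_congr rfl fun t _ => ?_
  rw [mul_sub, Finset.mul_sum, sub_eq_add_neg, ← Finset.sum_neg_distrib]
  congr 1
  · ring
  · exact Finset.sum_congr rfl fun l _ => by ring

lemma abs_one_sub_thetaHat_mul_sampleCov_le {lam : Fin p → ℝ}
    {gHat : (j : Fin p) → Ω → {k : Fin p // k ≠ j} → ℝ} (hlam : 0 ≤ lam j)
    (hmin : ∀ z, lassoObj T x j (lam j) (gHat j ω) ω ≤ lassoObj T x j (lam j) z ω)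
    (hσ : 0 < sigmaHatSq T x j (lam j) (gHat j ω) ω) (k : Fin p) :
    |(1 - thetaHat T x lam gHat ω * sampleCov T x ω) j k| ≤
      (sigmaHatSq T x j (lam j) (gHat j ω) ω)⁻¹ * lam j := by
  rw [Matrix.sub_apply, thetaHat_mul_sampleCov]
  by_cases h : k = j
  · subst h
    have : score T x k (gHat k ω) ω k = sigmaHatSq T x k (lam k) (gHat k ω) ω := by
      rw [score_self, sum_mul_score_eq hmin, sigmaHatSq]
    rw [this, inv_mul_cancel₀ hσ.ne', Matrix.one_apply_eq, sub_self, abs_zero]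
    positivity
  · rw [Matrix.one_apply_ne (Ne.symm h), zero_sub, abs_neg, abs_mul, abs_of_pos (inv_pos.2 hσ)]
    exact mul_le_mul_of_nonneg_left (abs_score_le hlam hmin ⟨k, h⟩) (inv_pos.2 hσ).le

end Estimator

/-! ### Population regression coefficients and the precision matrix -/

section Population

variable {p : ℕ} {A : Matrix (Fin p) (Fin p) ℝ} {γ₀ : ℝ} {j : Fin p}

lemma quadForm_ge_of_spectrum (hA : A.IsHermitian) (h : ∀ e ∈ spectrum ℝ A, γ₀ ≤ e)
    (w : Fin p → ℝ) : γ₀ * ∑ k, w k ^ 2 ≤ w ⬝ᵥ A.mulVec w := by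
  have hps : (A - algebraMap ℝ (Matrix (Fin p) (Fin p) ℝ) γ₀).PosSemidef := by
    rw [Matrix.posSemidef_iff_isHermitian_and_spectrum_nonneg]
    refine ⟨hA.sub ?_, ?_⟩
    · rw [Matrix.algebraMap_eq_diagonal]
      exact Matrix.isHermitian_diagonal _
    · rw [← spectrum.sub_singleton_eq]
      rintro _ ⟨e, he, _, rfl, rfl⟩
      have := h e he
      simpa using this
  have := hps.dotProduct_mulVec_nonneg w
  rw [Matrix.sub_mulVec, dotProduct_sub, Algebra.algebraMap_eq_smul_one, Matrix.smul_mulVec,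
    Matrix.one_mulVec, dotProduct_smul] at this
  simp only [star_trivial] at this
  have h2 : w ⬝ᵥ w = ∑ k, w k ^ 2 := by
    simp only [dotProduct, sq]
  rw [h2, smul_eq_mul] at this
  linarith

/-- The principal submatrix without the index `j`. -/
abbrev dropIndex (A : Matrix (Fin p) (Fin p) ℝ) (j : Fin p) :
    Matrix {k : Fin p // k ≠ j} {k : Fin p // k ≠ j} ℝ :=
  A.submatrix (Subtype.val : {k : Fin p // k ≠ j} → Fin p)
    (Subtype.val : {k : Fin p // k ≠ j} → Fin p)

lemma quadForm_dropIndex_ge (hq : ∀ w : Fin p → ℝ, γ₀ * ∑ k, w k ^ 2 ≤ w ⬝ᵥ A.mulVec w)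
    (h : {k : Fin p // k ≠ j} → ℝ) :
    γ₀ * ∑ k, h k ^ 2 ≤ h ⬝ᵥ (dropIndex A j).mulVec h := by
  have h1 := hq (fun k => if hk : k ≠ j then h ⟨k, hk⟩ else 0)
  have hsub : ∀ l : {l : Fin p // l ≠ j}, (if hk : l.1 ≠ j then h ⟨l.1, hk⟩ else 0) = h l :=
    fun l => dif_pos l.2
  simp only [dotProduct, Matrix.mulVec, Fintype.sum_eq_add_sum_subtype_ne _ j, hsub] at h1
  simpa [dotProduct, Matrix.mulVec] using h1

/-- The regression coefficients of coordinate `j` on the others, for a general matrix of second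
moments. -/
noncomputable def regCoef (A : Matrix (Fin p) (Fin p) ℝ) (j : Fin p) : {k : Fin p // k ≠ j} → ℝ :=
  Matrix.mulVec (dropIndex A j)⁻¹ (fun k => A k.1 j)

/-- The variance of the regression error. -/
noncomputable def regVar (A : Matrix (Fin p) (Fin p) ℝ) (j : Fin p) : ℝ :=
  A j j - ∑ l : {l : Fin p // l ≠ j}, A j l * regCoef A j l

/-- The coefficients of the regression error as a linear form in all coordinates. -/
noncomputable def regVec (g : {k : Fin p // k ≠ j} → ℝ) (k : Fin p) : ℝ :=
  if h : k = j then 1 else -g ⟨k, h⟩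

lemma regVec_self (g : {k : Fin p // k ≠ j} → ℝ) : regVec g j = 1 := dif_pos rfl

lemma regVec_sub (g : {k : Fin p // k ≠ j} → ℝ) (l : {k : Fin p // k ≠ j}) :
    regVec g l = -g l := dif_neg l.2

lemma sum_regVec_mul (g : {k : Fin p // k ≠ j} → ℝ) (f : Fin p → ℝ) :
    ∑ k, f k * regVec g k = f j - ∑ l : {l : Fin p // l ≠ j}, f l * g l := by
  rw [Fintype.sum_eq_add_sum_subtype_ne _ j]
  simp only [regVec_self, regVec_sub, mul_neg, Finset.sum_neg_distrib]
  ring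

lemma normal_equations (hA : A.IsHermitian) (hγ₀ : 0 < γ₀)
    (hq : ∀ w : Fin p → ℝ, γ₀ * ∑ k, w k ^ 2 ≤ w ⬝ᵥ A.mulVec w) (k : {k : Fin p // k ≠ j}) :
    ∑ l : {l : Fin p // l ≠ j}, A k l * regCoef A j l = A k j := by
  have hpd : (dropIndex A j).PosDef := by
    refine Matrix.PosDef.of_dotProduct_mulVec_pos (hA.submatrix _) fun h hne => ?_
    refine lt_of_lt_of_le ?_ (quadForm_dropIndex_ge hq h)
    obtain ⟨k, hk⟩ := Function.ne_iff.1 hne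
    refine mul_pos hγ₀ (Finset.sum_pos' (fun _ _ => sq_nonneg _) ⟨k, Finset.mem_univ _, ?_⟩)
    have : h k ≠ 0 := hk
    positivity
  have hdet : IsUnit (dropIndex A j).det := by
    rw [← Matrix.isUnit_iff_isUnit_det]; exact hpd.isUnit
  have h1 : (dropIndex A j).mulVec (regCoef A j) = fun k => A k.1 j := by
    rw [regCoef, Matrix.mulVec_mulVec, Matrix.mul_nonsing_inv _ hdet, Matrix.one_mulVec]
  exact congrFun h1 k

lemma mulVec_regVec (hA : A.IsHermitian) (hγ₀ : 0 < γ₀)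
    (hq : ∀ w : Fin p → ℝ, γ₀ * ∑ k, w k ^ 2 ≤ w ⬝ᵥ A.mulVec w) :
    A.mulVec (regVec (regCoef A j)) = Pi.single j (regVar A j) := by
  ext k
  simp only [Matrix.mulVec, dotProduct]
  rw [sum_regVec_mul]
  by_cases h : k = j
  · subst h; rw [Pi.single_eq_same]; rfl
  · rw [Pi.single_eq_of_ne h, normal_equations hA hγ₀ hq ⟨k, h⟩, sub_self]

lemma regVar_ge (hA : A.IsHermitian) (hγ₀ : 0 < γ₀)
    (hq : ∀ w : Fin p → ℝ, γ₀ * ∑ k, w k ^ 2 ≤ w ⬝ᵥ A.mulVec w) :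
    γ₀ * (1 + ∑ l, regCoef A j l ^ 2) ≤ regVar A j := by
  have h1 := hq (regVec (regCoef A j))
  rw [mulVec_regVec hA hγ₀ hq, dotProduct_single, regVec_self, one_mul,
    Fintype.sum_eq_add_sum_subtype_ne _ j] at h1
  simpa only [regVec_self, regVec_sub, neg_sq, one_pow] using h1

lemma regVar_le (hA : A.IsHermitian) (hγ₀ : 0 < γ₀)
    (hq : ∀ w : Fin p → ℝ, γ₀ * ∑ k, w k ^ 2 ≤ w ⬝ᵥ A.mulVec w) : regVar A j ≤ A j j := by
  have h1 := quadForm_dropIndex_ge (j := j) hq (regCoef A j)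
  have h2 : 0 ≤ γ₀ * ∑ k, regCoef A j k ^ 2 :=
    mul_nonneg hγ₀.le (Finset.sum_nonneg fun _ _ => sq_nonneg _)
  have h3 : regCoef A j ⬝ᵥ (dropIndex A j).mulVec (regCoef A j) =
      ∑ l : {l : Fin p // l ≠ j}, A j l * regCoef A j l := by
    simp only [dotProduct]
    refine Finset.sum_congr rfl fun l _ => ?_
    have e : (dropIndex A j).mulVec (regCoef A j) l = A l j := normal_equations hA hγ₀ hq l
    rw [e, mul_comm]
    have : A j l = A l j := by simpa using hA.apply l.1 j
    rw [this]
  rw [h3] at h1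
  unfold regVar
  linarith

/-- The `j`-th row of the inverse matrix is the normalized vector of regression coefficients. -/
lemma inv_row_eq (hA : A.IsHermitian) (hγ₀ : 0 < γ₀)
    (hq : ∀ w : Fin p → ℝ, γ₀ * ∑ k, w k ^ 2 ≤ w ⬝ᵥ A.mulVec w) (k : Fin p) :
    A⁻¹ j k = (regVar A j)⁻¹ * regVec (regCoef A j) k := by
  have hpd : A.PosDef := by
    refine Matrix.PosDef.of_dotProduct_mulVec_pos hA fun h hne => ?_
    refine lt_of_lt_of_le ?_ (hq h)
    obtain ⟨k, hk⟩ := Function.ne_iff.1 hne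
    refine mul_pos hγ₀ (Finset.sum_pos' (fun _ _ => sq_nonneg _) ⟨k, Finset.mem_univ _, ?_⟩)
    have : h k ≠ 0 := hk
    positivity
  have hdet : IsUnit A.det := by
    rw [← Matrix.isUnit_iff_isUnit_det]; exact hpd.isUnit
  have hpos : 0 < regVar A j := by
    refine lt_of_lt_of_le ?_ (regVar_ge hA hγ₀ hq)
    have : 0 ≤ ∑ l, regCoef A j l ^ 2 := Finset.sum_nonneg fun _ _ => sq_nonneg _
    positivity
  have h1 : regVec (regCoef A j) = A⁻¹.mulVec (Pi.single j (regVar A j)) := by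
    rw [← mulVec_regVec hA hγ₀ hq, Matrix.mulVec_mulVec, Matrix.nonsing_inv_mul _ hdet,
      Matrix.one_mulVec]
  have h2 : A⁻¹ j k = A⁻¹ k j := by simpa using (hA.inv).apply k j
  have h3 := congrFun h1 k
  rw [Matrix.mulVec_single] at h3
  simp at h3
  rw [h3, h2]
  field_simp

lemma numNonzero_regCoef_le (hA : A.IsHermitian) (hγ₀ : 0 < γ₀)
    (hq : ∀ w : Fin p → ℝ, γ₀ * ∑ k, w k ^ 2 ≤ w ⬝ᵥ A.mulVec w) :
    numNonzero (regCoef A j) + 1 ≤ numNonzero (A⁻¹ j) := by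
  classical
  have hpos : 0 < regVar A j := by
    refine lt_of_lt_of_le ?_ (regVar_ge hA hγ₀ hq)
    have : 0 ≤ ∑ l, regCoef A j l ^ 2 := Finset.sum_nonneg fun _ _ => sq_nonneg _
    positivity
  have hj : j ∉ (Finset.univ.filter fun k => regCoef A j k ≠ 0).map
      (Function.Embedding.subtype fun k => k ≠ j) := by
    simp
  unfold numNonzero
  rw [← Finset.card_map (Function.Embedding.subtype fun k => k ≠ j)]
  have : ((Finset.univ.filter fun k => regCoef A j k ≠ 0).map
      (Function.Embedding.subtype fun k => k ≠ j)).card + 1 ≤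
      (Finset.univ.filter fun k => A⁻¹ j k ≠ 0).card := by
    rw [← Finset.card_insert_of_notMem hj]
    refine Finset.card_le_card fun k hk => ?_
    rw [Finset.mem_filter]
    refine ⟨Finset.mem_univ _, ?_⟩
    rw [inv_row_eq hA hγ₀ hq]
    refine mul_ne_zero (inv_ne_zero hpos.ne') ?_
    rw [Finset.mem_insert, Finset.mem_map] at hk
    rcases hk with rfl | ⟨l, hl, rfl⟩
    · rw [regVec_self]; exact one_ne_zero
    · rw [Finset.mem_filter] at hl
      have := regVec_sub (regCoef A j) l
      rw [Function.Embedding.coe_subtype, this]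
      exact neg_ne_zero.2 hl.2
  convert this using 2

end Population

section SecondMoments

variable {Ω : Type*} [MeasurableSpace Ω] {P : Measure Ω} {p : ℕ} {x : ℤ → Fin p → Ω → ℝ}

lemma covMat_isHermitian : (covMat P x).IsHermitian := by
  ext k l
  simp only [Matrix.conjTranspose_apply, covMat, secondMoment, Matrix.of_apply, star_trivial]
  exact integral_congr_ae (Eventually.of_forall fun ω => mul_comm _ _)

lemma projCoef_eq_regCoef (j : Fin p) : projCoef P x j = regCoef (covMat P x) j := rfl

variable (hx2 : ∀ t k, MemLp (x t k) 2 P)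
  (hcov : ∀ t, secondMoment P x t = covMat P x)
include hx2 hcov

omit hx2 in
lemma integral_mul_eq_covMat (t : ℤ) (k l : Fin p) :
    ∫ ω, x t k ω * x t l ω ∂P = covMat P x k l := by
  rw [← hcov t]; rfl

lemma integral_projErr_mul (j : Fin p) (t : ℤ) (k : Fin p) :
    ∫ ω, projErr P x j t ω * x t k ω ∂P =
      covMat P x j k - ∑ l : {l : Fin p // l ≠ j}, projCoef P x j l * covMat P x l k := by
  have hi : ∀ k l, Integrable (fun ω => x t k ω * x t l ω) P := fun k l =>
    (hx2 t k).integrable_mul (hx2 t l)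
  have e : ∀ ω, projErr P x j t ω * x t k ω = x t j ω * x t k ω -
      ∑ l : {l : Fin p // l ≠ j}, projCoef P x j l * (x t l ω * x t k ω) := by
    intro ω
    rw [projErr, sub_mul, Finset.sum_mul]
    congr 1
    exact Finset.sum_congr rfl fun l _ => by ring
  simp only [e]
  rw [integral_sub (hi j k) (integrable_finsetSum _ fun (l : {l : Fin p // l ≠ j}) _ => (hi l.1 k).const_mul _),
    integral_finsetSum _ fun (l : {l : Fin p // l ≠ j}) _ => (hi l.1 k).const_mul _]
  simp only [integral_const_mul, integral_mul_eq_covMat hcov]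

variable {γ₀ : ℝ} (hγ₀ : 0 < γ₀)
  (hq : ∀ w : Fin p → ℝ, γ₀ * ∑ k, w k ^ 2 ≤ w ⬝ᵥ (covMat P x).mulVec w)
include hγ₀ hq

lemma integral_projErr_mul_eq_zero {j : Fin p} (t : ℤ) (k : {k : Fin p // k ≠ j}) :
    ∫ ω, projErr P x j t ω * x t k ω ∂P = 0 := by
  have hs : ∀ k l, covMat P x k l = covMat P x l k := fun k l => by
    simpa using (covMat_isHermitian (P := P) (x := x)).apply l k
  rw [integral_projErr_mul hx2 hcov, sub_eq_zero, hs,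
    ← normal_equations covMat_isHermitian hγ₀ hq k]
  refine Finset.sum_congr rfl fun l _ => ?_
  rw [hs l.1 k.1, projCoef_eq_regCoef, mul_comm]

lemma integral_projErr_sq (j : Fin p) (t : ℤ) :
    ∫ ω, projErr P x j t ω ^ 2 ∂P = regVar (covMat P x) j := by
  have hv : MemLp (projErr P x j t) 2 P :=
    (hx2 t j).sub (memLp_finsetSum _ fun k _ => (hx2 t k.1).const_mul _)
  have hi : ∀ k, Integrable (fun ω => projErr P x j t ω * x t k ω) P := fun k =>
    hv.integrable_mul (hx2 t k)
  have e : ∀ ω, projErr P x j t ω ^ 2 = projErr P x j t ω * x t j ω -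
      ∑ l : {l : Fin p // l ≠ j}, projCoef P x j l * (projErr P x j t ω * x t l ω) := by
    intro ω
    have h1 : ∑ l : {l : Fin p // l ≠ j}, projCoef P x j l * (projErr P x j t ω * x t l ω) =
        projErr P x j t ω * ∑ l : {l : Fin p // l ≠ j}, projCoef P x j l * x t l ω := by
      rw [Finset.mul_sum]
      exact Finset.sum_congr rfl fun l _ => by ring
    rw [h1, ← mul_sub, sq]; rfl
  simp only [e]
  rw [integral_sub (hi j) (integrable_finsetSum _ fun (l : {l : Fin p // l ≠ j}) _ => (hi l.1).const_mul _),
    integral_finsetSum _ fun (l : {l : Fin p // l ≠ j}) _ => (hi l.1).const_mul _]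
  simp only [integral_const_mul, integral_projErr_mul_eq_zero hx2 hcov hγ₀ hq, mul_zero,
    Finset.sum_const_zero, sub_zero]
  rw [integral_projErr_mul hx2 hcov, regVar]
  congr 1
  refine Finset.sum_congr rfl fun l _ => ?_
  have hs : covMat P x l j = covMat P x j l := by
    simpa using (covMat_isHermitian (P := P) (x := x)).apply j l.1
  rw [hs, projCoef_eq_regCoef, mul_comm]

end SecondMoments

/-! ### Row-wise error bounds on a favourable event -/

section RowBounds

variable {Ω : Type*} [MeasurableSpace Ω] {P : Measure Ω} {p T : ℕ} {x : ℤ → Fin p → Ω → ℝ}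
  {j : Fin p} {ω : Ω} {γ₀ : ℝ}

omit [MeasurableSpace Ω] in
lemma gramForm_eq (h : {k : Fin p // k ≠ j} → ℝ) :
    gramForm T x j h ω = ∑ k : {k : Fin p // k ≠ j}, ∑ l : {l : Fin p // l ≠ j},
      h k * h l * sampleCov T x ω k l := by
  simp only [gramForm, sampleCov, Matrix.of_apply, sq, Finset.sum_mul_sum, mul_div_assoc',
    ← Finset.sum_div]
  congr 1
  simp only [Finset.mul_sum]
  rw [Finset.sum_comm]
  refine Finset.sum_congr rfl fun k _ => ?_
  rw [Finset.sum_comm]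
  exact Finset.sum_congr rfl fun l _ => Finset.sum_congr rfl fun t _ => by ring

/-- The empirical quadratic form is bounded below in terms of the Euclidean and the `ℓ¹` norm. -/
lemma gramForm_ge (hq : ∀ w : Fin p → ℝ, γ₀ * ∑ k, w k ^ 2 ≤ w ⬝ᵥ (covMat P x).mulVec w)
    {η : ℝ} (hη : ∀ k l : {k : Fin p // k ≠ j}, |sampleCov T x ω k l - covMat P x k l| ≤ η)
    (h : {k : Fin p // k ≠ j} → ℝ) :
    γ₀ * ∑ k, h k ^ 2 - η * (∑ k, |h k|) ^ 2 ≤ gramForm T x j h ω := by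
  have h1 := quadForm_dropIndex_ge (j := j) hq h
  have h2 : h ⬝ᵥ (dropIndex (covMat P x) j).mulVec h = ∑ k : {k : Fin p // k ≠ j},
      ∑ l : {l : Fin p // l ≠ j}, h k * h l * covMat P x k l := by
    simp only [dotProduct, Matrix.mulVec, Finset.mul_sum]
    refine Finset.sum_congr rfl fun k _ => Finset.sum_congr rfl fun l _ => ?_
    simp only [dropIndex, Matrix.submatrix_apply]; ring
  have h3 : (∑ k, |h k|) ^ 2 * η = ∑ k : {k : Fin p // k ≠ j},
      ∑ l : {l : Fin p // l ≠ j}, |h k| * |h l| * η := by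
    rw [sq, Finset.sum_mul_sum, Finset.sum_mul]
    exact Finset.sum_congr rfl fun k _ => Finset.sum_mul _ _ _
  rw [gramForm_eq]
  have h4 : ∑ k : {k : Fin p // k ≠ j}, ∑ l : {l : Fin p // l ≠ j}, h k * h l * covMat P x k l ≤
      ∑ k : {k : Fin p // k ≠ j}, ∑ l : {l : Fin p // l ≠ j}, h k * h l * sampleCov T x ω k l +
      ∑ k : {k : Fin p // k ≠ j}, ∑ l : {l : Fin p // l ≠ j}, |h k| * |h l| * η := by
    rw [← Finset.sum_add_distrib]
    refine Finset.sum_le_sum fun k _ => ?_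
    rw [← Finset.sum_add_distrib]
    refine Finset.sum_le_sum fun l _ => ?_
    have h5 : |h k * h l * (sampleCov T x ω k l - covMat P x k l)| ≤ |h k| * |h l| * η := by
      rw [abs_mul, abs_mul]
      exact mul_le_mul_of_nonneg_left (hη k l) (by positivity)
    have := (abs_le.1 h5).1
    linarith
  linarith

/-- Deterministic error bounds for one row of the precision matrix: `ρ` is the rate of the penalty
and of the empirical error variance, and `M` measures the excess of the noise over the penalty. -/
lemma row_bounds (hγ₀ : 0 < γ₀)
    (hq : ∀ w : Fin p → ℝ, γ₀ * ∑ k, w k ^ 2 ≤ w ⬝ᵥ (covMat P x).mulVec w)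
    {lam : Fin p → ℝ} {gHat : (j : Fin p) → Ω → {k : Fin p // k ≠ j} → ℝ}
    (hmin : ∀ z, lassoObj T x j (lam j) (gHat j ω) ω ≤ lassoObj T x j (lam j) z ω)
    {M M₁ C₂ C Γ s ρ : ℝ} (hM : 0 ≤ M) (hM₁ : 0 ≤ M₁) (hC₂ : 0 ≤ C₂)
    (hC : C = 2 * (4 + 2 * M) ^ 2 / γ₀)
    (hΓ : √(∑ k, projCoef P x j k ^ 2) ≤ Γ)
    (hs1 : 1 ≤ s) (hs : (numNonzero (projCoef P x j) : ℝ) ≤ s)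
    (hlam : 0 < lam j) (hlamρ : lam j ≤ C₂ * ρ) (hρ : 0 ≤ ρ)
    (hnoise : ∀ h : {k : Fin p // k ≠ j} → ℝ,
      |∑ k : {k : Fin p // k ≠ j}, h k * score T x j (projCoef P x j) ω k| ≤
        lam j / 2 * ∑ k, |h k| + M * lam j * √(∑ k, h k ^ 2))
    (hgram : ∀ k l : {k : Fin p // k ≠ j},
      |sampleCov T x ω k l - covMat P x k l| ≤ γ₀ / (2 * (4 + 2 * M) ^ 2) / s)
    (hres : |residNormSq T x j (projCoef P x j) ω - regVar (covMat P x) j| ≤ M₁ * ρ)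
    (hsρ : s * ρ ≤ 1) (hsmall : (M₁ + 4 * C * C₂ ^ 2 + C₂ * Γ) * (s * ρ) ≤ γ₀ / 2) :
    ∑ k, |(thetaHat T x lam gHat ω - precMat P x) j k| ≤
        (2 / γ₀ * (C * C₂) + 2 / γ₀ ^ 2 * (M₁ + 4 * C * C₂ ^ 2 + C₂ * Γ) * (1 + Γ)) * (s * ρ) ∧
      ∀ k, |(1 - thetaHat T x lam gHat ω * sampleCov T x ω) j k| ≤ 2 / γ₀ * C₂ * ρ := by
  set g := projCoef P x j with hg
  set g' := gHat j ω with hg'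
  set σ2 := regVar (covMat P x) j with hσ2
  set σ2' := sigmaHatSq T x j (lam j) g' ω with hσ2'
  have hs0 : 0 < s := by linarith
  have hC0 : 0 ≤ C := by rw [hC]; positivity
  have hΓ0 : 0 ≤ Γ := (Real.sqrt_nonneg _).trans hΓ
  have hw1 : 1 ≤ √s := Real.one_le_sqrt.2 hs1
  have hw2 : √s * √s = s := Real.mul_self_sqrt hs0.le
  have hexp : residNormSq T x j g' ω = residNormSq T x j g ω -
      2 * ∑ k : {k : Fin p // k ≠ j}, (g' k - g k) * score T x j g ω k +
      gramForm T x j (fun k => g' k - g k) ω := by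
    have := residNormSq_add (T := T) (x := x) (ω := ω) g (fun k => g' k - g k) 1
    simpa using this
  obtain ⟨hΔ, hQ, hz⟩ := lasso_oracle (γ := g) (γ' := g')
    (z := fun k : {k : Fin p // k ≠ j} => score T x j g ω k)
    (Q := gramForm T x j (fun k => g' k - g k) ω) (η := γ₀ / (2 * (4 + 2 * M) ^ 2) / s)
    hlam hM hs1 hs hγ₀ (gramForm_nonneg _) (by positivity) (by
      have := hmin g
      unfold lassoObj at this
      rw [hexp] at this
      linarith) (hnoise _) (gramForm_ge hq hgram _) (by
      apply le_of_eq; field_simp)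
  rw [← hC] at hΔ hQ hz
  have hg1 : ∑ k, |g k| ≤ √s * Γ :=
    (sum_abs_le_sqrt_mul hs).trans (mul_le_mul_of_nonneg_left hΓ (by positivity))
  have hg1' : ∑ k, |g' k| ≤ √s * Γ + C * (lam j * s) := by
    have : ∑ k, |g' k| ≤ ∑ k, |g k| + ∑ k, |g' k - g k| := by
      rw [← Finset.sum_add_distrib]
      refine Finset.sum_le_sum fun k _ => ?_
      have := abs_add_le (g k) (g' k - g k)
      rwa [add_sub_cancel] at this
    linarith
  have hls : lam j ^ 2 * s ≤ C₂ ^ 2 * ρ := by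
    calc lam j ^ 2 * s ≤ (C₂ * ρ) ^ 2 * s := by gcongr
      _ = C₂ ^ 2 * ρ * (s * ρ) := by ring
      _ ≤ C₂ ^ 2 * ρ * 1 := by gcongr
      _ = _ := by ring
  set C₄ := M₁ + 4 * C * C₂ ^ 2 + C₂ * Γ with hC₄
  have hC₄0 : 0 ≤ C₄ := by positivity
  have hσdiff : |σ2' - σ2| ≤ C₄ * (√s * ρ) := by
    have hpen0 : 0 ≤ lam j * ∑ k, |g' k| :=
      mul_nonneg hlam.le (Finset.sum_nonneg fun _ _ => abs_nonneg _)
    have hpen : lam j * ∑ k, |g' k| ≤ C₂ * Γ * (√s * ρ) + C * (lam j ^ 2 * s) := by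
      calc lam j * ∑ k, |g' k| ≤ lam j * (√s * Γ + C * (lam j * s)) := by gcongr
        _ = lam j * (√s * Γ) + C * (lam j ^ 2 * s) := by ring
        _ ≤ C₂ * ρ * (√s * Γ) + C * (lam j ^ 2 * s) := by gcongr
        _ = _ := by ring
    have hQ0 := gramForm_nonneg (T := T) (x := x) (ω := ω) (fun k => g' k - g k)
    have e : σ2' - σ2 = (residNormSq T x j g ω - σ2) -
        2 * ∑ k : {k : Fin p // k ≠ j}, (g' k - g k) * score T x j g ω k +
        gramForm T x j (fun k => g' k - g k) ω + lam j * ∑ k, |g' k| := by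
      rw [hσ2', sigmaHatSq, hexp]; ring
    have h1 := abs_le.1 hres
    have h2 := abs_le.1 hz
    have h3 : C * (lam j ^ 2 * s) ≤ C * (C₂ ^ 2 * ρ) := mul_le_mul_of_nonneg_left hls hC0
    have h4 : ρ ≤ √s * ρ := le_mul_of_one_le_left hρ hw1
    have h5 : (M₁ + 4 * C * C₂ ^ 2) * ρ ≤ (M₁ + 4 * C * C₂ ^ 2) * (√s * ρ) :=
      mul_le_mul_of_nonneg_left h4 (by positivity)
    have h6 : 0 ≤ C₂ * Γ * (√s * ρ) := by positivity
    rw [e, hC₄, abs_le]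
    constructor <;> linarith [h1.1, h1.2, h2.1, h2.2]
  have hss : √s ≤ s := by nlinarith
  have hσ : γ₀ ≤ σ2 := by
    refine le_trans ?_ (regVar_ge covMat_isHermitian hγ₀ hq)
    have : 0 ≤ ∑ l, regCoef (covMat P x) j l ^ 2 := Finset.sum_nonneg fun _ _ => sq_nonneg _
    nlinarith
  have hσ' : γ₀ / 2 ≤ σ2' := by
    have h1 : C₄ * (√s * ρ) ≤ C₄ * (s * ρ) := by gcongr
    have := (abs_le.1 hσdiff).1
    linarith
  have hσ0 : 0 < σ2 := by linarith
  have hσ0' : 0 < σ2' := by linarith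
  have hinv' : σ2'⁻¹ ≤ 2 / γ₀ := by
    rw [← inv_div]; exact inv_anti₀ (by positivity) hσ'
  constructor
  · have hinv : |σ2'⁻¹ - σ2⁻¹| ≤ 2 / γ₀ ^ 2 * (C₄ * (√s * ρ)) := by
      rw [inv_sub_inv hσ0'.ne' hσ0.ne', abs_div, abs_sub_comm, abs_of_pos (mul_pos hσ0' hσ0),
        div_le_iff₀ (mul_pos hσ0' hσ0)]
      have h1 : γ₀ ^ 2 / 2 ≤ σ2' * σ2 := by
        calc γ₀ ^ 2 / 2 = γ₀ / 2 * γ₀ := by ring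
          _ ≤ σ2' * σ2 := by gcongr
      have h2 : 0 ≤ 2 / γ₀ ^ 2 * (C₄ * (√s * ρ)) := by positivity
      calc |σ2' - σ2| ≤ C₄ * (√s * ρ) := hσdiff
        _ = 2 / γ₀ ^ 2 * (C₄ * (√s * ρ)) * (γ₀ ^ 2 / 2) := by field_simp
        _ ≤ _ := mul_le_mul_of_nonneg_left h1 h2
    have hrow : ∀ k, (thetaHat T x lam gHat ω - precMat P x) j k =
        σ2'⁻¹ * (regVec g' k - regVec g k) + (σ2'⁻¹ - σ2⁻¹) * regVec g k := by
      intro k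
      rw [Matrix.sub_apply, precMat, inv_row_eq covMat_isHermitian hγ₀ hq]
      have : thetaHat T x lam gHat ω j k = σ2'⁻¹ * regVec g' k := rfl
      rw [this, hg, projCoef_eq_regCoef]
      ring
    calc ∑ k, |(thetaHat T x lam gHat ω - precMat P x) j k|
        ≤ ∑ k, (σ2'⁻¹ * |regVec g' k - regVec g k| + |σ2'⁻¹ - σ2⁻¹| * |regVec g k|) := by
          refine Finset.sum_le_sum fun k _ => ?_
          rw [hrow]
          refine (abs_add_le _ _).trans (le_of_eq ?_)
          rw [abs_mul, abs_mul, abs_of_pos (inv_pos.2 hσ0')]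
      _ = σ2'⁻¹ * ∑ k, |g' k - g k| + |σ2'⁻¹ - σ2⁻¹| * (1 + ∑ k, |g k|) := by
          rw [Finset.sum_add_distrib, ← Finset.mul_sum, ← Finset.mul_sum,
            Fintype.sum_eq_add_sum_subtype_ne _ j, Fintype.sum_eq_add_sum_subtype_ne _ j]
          simp only [regVec_self, regVec_sub, sub_self, abs_zero, zero_add, abs_one, abs_neg,
            ← neg_sub', abs_neg]
      _ ≤ 2 / γ₀ * (C * (C₂ * ρ * s)) + 2 / γ₀ ^ 2 * (C₄ * (√s * ρ)) * (√s * (1 + Γ)) := by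
          have hs0' : 0 ≤ ∑ k, |g k| := Finset.sum_nonneg fun _ _ => abs_nonneg _
          have h7 : C * (lam j * s) ≤ C * (C₂ * ρ * s) := by gcongr
          refine add_le_add (mul_le_mul hinv' (hΔ.trans h7)
            (Finset.sum_nonneg fun _ _ => abs_nonneg _) (by positivity))
            (mul_le_mul hinv (by linarith) (by positivity) (by positivity))
      _ = 2 / γ₀ * (C * C₂) * (s * ρ) + 2 / γ₀ ^ 2 * C₄ * (1 + Γ) * ((√s * √s) * ρ) := by ring
      _ = _ := by rw [hw2]; ring
  · intro k
    refine (abs_one_sub_thetaHat_mul_sampleCov_le hlam.le hmin hσ0' k).trans ?_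
    calc σ2'⁻¹ * lam j ≤ 2 / γ₀ * (C₂ * ρ) := mul_le_mul hinv' hlamρ hlam.le (by positivity)
      _ = _ := by ring

end RowBounds

/-! ### Probabilities of the favourable events -/

section Exponents

lemma two_lt_sigmaExp {q r : ℝ} (hr : 4 < r) (hq : 2 * r / (r - 2) < q) : 2 < sigmaExp q r := by
  have h2 : 0 < r - 2 := by linarith
  have hq0 : 0 < q := lt_trans (div_pos (by linarith) h2) hq
  rw [div_lt_iff₀ h2] at hq
  rw [sigmaExp, lt_div_iff₀ (by linarith)]
  linarith

lemma sigmaExp_self {r : ℝ} (hr : 0 < r) : sigmaExp r r = r / 2 := by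
  rw [sigmaExp]; field_simp; norm_num

lemma muExp_eq {r b : ℝ} (hr : 0 < r) : muExp r b = fukNagaevExp (sigmaExp r r) b := by
  rw [sigmaExp_self hr, muExp, fukNagaevExp,
    ← mul_div_mul_left ((b + 1) * (r / 2) - 1) (b + r / 2 - 1) two_ne_zero]
  congr 1 <;> ring

lemma one_lt_fukNagaevExp {s a : ℝ} (hs : 2 < s) (ha : (s - 1) / (s - 2) < a) :
    1 < fukNagaevExp s a := by
  have ha0 : 0 < a := lt_trans (div_pos (by linarith) (by linarith)) ha
  rw [fukNagaevExp, lt_div_iff₀ (by linarith)]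
  nlinarith

lemma eLpNorm_mul_le_sigmaExp {Ω : Type*} [MeasurableSpace Ω] {P : Measure Ω} {f g : Ω → ℝ}
    (hf : Measurable f) (hg : Measurable g) {q r k l : ℝ} (hq : 0 < q) (hr : 0 < r) (hk : 0 ≤ k)
    (hfk : eLpNorm f (ENNReal.ofReal q) P ≤ ENNReal.ofReal k)
    (hgl : eLpNorm g (ENNReal.ofReal r) P ≤ ENNReal.ofReal l) :
    eLpNorm (fun ω => f ω * g ω) (ENNReal.ofReal (sigmaExp q r)) P ≤ ENNReal.ofReal (k * l) := by
  have : ENNReal.HolderTriple (ENNReal.ofReal q) (ENNReal.ofReal r)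
      (ENNReal.ofReal (sigmaExp q r)) := by
    constructor
    rw [← ENNReal.ofReal_inv_of_pos hq, ← ENNReal.ofReal_inv_of_pos hr,
      ← ENNReal.ofReal_inv_of_pos (by unfold sigmaExp; positivity),
      ← ENNReal.ofReal_add (by positivity) (by positivity)]
    congr 1
    rw [sigmaExp]; field_simp; ring
  rw [ENNReal.ofReal_mul hk]
  exact (eLpNorm_smul_le_mul_eLpNorm (μ := P) hg.aestronglyMeasurable
    hf.aestronglyMeasurable).trans (mul_le_mul' hfk hgl)

/-- At the multiple `m` of the tuning rate, the Fuk–Nagaev bound is of order `1 / p`. -/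
lemma fuk_nagaev_at_tuningRate {κ δ B m : ℝ} {p T : ℕ} (hκ : 0 < κ) (hδ : δ ∈ Set.Ioo (0 : ℝ) 1)
    (hp : 1 ≤ p) (hT : 1 ≤ T) (hm : 0 < m) (hB : 0 < B) (hBm : 1 ≤ B * m ^ 2) :
    T * (T * (m * tuningRate κ δ p T)) ^ (-κ) +
        Real.exp (-(B * ((T * (m * tuningRate κ δ p T)) ^ 2 / T))) ≤
      (m ^ (-κ) + Real.exp (1 - B * m ^ 2)) / p := by
  have hδ0 := hδ.1
  have hp0 : (0 : ℝ) < p := by exact_mod_cast hp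
  have hT0 : (0 : ℝ) < T := by exact_mod_cast hT
  set X : ℝ := ((p : ℝ) / (δ * (T : ℝ) ^ (κ - 1))) ^ (1 / κ) with hX
  have hX0 : 0 < X := by positivity
  set R := tuningRate κ δ p T with hR
  have hXR : X ≤ R := le_max_left _ _
  have hR0 : 0 < R := hX0.trans_le hXR
  have hLR : √(Real.log (8 * p / δ) / T) ≤ R := le_max_right _ _
  have hlog : Real.log p + 1 ≤ Real.log (8 * p / δ) := by
    have h1 : (p : ℝ) * Real.exp 1 ≤ 8 * p / δ := by
      rw [le_div_iff₀ hδ0]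
      have h3 := Real.exp_one_lt_three
      have : (p : ℝ) * Real.exp 1 * δ ≤ p * 3 * 1 := by gcongr; exact hδ.2.le
      linarith
    calc Real.log p + 1 = Real.log (p * Real.exp 1) := by
          rw [Real.log_mul hp0.ne' (Real.exp_pos _).ne', Real.log_exp]
      _ ≤ _ := Real.log_le_log (by positivity) h1
  have hlogp : 0 ≤ Real.log p := Real.log_nonneg (by exact_mod_cast hp)
  rw [add_div]
  refine add_le_add ?_ ?_
  · have e1 : (T * (m * R)) ^ (-κ) ≤ (T * (m * X)) ^ (-κ) :=
      Real.rpow_le_rpow_of_nonpos (by positivity) (by gcongr) (by linarith)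
    have e2 : X ^ (-κ) = δ * (T : ℝ) ^ (κ - 1) / p := by
      rw [hX, ← Real.rpow_mul (by positivity), show 1 / κ * -κ = -1 by field_simp,
        Real.rpow_neg_one, inv_div]
    have e3 : (T : ℝ) * ((T : ℝ) ^ (-κ) * (T : ℝ) ^ (κ - 1)) = 1 := by
      rw [← Real.rpow_add hT0]
      nth_rewrite 1 [← Real.rpow_one (T : ℝ)]
      rw [← Real.rpow_add hT0, show 1 + (-κ + (κ - 1)) = 0 by ring, Real.rpow_zero]
    calc T * (T * (m * R)) ^ (-κ) ≤ T * (T * (m * X)) ^ (-κ) := by gcongr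
      _ = T * ((T : ℝ) ^ (-κ) * (T : ℝ) ^ (κ - 1)) * (m ^ (-κ) * δ / p) := by
          rw [Real.mul_rpow hT0.le (by positivity), Real.mul_rpow hm.le hX0.le, e2]; ring
      _ = m ^ (-κ) * δ / p := by rw [e3, one_mul]
      _ ≤ m ^ (-κ) * 1 / p := by gcongr; exact hδ.2.le
      _ = _ := by rw [mul_one]
  · have h1 : Real.log (8 * p / δ) / T ≤ R ^ 2 := by
      rw [← Real.sqrt_le_left hR0.le]
      exact hLR
    have h2 : m ^ 2 * Real.log (8 * p / δ) ≤ (T * (m * R)) ^ 2 / T := by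
      rw [div_le_iff₀ hT0] at h1
      calc m ^ 2 * Real.log (8 * p / δ) ≤ m ^ 2 * (R ^ 2 * T) := by gcongr
        _ = _ := by field_simp
    have h3 : (p : ℝ)⁻¹ = Real.exp (-Real.log p) := by rw [Real.exp_neg, Real.exp_log hp0]
    rw [div_eq_mul_inv (Real.exp (1 - B * m ^ 2)), h3, ← Real.exp_add]
    refine Real.exp_le_exp.2 ?_
    have h4 := mul_le_mul_of_nonneg_left h2 hB.le
    have h5 : B * m ^ 2 * (Real.log p + 1) ≤ B * m ^ 2 * Real.log (8 * p / δ) :=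
      mul_le_mul_of_nonneg_left hlog (by positivity)
    have h6 : 1 * Real.log p ≤ B * m ^ 2 * Real.log p := mul_le_mul_of_nonneg_right hBm hlogp
    linarith

end Exponents

section Events

variable {Ω : Type*} [MeasurableSpace Ω] {P : Measure Ω} [IsProbabilityMeasure P]

/-- If each coordinate of the noise exceeds the penalty with probability `O(1 / N)`, where `N` is at
least the number of coordinates, then with high probability boundedly many coordinates do so, and
their contribution is controlled by the Cauchy–Schwarz inequality. -/
lemma measureReal_noise_le {ι : Type*} [Fintype ι] {z : ι → Ω → ℝ} (hz : ∀ k, Measurable (z k))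
    {N A₀ A₁ u v lam M : ℝ} (hN : 0 < N) (hcard : (Fintype.card ι : ℝ) ≤ N) (hA₀ : 0 ≤ A₀)
    (hA₁ : 0 ≤ A₁)
    (h0 : ∀ k, P.real {ω | u < |z k ω|} ≤ A₀ / N) (h1 : ∀ k, P.real {ω | v < |z k ω|} ≤ A₁ / N)
    {n : ℕ} (hn : 1 ≤ n) (hlam : 0 < lam) (hu : u ≤ lam / 2) (hv0 : 0 ≤ v)
    (hv : v * √n ≤ M * lam) :
    P.real {ω | ¬ ∀ h : ι → ℝ, |∑ k, h k * z k ω| ≤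
      lam / 2 * ∑ k, |h k| + M * lam * √(∑ k, h k ^ 2)} ≤ A₀ / n + A₁ := by
  classical
  set E : ι → Set Ω := fun k => {ω | u < |z k ω|} with hE
  have hEm : ∀ k, MeasurableSet (E k) := fun k => measurableSet_lt measurable_const (hz k).abs
  set cnt : Ω → ℝ := fun ω => ∑ k, (E k).indicator (fun _ => (1 : ℝ)) ω with hcnt
  have hind : ∀ k, Integrable ((E k).indicator (fun _ => (1 : ℝ))) P := fun k =>
    (integrable_const (1 : ℝ)).indicator (hEm k)
  have hn0 : (0 : ℝ) < n := by exact_mod_cast hn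
  have hcount : P.real {ω | (n : ℝ) ≤ cnt ω} ≤ A₀ / n := by
    have hmk := mul_meas_ge_le_integral_of_nonneg (μ := P) (f := cnt)
      (Eventually.of_forall fun ω => Finset.sum_nonneg fun k _ =>
        Set.indicator_nonneg (fun _ _ => zero_le_one) _)
      (integrable_finsetSum _ fun k _ => hind k) n
    have hint : ∫ ω, cnt ω ∂P ≤ A₀ := by
      rw [hcnt, integral_finsetSum _ fun k _ => hind k]
      calc _ ≤ ∑ _k : ι, A₀ / N := by
            refine Finset.sum_le_sum fun k _ => ?_
            rw [integral_indicator (hEm k)]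
            simpa using h0 k
        _ = Fintype.card ι * (A₀ / N) := by simp
        _ ≤ N * (A₀ / N) := by gcongr
        _ = A₀ := by field_simp
    rw [le_div_iff₀ hn0, mul_comm]
    exact hmk.trans hint
  have hmax : P.real (⋃ k, {ω | v < |z k ω|}) ≤ A₁ := by
    refine (measureReal_iUnion_fintype_le _).trans ?_
    calc _ ≤ ∑ _k : ι, A₁ / N := Finset.sum_le_sum fun k _ => h1 k
      _ = Fintype.card ι * (A₁ / N) := by simp
      _ ≤ N * (A₁ / N) := by gcongr
      _ = A₁ := by field_simp
  refine (measureReal_mono (s₂ := {ω | (n : ℝ) ≤ cnt ω} ∪ ⋃ k, {ω | v < |z k ω|}) ?_).trans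
    ((measureReal_union_le _ _).trans (add_le_add hcount hmax))
  intro ω hω
  by_contra hcon
  simp only [Set.mem_union, Set.mem_iUnion, Set.mem_ofPred_eq, not_or, not_exists, not_lt,
    not_le] at hcon
  refine hω fun h => ?_
  set b : Finset ι := Finset.univ.filter fun k => u < |z k ω| with hb
  have hbn : (b.card : ℝ) ≤ n := by
    refine le_trans (le_of_eq ?_) hcon.1.le
    rw [hcnt, hb, Finset.card_filter]
    push_cast
    refine Finset.sum_congr rfl fun k _ => ?_
    simp [hE, Set.indicator_apply]
  have hbs : ∑ k ∈ b, |h k| ≤ √n * √(∑ k, h k ^ 2) := by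
    rw [← Real.sqrt_mul' _ (Finset.sum_nonneg fun k _ => sq_nonneg _)]
    refine Real.le_sqrt_of_sq_le (sq_sum_le_card_mul_sum_sq.trans ?_)
    refine mul_le_mul hbn ?_ (Finset.sum_nonneg fun k _ => sq_nonneg _) (by positivity)
    simp only [sq_abs]
    exact Finset.sum_le_sum_of_subset_of_nonneg (Finset.filter_subset _ _) fun k _ _ => sq_nonneg _
  calc |∑ k, h k * z k ω| ≤ ∑ k, |h k * z k ω| := Finset.abs_sum_le_sum_abs _ _
    _ ≤ ∑ k, (lam / 2 * |h k| + if u < |z k ω| then v * |h k| else 0) := by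
        refine Finset.sum_le_sum fun k _ => ?_
        rw [abs_mul]
        split_ifs with hk
        · have := mul_le_mul_of_nonneg_left (hcon.2 k) (abs_nonneg (h k))
          have : 0 ≤ lam / 2 * |h k| := by positivity
          linarith
        · have := mul_le_mul_of_nonneg_left ((not_lt.1 hk).trans hu) (abs_nonneg (h k))
          linarith
    _ = lam / 2 * ∑ k, |h k| + v * ∑ k ∈ b, |h k| := by
        rw [Finset.sum_add_distrib, ← Finset.mul_sum, hb, Finset.sum_filter]
        congr 1
        rw [Finset.mul_sum]
        simp only [mul_ite, mul_zero]
    _ ≤ lam / 2 * ∑ k, |h k| + M * lam * √(∑ k, h k ^ 2) := by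
        have h2 := mul_le_mul_of_nonneg_left hbs hv0
        have h3 := mul_le_mul_of_nonneg_right hv (Real.sqrt_nonneg (∑ k, h k ^ 2))
        linarith

variable {p : ℕ} {x : ℤ → Fin p → Ω → ℝ} {q r a b c K γ₀ A B : ℝ} {j : Fin p}

omit [IsProbabilityMeasure P] in
lemma measurable_projErr (hx : ∀ t k, Measurable (x t k)) (t : ℤ) :
    Measurable (projErr P x j t) :=
  (hx t j).sub (Finset.measurable_sum _ fun k _ => (hx t k.1).const_mul _)

omit [IsProbabilityMeasure P] in
lemma measurable_score (hx : ∀ t k, Measurable (x t k)) (T : ℕ) (k : Fin p) :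
    Measurable fun ω => score T x j (projCoef P x j) ω k :=
  (Finset.measurable_sum _ fun t _ => (hx t k).mul (measurable_projErr hx t)).div_const _

omit [IsProbabilityMeasure P] in
lemma measureReal_score_le (hx : ∀ t k, Measurable (x t k)) (hq0 : 0 < q) (hr0 : 0 < r)
    (hK : 0 < K) (hx2 : ∀ t k, MemLp (x t k) 2 P)
    (hreg : RegressionData P (projErr P x j) (others x j) q r a b c K)
    (hcov : ∀ t, secondMoment P x t = covMat P x) (hγ₀ : 0 < γ₀)
    (hq : ∀ w : Fin p → ℝ, γ₀ * ∑ k, w k ^ 2 ≤ w ⬝ᵥ (covMat P x).mulVec w)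
    (hFN : FukNagaevBound P (sigmaExp q r) a c (K * K) A B) {T : ℕ} (hT : 1 ≤ T) {u : ℝ}
    (hu : 0 < u) (k : {k : Fin p // k ≠ j}) :
    P.real {ω | u < |score T x j (projCoef P x j) ω k|} ≤
      A * (T * (T * u) ^ (-fukNagaevExp (sigmaExp q r) a) +
        Real.exp (-(B * ((T * u) ^ 2 / T)))) := by
  have hT0 : (0 : ℝ) < T := by exact_mod_cast hT
  have h1 := hFN (fun t ω => projErr P x j t ω * x t k ω)
    (fun t => (measurable_projErr hx t).mul (hx t k))
    (fun t => eLpNorm_mul_le_sigmaExp (measurable_projErr hx t) (hx t k) hq0 hr0 hK.le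
      (hreg.moment_u t) (hreg.moment_x t k))
    (fun n hn => hreg.mixing_ux k n hn) T (T * u) hT (by positivity)
  refine le_trans (le_of_eq ?_) h1
  congr 1
  ext ω
  simp only [Set.mem_ofPred_eq]
  simp only [integral_projErr_mul_eq_zero hx2 hcov hγ₀ hq, sub_zero]
  have e : score T x j (projCoef P x j) ω k =
      (∑ t ∈ Finset.Icc (1 : ℤ) T, projErr P x j t ω * x t k ω) / T := by
    rw [score]
    congr 1
    exact Finset.sum_congr rfl fun t _ => mul_comm _ _
  rw [e, abs_div, abs_of_pos hT0, lt_div_iff₀ hT0, mul_comm u]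

lemma measureReal_gram_le (hx : ∀ t k, Measurable (x t k)) (hr0 : 0 < r) (hK : 0 < K)
    (hreg : RegressionData P (projErr P x j) (others x j) q r a b c K)
    (hcov : ∀ t, secondMoment P x t = covMat P x)
    (hFN : FukNagaevBound P (sigmaExp r r) b c (K * K) A B) {T : ℕ} (hT : 1 ≤ T) {u : ℝ}
    (hu : 0 < u) (hA : 0 ≤ A) :
    P.real {ω | ¬ ∀ k l : {k : Fin p // k ≠ j}, |sampleCov T x ω k l - covMat P x k l| ≤ u} ≤
      (p : ℝ) ^ 2 * (A * (T * (T * u) ^ (-fukNagaevExp (sigmaExp r r) b) +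
        Real.exp (-(B * ((T * u) ^ 2 / T))))) := by
  have hT0 : (0 : ℝ) < T := by exact_mod_cast hT
  have h1 : ∀ kl : {k : Fin p // k ≠ j} × {k : Fin p // k ≠ j},
      P.real {ω | u < |sampleCov T x ω kl.1 kl.2 - covMat P x kl.1 kl.2|} ≤
      A * (T * (T * u) ^ (-fukNagaevExp (sigmaExp r r) b) +
        Real.exp (-(B * ((T * u) ^ 2 / T)))) := by
    rintro ⟨k, l⟩
    have h1 := hFN (fun t ω => x t k ω * x t l ω)
      (fun t => (hx t k).mul (hx t l))
      (fun t => eLpNorm_mul_le_sigmaExp (hx t k) (hx t l) hr0 hr0 hK.le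
        (hreg.moment_x t k) (hreg.moment_x t l))
      (fun n hn => hreg.mixing_xx k l n hn) T (T * u) hT (by positivity)
    refine le_trans (le_of_eq ?_) h1
    congr 1
    ext ω
    simp only [Set.mem_ofPred_eq]
    simp only [integral_mul_eq_covMat hcov]
    have e : sampleCov T x ω k l - covMat P x k l =
        (∑ t ∈ Finset.Icc (1 : ℤ) T, (x t k ω * x t l ω - covMat P x k l)) / T := by
      rw [Finset.sum_sub_distrib, sub_div, sampleCov, Matrix.of_apply]
      simp
      field_simp
    rw [e, abs_div, abs_of_pos hT0, lt_div_iff₀ hT0, mul_comm u]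
  have hsub : {ω | ¬ ∀ k l : {k : Fin p // k ≠ j}, |sampleCov T x ω k l - covMat P x k l| ≤ u} ⊆
      ⋃ kl : {k : Fin p // k ≠ j} × {k : Fin p // k ≠ j},
        {ω | u < |sampleCov T x ω kl.1 kl.2 - covMat P x kl.1 kl.2|} := by
    intro ω hω
    simp only [Set.mem_ofPred_eq, not_forall, not_le] at hω
    obtain ⟨k, l, h⟩ := hω
    exact Set.mem_iUnion.2 ⟨(k, l), h⟩
  refine (measureReal_mono hsub).trans ((measureReal_iUnion_fintype_le _).trans
    ((Finset.sum_le_sum fun kl _ => h1 kl).trans ?_))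
  rw [Finset.sum_const, nsmul_eq_mul]
  refine mul_le_mul_of_nonneg_right ?_ (by positivity)
  have hc : Fintype.card {k : Fin p // k ≠ j} ≤ p := by
    simp
  rw [Finset.card_univ, Fintype.card_prod, sq]
  exact_mod_cast Nat.mul_le_mul hc hc

lemma measure_residNormSq_le (hx4 : ∀ t k, MemLp (x t k) 4 P)
    (hcov : ∀ t, secondMoment P x t = covMat P x) (hγ₀ : 0 < γ₀)
    (hq : ∀ w : Fin p → ℝ, γ₀ * ∑ k, w k ^ 2 ≤ w ⬝ᵥ (covMat P x).mulVec w) {T : ℕ} (hT : 1 ≤ T)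
    {L : ℝ} (hL : variance (fun ω => (√(T : ℝ))⁻¹ *
      ∑ t ∈ Finset.Icc (1 : ℤ) T, projErr P x j t ω ^ 2) P ≤ L) {m : ℝ} (hm : 0 < m) :
    P {ω | ¬ |residNormSq T x j (projCoef P x j) ω - regVar (covMat P x) j| ≤ m / √T} ≤
      ENNReal.ofReal (L / m ^ 2) := by
  have hT0 : (0 : ℝ) < T := by exact_mod_cast hT
  have hw : 0 < √(T : ℝ) := Real.sqrt_pos.2 hT0
  have hww : √(T : ℝ) * √(T : ℝ) = T := Real.mul_self_sqrt hT0.le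
  have hx2 : ∀ t k, MemLp (x t k) 2 P := fun t k => (hx4 t k).mono_exponent (by norm_num)
  have hv4 : ∀ t, MemLp (projErr P x j t) 4 P := fun t =>
    (hx4 t j).sub (memLp_finsetSum _ fun k _ => (hx4 t k.1).const_mul _)
  have hv2 : ∀ t, MemLp (fun ω => projErr P x j t ω ^ 2) 2 P := by
    intro t
    have : ENNReal.HolderTriple 4 4 2 := by
      constructor
      have e : (4 : ℝ≥0∞) = ENNReal.ofReal 4 := by simp
      have e2 : (2 : ℝ≥0∞) = ENNReal.ofReal 2 := by simp
      rw [e, e2, ← ENNReal.ofReal_inv_of_pos (by norm_num), ← ENNReal.ofReal_inv_of_pos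
        (by norm_num), ← ENNReal.ofReal_add (by norm_num) (by norm_num)]
      norm_num
    have := (hv4 t).mul (hv4 t) (r := 2)
    simp only [sq]
    exact this
  set X : Ω → ℝ := fun ω => (√(T : ℝ))⁻¹ * ∑ t ∈ Finset.Icc (1 : ℤ) T, projErr P x j t ω ^ 2
    with hX
  have hX2 : MemLp X 2 P := (memLp_finsetSum _ fun t _ => hv2 t).const_mul _
  have hEX : ∫ ω, X ω ∂P = √T * regVar (covMat P x) j := by
    rw [hX, integral_const_mul, integral_finsetSum _ fun t _ => (hv2 t).integrable one_le_two]
    simp only [integral_projErr_sq hx2 hcov hγ₀ hq]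
    simp
    rw [← mul_assoc]
    congr 1
    field_simp
    rw [sq]; exact hww.symm
  have hres : ∀ ω, residNormSq T x j (projCoef P x j) ω - regVar (covMat P x) j =
      (X ω - ∫ ω', X ω' ∂P) / √T := by
    intro ω
    rw [hEX, sub_div, mul_div_cancel_left₀ _ hw.ne']
    congr 1
    simp only [hX, residNormSq]
    nth_rewrite 1 [← hww]
    have : ∀ t, x t j ω - ∑ k, projCoef P x j k * x t k.1 ω = projErr P x j t ω := fun t => rfl
    simp only [this]
    rw [← div_div, inv_mul_eq_div]
  refine (measure_mono ?_).trans ((meas_ge_le_variance_div_sq hX2 hm).trans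
    (ENNReal.ofReal_le_ofReal (div_le_div_of_nonneg_right hL (by positivity))))
  intro ω hω
  simp only [Set.mem_ofPred_eq, not_le] at hω ⊢
  rw [hres, abs_div, abs_of_pos hw, div_lt_div_iff_of_pos_right hw] at hω
  exact hω.le

end Events

/-! ### Comparison of rates -/

section Rates

/-- The rate `p^{1/κ} / T^{1 - 1/κ} ∨ √(log p / T)`. -/
noncomputable def noiseRate (κ : ℝ) (p T : ℕ) : ℝ :=
  max ((p : ℝ) ^ (1 / κ) / (T : ℝ) ^ (1 - 1 / κ)) (√(Real.log p / T))

lemma noiseRate_nonneg (κ : ℝ) (p T : ℕ) : 0 ≤ noiseRate κ p T :=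
  le_max_of_le_right (Real.sqrt_nonneg _)

lemma tuningRate_pos {κ δ : ℝ} {p T : ℕ} (hδ : 0 < δ) (hp : 1 ≤ p) (hT : 1 ≤ T) :
    0 < tuningRate κ δ p T := by
  have hp0 : (0 : ℝ) < p := by exact_mod_cast hp
  have hT0 : (0 : ℝ) < T := by exact_mod_cast hT
  exact lt_max_of_lt_left (by positivity)

/-- For a fixed level `δ`, the tuning rate is of the order of the noise rate. -/
lemma tuningRate_le_noiseRate {κ δ : ℝ} (hκ : 1 < κ) (hδ : δ ∈ Set.Ioo (0 : ℝ) 1) :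
    ∃ C : ℝ, 0 < C ∧ ∀ p T : ℕ, 2 ≤ p → 1 ≤ T → tuningRate κ δ p T ≤ C * noiseRate κ p T := by
  have hδ0 := hδ.1
  have hlog2 : 0 < Real.log 2 := Real.log_pos one_lt_two
  have hlδ : 0 < Real.log (8 / δ) := Real.log_pos (by rw [lt_div_iff₀ hδ0]; linarith [hδ.2])
  set c₁ : ℝ := (δ⁻¹) ^ (1 / κ) with hc₁
  set c₂ : ℝ := √(1 + Real.log (8 / δ) / Real.log 2) with hc₂
  have hc₁0 : 0 < c₁ := by positivity
  have hc₂0 : 0 < c₂ := by positivity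
  refine ⟨c₁ + c₂, by positivity, fun p T hp hT => ?_⟩
  have hp0 : (0 : ℝ) < p := by exact_mod_cast (by omega : 0 < p)
  have hT0 : (0 : ℝ) < T := by exact_mod_cast hT
  have hρ := noiseRate_nonneg κ p T
  refine max_le ?_ ?_
  · have e : ((p : ℝ) / (δ * (T : ℝ) ^ (κ - 1))) ^ (1 / κ) =
        c₁ * ((p : ℝ) ^ (1 / κ) / (T : ℝ) ^ (1 - 1 / κ)) := by
      have h1 : (p : ℝ) / (δ * (T : ℝ) ^ (κ - 1)) = δ⁻¹ * (p / (T : ℝ) ^ (κ - 1)) := by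
        field_simp
      rw [h1, Real.mul_rpow (by positivity) (by positivity), Real.div_rpow hp0.le (by positivity),
        ← Real.rpow_mul hT0.le]
      congr 3
      field_simp
    rw [e]
    have h2 : (p : ℝ) ^ (1 / κ) / (T : ℝ) ^ (1 - 1 / κ) ≤ noiseRate κ p T := le_max_left _ _
    calc _ ≤ c₁ * noiseRate κ p T := by gcongr
      _ ≤ _ := by gcongr; linarith
  · have hlp : Real.log 2 ≤ Real.log p := Real.log_le_log two_pos (by exact_mod_cast hp)
    have h1 : Real.log (8 * p / δ) ≤ (1 + Real.log (8 / δ) / Real.log 2) * Real.log p := by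
      rw [show 8 * (p : ℝ) / δ = p * (8 / δ) by ring, Real.log_mul hp0.ne' (by positivity)]
      have : Real.log (8 / δ) ≤ Real.log (8 / δ) / Real.log 2 * Real.log p := by
        rw [div_mul_eq_mul_div, le_div_iff₀ hlog2]
        gcongr
      linarith
    have h2 : √(Real.log p / T) ≤ noiseRate κ p T := le_max_right _ _
    calc √(Real.log (8 * p / δ) / T) ≤
          √((1 + Real.log (8 / δ) / Real.log 2) * (Real.log p / T)) := by
          refine Real.sqrt_le_sqrt ?_
          rw [← mul_div_assoc]
          gcongr
      _ = c₂ * √(Real.log p / T) := Real.sqrt_mul (by positivity) _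
      _ ≤ c₂ * noiseRate κ p T := by gcongr
      _ ≤ _ := by gcongr; linarith

lemma div_sqrt_le_noiseRate {κ m : ℝ} {p T : ℕ} (hp : 2 ≤ p) (hm : 0 ≤ m) :
    m / √T ≤ m / √(Real.log 2) * noiseRate κ p T := by
  have hlog2 : 0 < Real.log 2 := Real.log_pos one_lt_two
  have hlp : Real.log 2 ≤ Real.log p := Real.log_le_log two_pos (by exact_mod_cast hp)
  have h2 : √(Real.log p / T) ≤ noiseRate κ p T := le_max_right _ _
  have h3 : √(Real.log 2) / √T ≤ noiseRate κ p T := by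
    refine le_trans ?_ h2
    rw [← Real.sqrt_div hlog2.le]
    exact Real.sqrt_le_sqrt (by gcongr)
  have h4 : 0 < √(Real.log 2) := Real.sqrt_pos.2 hlog2
  calc m / √T = m / √(Real.log 2) * (√(Real.log 2) / √T) := by field_simp
    _ ≤ _ := by gcongr

lemma tendsto_mul_noiseRate {κ : ℝ} (hκ : 1 < κ) {p S : ℕ → ℕ}
    (h1 : Tendsto (fun T : ℕ => (S T : ℝ) ^ κ * (p T : ℝ) * (T : ℝ) ^ (1 - κ)) atTop (𝓝 0))
    (h2 : Tendsto (fun T : ℕ => (S T : ℝ) ^ 2 * Real.log (p T) / T) atTop (𝓝 0)) :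
    Tendsto (fun T : ℕ => (S T : ℝ) * noiseRate κ (p T) T) atTop (𝓝 0) := by
  have hκ0 : 0 < κ := by linarith
  have t1 : Tendsto (fun T : ℕ => ((S T : ℝ) ^ κ * (p T : ℝ) * (T : ℝ) ^ (1 - κ)) ^ (1 / κ)) atTop
      (𝓝 0) := by
    have := h1.rpow_const (p := 1 / κ) (Or.inr (by positivity))
    rwa [Real.zero_rpow (by positivity)] at this
  have t2 : Tendsto (fun T : ℕ => √((S T : ℝ) ^ 2 * Real.log (p T) / T)) atTop (𝓝 0) := by
    have := h2.sqrt
    rwa [Real.sqrt_zero] at this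
  have t3 := t1.max t2
  rw [max_self] at t3
  refine t3.congr' ?_
  filter_upwards [eventually_ge_atTop 1] with T hT
  have hT0 : (0 : ℝ) < T := by exact_mod_cast hT
  rw [noiseRate, mul_max_of_nonneg _ _ (Nat.cast_nonneg _)]
  congr 1
  · rw [Real.mul_rpow (by positivity) (by positivity), Real.mul_rpow (by positivity) (by positivity),
      ← Real.rpow_mul (by positivity), ← Real.rpow_mul hT0.le, mul_one_div_cancel hκ0.ne',
      Real.rpow_one, mul_assoc, div_eq_mul_inv ((p T : ℝ) ^ (1 / κ)), ← Real.rpow_neg hT0.le]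
    congr 3
    field_simp
    ring
  · rw [mul_div_assoc, Real.sqrt_mul (sq_nonneg _), Real.sqrt_sq (Nat.cast_nonneg _)]

/-- The Fuk–Nagaev bound for all `p²` entries of the Gram matrix at deviation `η / s`. The
exponential part vanishes by `s ≤ S` and `S² log p / T → 0`. -/
lemma tendsto_gram_bound {μ η A B : ℝ} (hη : 0 < η) (hB : 0 < B) {p s S : ℕ → ℕ}
    (hp : ∀ᶠ T in atTop, 2 ≤ p T) (hs : ∀ T, 1 ≤ s T) (hsS : ∀ T, s T ≤ S T)
    (h1 : Tendsto (fun T : ℕ => (s T : ℝ) ^ μ * (p T : ℝ) ^ 2 * (T : ℝ) ^ (1 - μ)) atTop (𝓝 0))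
    (h2 : Tendsto (fun T : ℕ => (S T : ℝ) ^ 2 * Real.log (p T) / T) atTop (𝓝 0)) :
    Tendsto (fun T : ℕ => (p T : ℝ) ^ 2 * (A * (T * (T * (η / s T)) ^ (-μ) +
      Real.exp (-(B * ((T * (η / s T)) ^ 2 / T)))))) atTop (𝓝 0) := by
  have hlog2 : 0 < Real.log 2 := Real.log_pos one_lt_two
  have t1 : Tendsto (fun T : ℕ => (p T : ℝ) ^ 2 * (T * (T * (η / s T)) ^ (-μ))) atTop (𝓝 0) := by
    have := h1.const_mul (η ^ (-μ))
    rw [mul_zero] at this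
    refine this.congr' ?_
    filter_upwards [eventually_ge_atTop 1] with T hT
    have hT0 : (0 : ℝ) < T := by exact_mod_cast hT
    have hs0 : (0 : ℝ) < s T := by exact_mod_cast hs T
    rw [Real.mul_rpow hT0.le (by positivity), Real.div_rpow hη.le hs0.le, Real.rpow_neg hs0.le,
      div_inv_eq_mul, sub_eq_add_neg, Real.rpow_add hT0, Real.rpow_one]
    ring
  have t2 : Tendsto (fun T : ℕ => (p T : ℝ) ^ 2 * Real.exp (-(B * ((T * (η / s T)) ^ 2 / T))))
      atTop (𝓝 0) := by
    rw [Metric.tendsto_atTop']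
    intro ε hε
    set N : ℝ := |Real.log ε| / Real.log 2 + 1 with hN
    have hN0 : 0 < N := by positivity
    have hev : ∀ᶠ T : ℕ in atTop, (S T : ℝ) ^ 2 * Real.log (p T) / T < B * η ^ 2 / (2 + N) :=
      h2.eventually_lt_const (by positivity)
    obtain ⟨T₀, hT₀⟩ := eventually_atTop.1 (hev.and (hp.and (eventually_ge_atTop 1)))
    refine ⟨T₀, fun T hT => ?_⟩
    obtain ⟨hw, hp2, hT1⟩ := hT₀ T hT.le
    have hT0 : (0 : ℝ) < T := by exact_mod_cast hT1
    have hs0 : (0 : ℝ) < s T := by exact_mod_cast hs T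
    have hp0 : (0 : ℝ) < p T := by exact_mod_cast (by omega : 0 < p T)
    have hlp : Real.log 2 ≤ Real.log (p T) := Real.log_le_log two_pos (by exact_mod_cast hp2)
    have hsS' : (s T : ℝ) ≤ S T := by exact_mod_cast hsS T
    rw [div_lt_div_iff₀ hT0 (by positivity)] at hw
    have h3 : (s T : ℝ) ^ 2 * Real.log (p T) * (2 + N) ≤ B * η ^ 2 * T := by
      refine le_trans ?_ hw.le
      have : 0 ≤ Real.log (p T) := by linarith
      gcongr
    have h4 : (2 + N) * Real.log (p T) ≤ B * ((T * (η / s T)) ^ 2 / T) := by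
      have e : B * ((T * (η / s T)) ^ 2 / T) = B * η ^ 2 * T / (s T : ℝ) ^ 2 := by
        field_simp
      rw [e, le_div_iff₀ (by positivity)]
      linarith
    have h5 : (p T : ℝ) ^ 2 = Real.exp (2 * Real.log (p T)) := by
      rw [two_mul, Real.exp_add, Real.exp_log hp0, sq]
    have h6 : N * Real.log 2 = |Real.log ε| + Real.log 2 := by
      rw [hN]; field_simp
    rw [Real.dist_eq, sub_zero, abs_of_nonneg (by positivity), h5, ← Real.exp_add]
    have h7 : N * Real.log 2 ≤ N * Real.log (p T) := by gcongr
    calc _ < Real.exp (Real.log ε) := by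
          refine Real.exp_lt_exp.2 ?_
          have := neg_abs_le (Real.log ε)
          linarith
      _ = ε := Real.exp_log hε
  have t3 := (t1.add t2).const_mul A
  rw [add_zero, mul_zero] at t3
  refine t3.congr fun T => ?_
  ring

end Rates

/-! ### The rows of the estimated precision matrix -/

section Rows

variable {Ω : Type*} [MeasurableSpace Ω] {P : Measure Ω} [IsProbabilityMeasure P] {p T : ℕ}
  {x : ℤ → Fin p → Ω → ℝ} {q r a b c K γ₀ : ℝ} {j : Fin p}

lemma memLp_of_eLpNorm_le {X : Ω → ℝ} (hX : Measurable X) {s t k : ℝ} (hst : s ≤ t)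
    (h : eLpNorm X (ENNReal.ofReal t) P ≤ ENNReal.ofReal k) : MemLp X (ENNReal.ofReal s) P :=
  MemLp.mono_exponent ⟨hX.aestronglyMeasurable, h.trans_lt ENNReal.ofReal_lt_top⟩
    (ENNReal.ofReal_le_ofReal hst)

/-- The Euclidean norm of the projection coefficients is bounded. -/
lemma sqrt_sum_projCoef_sq_le (hx : ∀ t k, Measurable (x t k)) (hr : 2 ≤ r) (hK : 0 < K)
    (hmom : ∀ t k, eLpNorm (x t k) (ENNReal.ofReal r) P ≤ ENNReal.ofReal K) (hγ₀ : 0 < γ₀)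
    (hq : ∀ w : Fin p → ℝ, γ₀ * ∑ k, w k ^ 2 ≤ w ⬝ᵥ (covMat P x).mulVec w) :
    √(∑ k, projCoef P x j k ^ 2) ≤ K / √γ₀ := by
  have h2 := (integral_abs_rpow_le_of_eLpNorm_le (hx 0 j).aestronglyMeasurable two_pos hK.le
    ((eLpNorm_le_eLpNorm_of_exponent_le (ENNReal.ofReal_le_ofReal hr)
      (hx 0 j).aestronglyMeasurable).trans (hmom 0 j))).2
  have h3 : covMat P x j j ≤ K ^ 2 := by
    refine le_trans (le_of_eq ?_) (h2.trans (le_of_eq (Real.rpow_two K)))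
    simp only [covMat, secondMoment, Matrix.of_apply, Real.rpow_two, sq_abs]
    simp only [sq]
  have h4 := regVar_ge (j := j) covMat_isHermitian hγ₀ hq
  have h5 := regVar_le (j := j) covMat_isHermitian hγ₀ hq
  have h6 : ∑ k, projCoef P x j k ^ 2 ≤ K ^ 2 / γ₀ := by
    rw [le_div_iff₀ hγ₀, projCoef_eq_regCoef]
    linarith
  calc _ ≤ √(K ^ 2 / γ₀) := Real.sqrt_le_sqrt h6
    _ = _ := by rw [Real.sqrt_div (sq_nonneg _), Real.sqrt_sq hK.le]

/-- The probability that the error bounds for one row fail, for given values of the truncation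
constants `n`, `m` and `m₁`. -/
lemma measure_row_failure_le {lam : Fin p → ℝ} {gHat : (j : Fin p) → Ω → {k : Fin p // k ≠ j} → ℝ}
    {δ C₀ C₂ A B A' B' m m₁ L M C M₁ Γ s ρ : ℝ} {n : ℕ}
    (hp : 1 ≤ p) (hT : 1 ≤ T) (hr : 4 < r) (hqr : 2 * r / (r - 2) < q)
    (ha : (sigmaExp q r - 1) / (sigmaExp q r - 2) < a) (hK : 0 < K)
    (hx : ∀ t k, Measurable (x t k))
    (hmom : ∀ t k, eLpNorm (x t k) (ENNReal.ofReal r) P ≤ ENNReal.ofReal K)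
    (hreg : RegressionData P (projErr P x j) (others x j) q r a b c K)
    (hcov : ∀ t, secondMoment P x t = covMat P x) (hγ₀ : 0 < γ₀)
    (hq : ∀ w : Fin p → ℝ, γ₀ * ∑ k, w k ^ 2 ≤ w ⬝ᵥ (covMat P x).mulVec w)
    (hmin : ∀ ω z, lassoObj T x j (lam j) (gHat j ω) ω ≤ lassoObj T x j (lam j) z ω)
    (hA : 0 < A) (hB : 0 < B) (hA' : 0 < A')
    (hFN : FukNagaevBound P (sigmaExp q r) a c (K * K) A B)
    (hFN' : FukNagaevBound P (sigmaExp r r) b c (K * K) A' B')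
    (hδ : δ ∈ Set.Ioo (0 : ℝ) 1) (hC₀ : 0 < C₀) (hBC₀ : 1 ≤ B * (C₀ / 2) ^ 2)
    (hlam : C₀ * tuningRate (fukNagaevExp (sigmaExp q r) a) δ p T ≤ lam j)
    (hn : 1 ≤ n) (hm : 0 < m) (hBm : 1 ≤ B * m ^ 2) (hm₁ : 0 < m₁)
    (hL : variance (fun ω => (√(T : ℝ))⁻¹ *
      ∑ t ∈ Finset.Icc (1 : ℤ) T, projErr P x j t ω ^ 2) P ≤ L)
    (hM : M = m * √n / C₀) (hM₁ : 0 ≤ M₁) (hC₂ : 0 ≤ C₂)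
    (hC : C = 2 * (4 + 2 * M) ^ 2 / γ₀) (hΓ : Γ = K / √γ₀)
    (hs1 : 1 ≤ s) (hs : (numNonzero (projCoef P x j) : ℝ) ≤ s)
    (hlamρ : lam j ≤ C₂ * ρ) (hρ : 0 ≤ ρ) (hm₁ρ : m₁ / √T ≤ M₁ * ρ)
    (hsρ : s * ρ ≤ 1) (hsmall : (M₁ + 4 * C * C₂ ^ 2 + C₂ * Γ) * (s * ρ) ≤ γ₀ / 2) :
    P {ω | ¬ (∑ k, |(thetaHat T x lam gHat ω - precMat P x) j k| ≤
        (2 / γ₀ * (C * C₂) + 2 / γ₀ ^ 2 * (M₁ + 4 * C * C₂ ^ 2 + C₂ * Γ) * (1 + Γ)) * (s * ρ) ∧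
      ∀ k, |(1 - thetaHat T x lam gHat ω * sampleCov T x ω) j k| ≤ 2 / γ₀ * C₂ * ρ)} ≤
    ENNReal.ofReal (A * ((C₀ / 2) ^ (-fukNagaevExp (sigmaExp q r) a) +
        Real.exp (1 - B * (C₀ / 2) ^ 2)) / n +
      A * (m ^ (-fukNagaevExp (sigmaExp q r) a) + Real.exp (1 - B * m ^ 2))) +
    ENNReal.ofReal ((p : ℝ) ^ 2 * (A' * (T * (T * (γ₀ / (2 * (4 + 2 * M) ^ 2) / s)) ^
        (-fukNagaevExp (sigmaExp r r) b) +
        Real.exp (-(B' * ((T * (γ₀ / (2 * (4 + 2 * M) ^ 2) / s)) ^ 2 / T)))))) +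
    ENNReal.ofReal (L / m₁ ^ 2) := by
  have hp0 : (0 : ℝ) < p := by exact_mod_cast hp
  have hq0 : 0 < q := lt_trans (div_pos (by linarith) (by linarith)) hqr
  have hr0 : 0 < r := by linarith
  have hM0 : 0 ≤ M := by rw [hM]; positivity
  have hx2 : ∀ t k, MemLp (x t k) 2 P := fun t k => by
    simpa using memLp_of_eLpNorm_le (s := 2) (hx t k) (by linarith) (hmom t k)
  have hx4 : ∀ t k, MemLp (x t k) 4 P := fun t k => by
    simpa using memLp_of_eLpNorm_le (s := 4) (hx t k) (by linarith) (hmom t k)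
  set κ := fukNagaevExp (sigmaExp q r) a with hκ
  have hκ1 : 1 < κ := one_lt_fukNagaevExp (two_lt_sigmaExp hr hqr) ha
  set R := tuningRate κ δ p T with hR
  have hR0 : 0 < R := tuningRate_pos hδ.1 hp hT
  have hlam0 : 0 < lam j := (mul_pos hC₀ hR0).trans_le hlam
  have htail : ∀ m : ℝ, 0 < m → 1 ≤ B * m ^ 2 → ∀ k : {k : Fin p // k ≠ j},
      P.real {ω | m * R < |score T x j (projCoef P x j) ω k|} ≤
        A * (m ^ (-κ) + Real.exp (1 - B * m ^ 2)) / p := by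
    intro m hm hBm k
    refine (measureReal_score_le hx hq0 hr0 hK hx2 hreg hcov hγ₀ hq hFN hT
      (by positivity : 0 < m * R) k).trans ?_
    rw [mul_div_assoc]
    exact mul_le_mul_of_nonneg_left
      (fuk_nagaev_at_tuningRate (by linarith) hδ hp hT hm hB hBm) hA.le
  have hcard : (Fintype.card {k : Fin p // k ≠ j} : ℝ) ≤ p := by
    have : Fintype.card {k : Fin p // k ≠ j} ≤ p := by simp
    exact_mod_cast this
  have hnoise := measureReal_noise_le (P := P)
    (z := fun (k : {k : Fin p // k ≠ j}) ω => score T x j (projCoef P x j) ω k) (lam := lam j) (M := M)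
    (fun k => measurable_score hx T k) hp0 hcard (by positivity) (by positivity)
    (htail (C₀ / 2) (by positivity) hBC₀) (htail m hm hBm) hn hlam0 (by linarith) (by positivity) (by
      rw [hM]
      calc m * R * √n = m * √n / C₀ * (C₀ * R) := by field_simp
        _ ≤ _ := by gcongr)
  have hgram := measureReal_gram_le hx hr0 hK hreg hcov hFN' hT
    (u := γ₀ / (2 * (4 + 2 * M) ^ 2) / s) (by positivity) hA'.le
  have hres := measure_residNormSq_le hx4 hcov hγ₀ hq hT hL hm₁
  rw [← ENNReal.ofReal_le_ofReal_iff (by positivity), ofReal_measureReal] at hnoise hgram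
  refine le_trans (measure_mono ?_) ((measure_union_le _ _).trans (add_le_add
    ((measure_union_le _ _).trans (add_le_add hnoise hgram)) hres))
  intro ω hω
  by_contra hcon
  simp only [Set.mem_union, Set.mem_ofPred_eq, not_or, not_not] at hcon
  exact hω (row_bounds hγ₀ hq (hmin ω) hM0 hM₁ hC₂ hC
    (hΓ ▸ sqrt_sum_projCoef_sq_le hx (by linarith) hK hmom hγ₀ hq) hs1 hs hlam0 hlamρ hρ
    hcon.1.1 hcon.1.2 (hcon.2.trans hm₁ρ) hsρ hsmall)

end Rows

/-! ### Uniformity over the target rows -/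

lemma abs_rowSumNorm_le {p : ℕ} {A : Matrix (Fin p) (Fin p) ℝ} {G : Finset (Fin p)} {D : ℝ}
    (hD : 0 ≤ D) (h : ∀ j ∈ G, ∑ k, |A j k| ≤ D) : |rowSumNorm A G| ≤ D := by
  rw [rowSumNorm, abs_of_nonneg (Real.iSup_nonneg fun j =>
    Finset.sum_nonneg fun k _ => abs_nonneg _)]
  exact Real.iSup_le (fun j => h j.1 j.2) hD

lemma abs_rowMaxNorm_le {p : ℕ} {A : Matrix (Fin p) (Fin p) ℝ} {G : Finset (Fin p)} {D : ℝ}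
    (hD : 0 ≤ D) (h : ∀ j ∈ G, ∀ k, |A j k| ≤ D) : |rowMaxNorm A G| ≤ D := by
  rw [rowMaxNorm, abs_of_nonneg (Real.iSup_nonneg fun j => Real.iSup_nonneg fun k => abs_nonneg _)]
  exact Real.iSup_le (fun j => Real.iSup_le (fun k => h j.1 j.2 k) hD) hD

lemma bigOP_of_eventually {Ω : Type*} [MeasurableSpace Ω] {P : Measure Ω} {Y : ℕ → Ω → ℝ}
    {ρ : ℕ → ℝ} {E : ℝ → ℕ → Ω → Prop}
    (hE : ∀ ε : ℝ, 0 < ε → ∃ D : ℝ, 0 < D ∧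
      ∀ᶠ T in atTop, P {ω | ¬ E D T ω} ≤ ENNReal.ofReal ε)
    (h : ∀ D T ω, 0 < D → E D T ω → |Y T ω| ≤ D * ρ T) : BigOP P Y ρ := by
  intro ε hε
  obtain ⟨D, hD, hev⟩ := hE ε hε
  refine ⟨D, hD, hev.mono fun T hT => (measure_mono fun ω hω => ?_).trans hT⟩
  simp only [Set.mem_ofPred_eq] at hω ⊢
  exact fun hcon => not_lt.2 (h D T ω hD hcon) hω

lemma regSparsity_le_rowSparsity {Ω : Type*} [MeasurableSpace Ω] {P : Measure Ω} {p : ℕ}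
    {x : ℤ → Fin p → Ω → ℝ} {G : Finset (Fin p)} (hG : G.Nonempty) {γ₀ : ℝ} (hγ₀ : 0 < γ₀)
    (hq : ∀ w : Fin p → ℝ, γ₀ * ∑ k, w k ^ 2 ≤ w ⬝ᵥ (covMat P x).mulVec w) :
    regSparsity P x G ≤ rowSparsity P x G := by
  have h1 : ∀ j ∈ G, numNonzero (projCoef P x j) + 1 ≤ rowSparsity P x G := fun j hj =>
    (numNonzero_regCoef_le covMat_isHermitian hγ₀ hq).trans
      (Finset.le_sup (f := fun j => numNonzero (precMat P x j)) hj)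
  refine max_le ?_ (Finset.sup_le fun j hj => ?_)
  · obtain ⟨j, hj⟩ := hG
    have := h1 j hj
    omega
  · have := h1 j hj
    omega

end NodewiseLasso

theorem mainTheorem7
    (q r a b c K : ℝ) (hr : 4 < r) (hq : 2 * r / (r - 2) < q)
    (ha : (NodewiseLasso.sigmaExp q r - 1) / (NodewiseLasso.sigmaExp q r - 2) < a)
    (hb : (r - 2) / (r - 4) < b) (hc : 0 < c) (hK : 0 < K) :
    ∃ C₀ : ℝ, 0 < C₀ ∧
      ∀ (Ω : Type*) [MeasurableSpace Ω] (P : Measure Ω) [IsProbabilityMeasure P]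
        -- dimensions, covariates, and target rows, indexed by the sample size
        (p : ℕ → ℕ) (x : (T : ℕ) → ℤ → Fin (p T) → Ω → ℝ)
        (G : (T : ℕ) → Finset (Fin (p T))) (g : ℕ)
        (_ : ∀ᶠ T in atTop, 2 ≤ p T) (_ : ∀ T, (G T).card = g)
        -- data
        (_ : ∀ T t k, Measurable (x T t k))
        (_ : ∀ T t k, eLpNorm (x T t k) (ENNReal.ofReal r) P ≤ ENNReal.ofReal K)
        (_ : ∀ T, ∀ j ∈ G T, NodewiseLasso.RegressionData P (NodewiseLasso.projErr P (x T) j)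
          (NodewiseLasso.others (x T) j) q r a b c K)
        -- covariance
        (_ : ∀ T t, NodewiseLasso.secondMoment P (x T) t = NodewiseLasso.covMat P (x T))
        (γ₀ : ℝ) (_ : 0 < γ₀)
        (_ : ∀ T, ∀ e ∈ spectrum ℝ (NodewiseLasso.covMat P (x T)), γ₀ ≤ e)
        -- regularization
        (δ : ℝ) (_ : δ ∈ Set.Ioo (0 : ℝ) 1) (C₁ : ℝ) (lam : (T : ℕ) → Fin (p T) → ℝ)
        (_ : ∀ᶠ T in atTop, ∀ j ∈ G T,
          C₀ * NodewiseLasso.tuningRate (NodewiseLasso.kappaExp q r a) δ (p T) T ≤ lam T j ∧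
          lam T j ≤ C₁ * NodewiseLasso.tuningRate (NodewiseLasso.kappaExp q r a) δ (p T) T)
        -- rates
        (_ : Tendsto (fun T : ℕ =>
          (NodewiseLasso.regSparsity P (x T) (G T) : ℝ) ^ (NodewiseLasso.muExp r b) *
            (p T : ℝ) ^ 2 * (T : ℝ) ^ (1 - NodewiseLasso.muExp r b)) atTop (𝓝 0))
        (c₁ : ℝ) (_ : 0 < c₁)
        (_ : Tendsto (fun T : ℕ => (p T : ℝ) ^ 2 *
          Real.exp (-c₁ * T / (NodewiseLasso.regSparsity P (x T) (G T) : ℝ) ^ 2)) atTop (𝓝 0))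
        -- finite long-run variance of the squared projection errors
        (L : ℝ) (_ : ∀ᶠ T : ℕ in atTop, ∀ j ∈ G T,
          variance (fun ω => (√(T : ℝ))⁻¹ *
            ∑ t ∈ Finset.Icc (1 : ℤ) T, NodewiseLasso.projErr P (x T) j t ω ^ 2) P ≤ L)
        -- additional rate conditions
        (_ : Tendsto (fun T : ℕ =>
          (NodewiseLasso.rowSparsity P (x T) (G T) : ℝ) ^ (NodewiseLasso.kappaExp q r a) *
            (p T : ℝ) * (T : ℝ) ^ (1 - NodewiseLasso.kappaExp q r a)) atTop (𝓝 0))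
        (_ : Tendsto (fun T : ℕ =>
          (NodewiseLasso.rowSparsity P (x T) (G T) : ℝ) ^ 2 * Real.log (p T) / T) atTop (𝓝 0))
        -- nodewise LASSO estimators
        (gHat : (T : ℕ) → (j : Fin (p T)) → Ω → {k : Fin (p T) // k ≠ j} → ℝ)
        (_ : ∀ T, ∀ j ∈ G T, ∀ ω, ∀ z : {k : Fin (p T) // k ≠ j} → ℝ,
          NodewiseLasso.lassoObj T (x T) j (lam T j) (gHat T j ω) ω ≤
            NodewiseLasso.lassoObj T (x T) j (lam T j) z ω),
        NodewiseLasso.BigOP P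
          (fun T ω => NodewiseLasso.rowSumNorm
            (NodewiseLasso.thetaHat T (x T) (lam T) (gHat T) ω -
              NodewiseLasso.precMat P (x T)) (G T))
          (fun T => max
            ((NodewiseLasso.rowSparsity P (x T) (G T) : ℝ) *
              (p T : ℝ) ^ (1 / NodewiseLasso.kappaExp q r a) /
                (T : ℝ) ^ (1 - 1 / NodewiseLasso.kappaExp q r a))
            ((NodewiseLasso.rowSparsity P (x T) (G T) : ℝ) * √(Real.log (p T) / T))) ∧
        NodewiseLasso.BigOP P
          (fun T ω => NodewiseLasso.rowMaxNorm
            (1 - NodewiseLasso.thetaHat T (x T) (lam T) (gHat T) ω *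
              NodewiseLasso.sampleCov T (x T) ω) (G T))
          (fun T => max
            ((p T : ℝ) ^ (1 / NodewiseLasso.kappaExp q r a) /
              (T : ℝ) ^ (1 - 1 / NodewiseLasso.kappaExp q r a))
            (√(Real.log (p T) / T))) := by
  have hς := NodewiseLasso.two_lt_sigmaExp hr hq
  have hr0 : 0 < r := by linarith
  have hKK : 0 < K * K := mul_pos hK hK
  have hςr : 2 < NodewiseLasso.sigmaExp r r := by
    rw [NodewiseLasso.sigmaExp_self hr0]; linarith
  have hb' : (NodewiseLasso.sigmaExp r r - 1) / (NodewiseLasso.sigmaExp r r - 2) < b := by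
    rw [NodewiseLasso.sigmaExp_self hr0]
    refine lt_of_eq_of_lt ?_ hb
    rw [← mul_div_mul_left (r / 2 - 1) (r / 2 - 2) two_ne_zero]
    congr 1 <;> ring
  obtain ⟨A, B, hA, hB, hFN⟩ := NodewiseLasso.fuk_nagaev hς ha hc hKK
  obtain ⟨A', B', hA', hB', hFN'⟩ := NodewiseLasso.fuk_nagaev hςr hb' hc hKK
  set κ := NodewiseLasso.kappaExp q r a with hκ
  have hκ1 : 1 < κ := NodewiseLasso.one_lt_fukNagaevExp hς ha
  -- the exponential part of the tail bound at half the penalty level is then of order `1 / p`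
  set C₀ : ℝ := 2 / √B with hC₀
  have hsB : 0 < √B := Real.sqrt_pos.2 hB
  have hC₀0 : 0 < C₀ := by positivity
  have hBC₀ : B * (C₀ / 2) ^ 2 = 1 := by
    rw [hC₀, div_div_cancel_left' two_ne_zero, inv_pow, Real.sq_sqrt hB.le]
    exact mul_inv_cancel₀ hB.ne'
  refine ⟨C₀, hC₀0, ?_⟩
  intro Ω _ P _ p x G g hp hGg hx hmom hreg hcov γ₀ hγ₀ hspec δ hδ C₁ lam hlam hrate c₁ _ _ L hL
    hS1 hS2 gHat hmin
  have hquad : ∀ T, ∀ w : Fin (p T) → ℝ,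
      γ₀ * ∑ k, w k ^ 2 ≤ w ⬝ᵥ (NodewiseLasso.covMat P (x T)).mulVec w := fun T =>
    NodewiseLasso.quadForm_ge_of_spectrum NodewiseLasso.covMat_isHermitian (hspec T)
  set S : ℕ → ℕ := fun T => NodewiseLasso.rowSparsity P (x T) (G T) with hSdef
  set ρ : ℕ → ℝ := fun T => NodewiseLasso.noiseRate κ (p T) T with hρdef
  have hρ0 : ∀ T, 0 ≤ ρ T := fun T => NodewiseLasso.noiseRate_nonneg κ (p T) T
  have hSρ0 : ∀ T, 0 ≤ (S T : ℝ) * ρ T := fun T => mul_nonneg (Nat.cast_nonneg _) (hρ0 T)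
  have core : ∀ ε : ℝ, 0 < ε → ∃ D : ℝ, 0 < D ∧ ∀ᶠ T in atTop, P {ω | ¬ ∀ j ∈ G T,
      ∑ k, |(NodewiseLasso.thetaHat T (x T) (lam T) (gHat T) ω -
        NodewiseLasso.precMat P (x T)) j k| ≤ D * (S T * ρ T) ∧
      ∀ k, |(1 - NodewiseLasso.thetaHat T (x T) (lam T) (gHat T) ω *
        NodewiseLasso.sampleCov T (x T) ω) j k| ≤ D * ρ T} ≤ ENNReal.ofReal ε := by
    intro ε hε
    rcases Nat.eq_zero_or_pos g with hg0 | hgpos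
    · refine ⟨1, one_pos, Eventually.of_forall fun T => ?_⟩
      have : G T = ∅ := Finset.card_eq_zero.1 ((hGg T).trans hg0)
      simp [this]
    have hG : ∀ T, (G T).Nonempty := fun T => Finset.card_pos.1 (by rw [hGg T]; exact hgpos)
    have hg0 : (0 : ℝ) < g := by exact_mod_cast hgpos
    set s : ℕ → ℕ := fun T => NodewiseLasso.regSparsity P (x T) (G T) with hsdef
    have hs1 : ∀ T, 1 ≤ s T := fun T => le_max_left _ _
    have hsS : ∀ T, s T ≤ S T := fun T =>
      NodewiseLasso.regSparsity_le_rowSparsity (hG T) hγ₀ (hquad T)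
    obtain ⟨Cδ, hCδ, hCδle⟩ := NodewiseLasso.tuningRate_le_noiseRate hκ1 hδ
    -- each of the four failure events for a row receives an equal share of the probability
    set ε' : ℝ := ε / g / 4 with hε'
    have hε'0 : 0 < ε' := by positivity
    obtain ⟨n, hn1, hn⟩ : ∃ n : ℕ, 1 ≤ n ∧
        A * ((C₀ / 2) ^ (-κ) + Real.exp (1 - B * (C₀ / 2) ^ 2)) / n ≤ ε' := by
      have := tendsto_const_div_atTop_nhds_zero_nat
        (A * ((C₀ / 2) ^ (-κ) + Real.exp (1 - B * (C₀ / 2) ^ 2)))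
      obtain ⟨n, h1, h2⟩ := ((eventually_ge_atTop 1).and (this.eventually_le_const hε'0)).exists
      exact ⟨n, h1, h2⟩
    obtain ⟨m, hm0, hBm, hm⟩ : ∃ m : ℝ, 0 < m ∧ 1 ≤ B * m ^ 2 ∧
        A * (m ^ (-κ) + Real.exp (1 - B * m ^ 2)) ≤ ε' := by
      have tB : Tendsto (fun m : ℝ => B * m ^ 2) atTop atTop :=
        (tendsto_pow_atTop two_ne_zero).const_mul_atTop hB
      have t1 : Tendsto (fun m : ℝ => m ^ (-κ)) atTop (𝓝 0) :=
        tendsto_rpow_neg_atTop (by linarith)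
      have t2 : Tendsto (fun m : ℝ => Real.exp (1 - B * m ^ 2)) atTop (𝓝 0) :=
        Real.tendsto_exp_atBot.comp (by
          simpa only [sub_eq_add_neg, Function.comp_def] using
            tendsto_atBot_add_const_left _ (1 : ℝ) (tendsto_neg_atTop_atBot.comp tB))
      have t3 := (t1.add t2).const_mul A
      rw [add_zero, mul_zero] at t3
      obtain ⟨m, h1, h2, h3⟩ := ((eventually_gt_atTop (0 : ℝ)).and
        ((tB.eventually_ge_atTop 1).and (t3.eventually_le_const hε'0))).exists
      exact ⟨m, h1, h2, h3⟩
    set L' : ℝ := |L| + 1 with hL'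
    have hL'0 : 0 < L' := by positivity
    set m₁ : ℝ := √(L' / ε') with hm₁
    have hm₁0 : 0 < m₁ := Real.sqrt_pos.2 (by positivity)
    have hm₁L : L' / m₁ ^ 2 = ε' := by
      rw [hm₁, Real.sq_sqrt (by positivity)]; field_simp
    set M : ℝ := m * √n / C₀ with hM
    have hM0 : 0 ≤ M := by positivity
    set C : ℝ := 2 * (4 + 2 * M) ^ 2 / γ₀ with hC
    set C₂ : ℝ := |C₁| * Cδ with hC₂
    set M₁ : ℝ := m₁ / √(Real.log 2) with hM₁
    set Γ : ℝ := K / √γ₀ with hΓ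
    set D₁ : ℝ := 2 / γ₀ * (C * C₂) + 2 / γ₀ ^ 2 * (M₁ + 4 * C * C₂ ^ 2 + C₂ * Γ) * (1 + Γ)
      with hD₁
    set D₂ : ℝ := 2 / γ₀ * C₂ with hD₂
    have hC₂0 : 0 ≤ C₂ := by positivity
    have hM₁0 : 0 ≤ M₁ := by positivity
    have hD₁0 : 0 ≤ D₁ := by positivity
    have hD₂0 : 0 ≤ D₂ := by positivity
    refine ⟨D₁ + D₂ + 1, by positivity, ?_⟩
    have tSρ := NodewiseLasso.tendsto_mul_noiseRate hκ1 (p := p) (S := S) hS1 hS2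
    have tsmall := tSρ.const_mul (M₁ + 4 * C * C₂ ^ 2 + C₂ * Γ)
    rw [mul_zero] at tsmall
    rw [NodewiseLasso.muExp_eq hr0] at hrate
    have tgram := NodewiseLasso.tendsto_gram_bound (A := A')
      (η := γ₀ / (2 * (4 + 2 * M) ^ 2)) (by positivity) hB' (p := p) (s := s) (S := S) hp hs1 hsS
      hrate hS2
    filter_upwards [hp, hlam, hL, eventually_ge_atTop 1, tSρ.eventually_le_const one_pos,
      tsmall.eventually_le_const (half_pos hγ₀), tgram.eventually_le_const hε'0]
      with T hpT hlamT hLT hT hSρ hsm hgr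
    have hsSr : (s T : ℝ) * ρ T ≤ S T * ρ T :=
      mul_le_mul_of_nonneg_right (by exact_mod_cast hsS T) (hρ0 T)
    have hrow : ∀ j ∈ G T, P {ω | ¬ (∑ k, |(NodewiseLasso.thetaHat T (x T) (lam T) (gHat T) ω -
        NodewiseLasso.precMat P (x T)) j k| ≤ (D₁ + D₂ + 1) * (S T * ρ T) ∧
        ∀ k, |(1 - NodewiseLasso.thetaHat T (x T) (lam T) (gHat T) ω *
        NodewiseLasso.sampleCov T (x T) ω) j k| ≤ (D₁ + D₂ + 1) * ρ T)} ≤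
        ENNReal.ofReal (ε / g) := by
      intro j hj
      have hCδT := hCδle (p T) T hpT hT
      have hR0 : 0 < NodewiseLasso.tuningRate κ δ (p T) T :=
        NodewiseLasso.tuningRate_pos hδ.1 (by omega) hT
      have hnum : (NodewiseLasso.numNonzero (NodewiseLasso.projCoef P (x T) j) : ℝ) ≤ s T := by
        exact_mod_cast (Finset.le_sup
          (f := fun j => NodewiseLasso.numNonzero (NodewiseLasso.projCoef P (x T) j)) hj).trans
          (le_max_right _ _)
      have hlamρ : lam T j ≤ C₂ * ρ T := by
        calc lam T j ≤ C₁ * NodewiseLasso.tuningRate κ δ (p T) T := (hlamT j hj).2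
          _ ≤ |C₁| * NodewiseLasso.tuningRate κ δ (p T) T := by gcongr; exact le_abs_self _
          _ ≤ |C₁| * (Cδ * ρ T) := by gcongr
          _ = C₂ * ρ T := by rw [hC₂]; ring
      have hfail := NodewiseLasso.measure_row_failure_le (P := P) (x := x T) (j := j)
        (gHat := gHat T) (s := s T) (ρ := ρ T) (L := L') (C := C) (M₁ := M₁) (Γ := Γ)
        (by omega) hT hr hq ha hK (hx T) (hmom T) (hreg T j hj) (hcov T) hγ₀ (hquad T)
        (hmin T j hj) hA hB hA' (hFN Ω P) (hFN' Ω P) hδ hC₀0 hBC₀.ge (hlamT j hj).1 hn1 hm0 hBm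
        hm₁0 ((hLT j hj).trans (by have := le_abs_self L; linarith)) hM hM₁0 hC₂0 hC hΓ
        (by exact_mod_cast hs1 T) hnum hlamρ (hρ0 T)
        (NodewiseLasso.div_sqrt_le_noiseRate hpT hm₁0.le) (hsSr.trans hSρ)
        ((mul_le_mul_of_nonneg_left hsSr (by positivity)).trans hsm)
      refine (measure_mono fun ω hω => ?_).trans (hfail.trans ?_)
      · simp only [Set.mem_ofPred_eq] at hω ⊢
        refine fun hcon => hω ⟨hcon.1.trans ?_, fun k => (hcon.2 k).trans ?_⟩
        · calc D₁ * (s T * ρ T) ≤ D₁ * (S T * ρ T) := by gcongr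
            _ ≤ _ := mul_le_mul_of_nonneg_right (by linarith) (hSρ0 T)
        · exact mul_le_mul_of_nonneg_right (by linarith) (hρ0 T)
      · calc _ ≤ ENNReal.ofReal (ε' + ε') + ENNReal.ofReal ε' + ENNReal.ofReal ε' := by
              refine add_le_add (add_le_add (ENNReal.ofReal_le_ofReal (add_le_add hn hm))
                (ENNReal.ofReal_le_ofReal hgr)) (ENNReal.ofReal_le_ofReal hm₁L.le)
          _ = ENNReal.ofReal (ε / g) := by
              rw [← ENNReal.ofReal_add (by positivity) hε'0.le,
                ← ENNReal.ofReal_add (by positivity) hε'0.le]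
              congr 1
              rw [hε']; ring
    refine (measure_mono (t := ⋃ j ∈ G T, _) fun ω hω => ?_).trans
      ((measure_biUnion_finset_le _ _).trans ((Finset.sum_le_sum hrow).trans ?_))
    · simp only [Set.mem_ofPred_eq, not_forall] at hω
      obtain ⟨j, hj, hω⟩ := hω
      exact Set.mem_biUnion hj hω
    · rw [Finset.sum_const, hGg, nsmul_eq_mul, ← ENNReal.ofReal_natCast,
        ← ENNReal.ofReal_mul hg0.le]
      refine ENNReal.ofReal_le_ofReal (le_of_eq ?_)
      field_simp
  have hSρ : ∀ T, max ((S T : ℝ) * (p T : ℝ) ^ (1 / κ) / (T : ℝ) ^ (1 - 1 / κ))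
      ((S T : ℝ) * √(Real.log (p T) / T)) = S T * ρ T := by
    intro T
    simp only [hρdef, NodewiseLasso.noiseRate]
    rw [mul_max_of_nonneg _ _ (Nat.cast_nonneg _), mul_div_assoc]
  constructor
  · refine NodewiseLasso.bigOP_of_eventually core fun D T ω hD h => ?_
    refine NodewiseLasso.abs_rowSumNorm_le ?_ fun j hj => ?_
    · exact mul_nonneg hD.le ((hSρ0 T).trans_eq (hSρ T).symm)
    · exact (h j hj).1.trans_eq (congrArg _ (hSρ T).symm)
  · exact NodewiseLasso.bigOP_of_eventually core fun D T ω hD h =>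
      NodewiseLasso.abs_rowMaxNorm_le (mul_nonneg hD.le (hρ0 T)) fun j hj => (h j hj).2
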